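/- Notation. Let $\mathbb S^2\subset\mathbb R^3$ be the unit sphere with surface measure $d\mathbf m$, $\mathcal R=\mathbf m\times\nabla_{\mathbf m}$ the rotational gradient (with components $\mathcal R_1,\mathcal R_2,\mathcal R_3$, taken in the weak sense), $H^2(\mathbb S^2)$ the real Sobolev space, and for $\alpha\in\mathbb R$ let $\mathcal U f(\mathbf m)=\alpha\int_{\mathbb S^2}|\mathbf m\times\mathbf m'|^2f(\mathbf m')\,d\mathbf m'$ be the Maier–Saupe potential. For a positive function $h$ on $\mathbb S^2$ put $$\mathcal G_hf=\mathcal R\cdot\big(\mathcal Rf+h\,\mathcal R\,\mathcal Uf+f\,\mathcal R\,\mathcal Uh\big),\qquad \mathcal H_hf=\frac fh+\mathcal Uf,\qquad \operatorname{Ker}\mathcal G_h=\Big\{\phi\in H^2(\mathbb S^2):\int_{\mathbb S^2}\phi\,d\mathbf m=0,\ \mathcal G_h\phi=0\Big\},$$ where $\mathcal G_h$ is regarded as an operator in $L^2(\mathbb S^2)$ with domain $H^2(\mathbb S^2)$. A probability density $h\in L^2(\mathbb S^2)$ that is positive almost everywhere is a critical point (of the free energy $\int_{\mathbb S^2}(f\ln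 f+\tfrac12f\,\mathcal Uf)\,d\mathbf m$) if $\ln h+\mathcal Uh$ is constant, and a critical point is stable if $\int_{\mathbb S^2}(\mathcal H_h\phi)\,\phi\,d\mathbf m\ge0$ for every $\phi\in L^2(\mathbb S^2)$ with $\int_{\mathbb S^2}\phi\,d\mathbf m=0$. For $\eta\in\mathbb R$ let $A_k(\eta)=\int_{-1}^1z^ke^{\eta z^2}\,dz$, for $\alpha\in\mathbb R$ let $S_\alpha=\{\eta\in\mathbb R: A_0(\eta)=\alpha(A_2(\eta)-A_4(\eta))\}$, and let $\alpha^*=\inf\{\alpha: S_\alpha\ne\emptyset\}$ $(\approx 6.731393)$. For a unit vector $\mathbf n$ let $h_{\eta,\mathbf n}(\mathbf m)=e^{\eta(\mathbf m\cdot\mathbf n)^2}\big/\int_{\mathbb S^2}e^{\eta(\mathbf m'\cdot\mathbf n)^2}\,d\mathbf m'$. Theorem. Let $\alpha>\alpha^*$ and let $\mathbf n\in\mathbb R^3$ be a unit vector. Then $S_\alpha$ consists of exactly two numbers $\eta_1=\max S_\alpha>\eta_2=\min S_\alpha$. Put $h_i=h_{\eta_i,\mathbf n}$, $i=1,2$.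 Both $h_1$ and $h_2$ are critical points, $h_1$ is stable, and $h_2$ is not stable if $\alpha\neq\frac{15}2$. Moreover: 1. $\mathcal G_{h_1}$ has no positive eigenvalue. If $\alpha\ne\frac{15}2$, then $\mathcal G_{h_2}$ has at least one positive eigenvalue. 2. $\operatorname{Ker}\mathcal G_{h_1}=\{\mathbf\Theta\cdot\mathcal Rh_1:\mathbf\Theta\in\mathbb R^3\}$, and this is a two-dimensional space. 3. If $\phi\in\operatorname{Ker}\mathcal G_{h_1}$, then $\mathcal H_{h_1}\phi=0$. -/

import Mathlib

open MeasureTheory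
open scoped ContDiff InnerProductSpace

noncomputable section

namespace DoiOnsager

/-- Euclidean three-space. -/
abbrev E3 : Type := EuclideanSpace ℝ (Fin 3)

/-- The unit sphere of `ℝ³`. -/
abbrev S2 : Type := Metric.sphere (0 : E3) 1

/-- The surface measure of the unit sphere (total mass `4π`). -/
def σ : Measure S2 := (volume : Measure E3).toSphere

/-- The Hilbert space `L²(S²)` of (classes of) real functions. -/
abbrev L2S : Type := Lp ℝ 2 σ

/-- The cross product of `ℝ³`. -/
def cross (x y : E3) : E3 := WithLp.toLp 2 (crossProduct x.ofLp y.ofLp)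

/-- The `i`-th component of the rotational gradient `m × ∇ψ`. At a point of the sphere it depends
only on the restriction of `ψ` to the sphere, because the cross product with `m` removes the
normal part of the gradient. -/
def rot (i : Fin 3) (ψ : E3 → ℝ) (m : E3) : ℝ := cross m (gradient ψ m) i

/-- `g` is the weak derivative `R_i f` on the sphere. The operator `R_i` is antisymmetric for the
surface measure, and the test functions are the smooth functions on the sphere, written as
restrictions of smooth functions on `ℝ³`. -/
def HasWeakRot (i : Fin 3) (f g : S2 → ℝ) : Prop :=
  ∀ ψ : E3 → ℝ, ContDiff ℝ ∞ ψ → ∫ m, g m * ψ m ∂σ = - ∫ m, f m * rot i ψ m ∂σ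

/-- Membership in the Sobolev space `H^k(S²)`. The fields `R_1, R_2, R_3` span every tangent
space of the sphere. -/
def MemH : ℕ → (S2 → ℝ) → Prop
  | 0, f => MemLp f 2 σ
  | k + 1, f => MemLp f 2 σ ∧ ∀ i, ∃ g, MemH k g ∧ HasWeakRot i f g

open Classical in
/-- The weak derivative `R_i f ∈ L²(S²)`, unique almost everywhere when it exists. -/
def weakRot (i : Fin 3) (f : S2 → ℝ) : S2 → ℝ :=
  if hf : ∃ g : S2 → ℝ, MemLp g 2 σ ∧ HasWeakRot i f g then hf.choose else 0

/-- The Maier–Saupe mean-field potential `α ∫ |x × m'|² f(m') dm'`. It is only used on the sphere,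
but the formula makes sense at all points of `ℝ³`. -/
def potential (α : ℝ) (f : S2 → ℝ) (x : E3) : ℝ := α * ∫ m', ‖cross x m'‖ ^ 2 * f m' ∂σ

/-- The linearized Doi–Onsager operator `R · (R f + h R(U f) + f R(U h))`. -/
def opG (α : ℝ) (h f : S2 → ℝ) : S2 → ℝ := fun m =>
  ∑ i, weakRot i (fun m' => weakRot i f m' + h m' * rot i (potential α f) m'
    + f m' * rot i (potential α h) m') m

/-- The operator `f / h + U f`. -/
def opH (α : ℝ) (h f : S2 → ℝ) : S2 → ℝ := fun m => f m / h m + potential α f m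

/-- `μ` is an eigenvalue of the linearized operator with domain `H²(S²)` in `L²(S²)`. -/
def IsEigenvalueG (α : ℝ) (h : S2 → ℝ) (μ : ℝ) : Prop :=
  ∃ f : L2S, f ≠ 0 ∧ MemH 2 f ∧ ∀ᵐ m ∂σ, opG α h f m = μ * f m

/-- The kernel of the linearized operator among the functions in `H²(S²)` of mean zero. -/
def kerG (α : ℝ) (h : S2 → ℝ) : Set L2S :=
  {φ | MemH 2 φ ∧ ∫ m, φ m ∂σ = 0 ∧ ∀ᵐ m ∂σ, opG α h φ m = 0}

/-- The probability density `h` is a critical point of the free energy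
`∫ (f ln f + ½ f U f)`: the chemical potential `ln h + U h` is constant. -/
def IsCriticalPoint (α : ℝ) (h : S2 → ℝ) : Prop :=
  MemLp h 2 σ ∧ (∀ᵐ m ∂σ, 0 < h m) ∧ ∫ m, h m ∂σ = 1 ∧
    ∃ c : ℝ, ∀ᵐ m ∂σ, Real.log (h m) + potential α h m = c

/-- The second variation of the free energy at `h` is nonnegative on the functions of mean zero. -/
def SecondVariationNonneg (α : ℝ) (h : S2 → ℝ) : Prop :=
  ∀ φ : S2 → ℝ, MemLp φ 2 σ → ∫ m, φ m ∂σ = 0 → 0 ≤ ∫ m, opH α h φ m * φ m ∂σ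

/-- The density `exp (η (x·n)²) / ∫ exp (η (m·n)²) dm`, with its obvious extension to `ℝ³`. -/
def density (η : ℝ) (n : E3) (x : E3) : ℝ :=
  Real.exp (η * ⟪x, n⟫_ℝ ^ 2) / ∫ m : S2, Real.exp (η * ⟪(m : E3), n⟫_ℝ ^ 2) ∂σ

/-- The moments `∫_{-1}^1 z^k exp (η z²) dz`. -/
def moment (k : ℕ) (η : ℝ) : ℝ := ∫ z in (-1 : ℝ)..1, z ^ k * Real.exp (η * z ^ 2)

/-- The parameters `η` of the nontrivial branches of critical points. For `η ≠ 0` the equation says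
that `density η n` is critical; it holds for `η = 0` only when `α = 7.5`, where one of the
branches crosses the isotropic state. -/
def branchSet (α : ℝ) : Set ℝ := {η | moment 0 η = α * (moment 2 η - moment 4 η)}

/-- The critical intensity (about `6.731393`), above which there are two nontrivial branches. -/
def alphaStar : ℝ := sInf {α | (branchSet α).Nonempty}

/-- The upper branch. -/
def eta1 (α : ℝ) : ℝ := sSup (branchSet α)

/-- The lower branch. -/
def eta2 (α : ℝ) : ℝ := sInf (branchSet α)

end DoiOnsager

end

noncomputable section

namespace DoiOnsager

/-! ### Moments of exp (η z²) on [-1, 1] and the two solutions of the branch equation. -/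

section Moments

/-! Write z = m·n, let x, y be the other two coordinates, and let ⟨·⟩ be the average for the density
h = h_{η,n}. The branch equation is α · `gap` η = 1 with `gap` = ⟨z²⟩ - ⟨z⁴⟩. Integration by parts
shows `gap`' = `disc` / (2η) for η ≠ 0, and `disc` solves a linear differential equation whose
source has the sign of η (1 - 2⟨z²⟩). As ⟨z²⟩ increases with η, `gap` first rises and then falls,
with its maximum at some η > 0, and it decays at infinity. Above α* there are therefore exactly two
solutions, η₁ beyond the maximum and η₂ before it (`branchSet_eq_pair`).

Since |m × m'|² = 1 - (m·m')², the potential sees a function only through its mass and second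
moments. Completing the square in the second variation (`second_variation_eq`) leaves three numbers:
1 - (3/2) α Var(z²) for the mode z², 1 - 2α⟨x²y²⟩ for x² - y² and xy, and 1 - α `gap` for xz and yz.
On a branch the third vanishes, the first has the sign of -`disc` and the second the sign of η. The
first two are positive at η₁, and one of them is negative at η₂ ≠ 0 (`stable_coefs`,
`unstable_coefs`).

Because ln h + U h is constant, G_h f = R · (h R (H_h f)), so that ∫ (G_h f)(H_h f) = -∫ h |R (H_h
f)|² (`hasWeakRot_zero_of_energy`). With a nonnegative second variation this excludes positive
eigenvalues. For φ in the kernel H_h φ is constant, the second variation at φ is zero, and strict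
positivity of the first two numbers leaves only φ = h (p xz + q yz). These are the infinitesimal
rotations of h, and H_h vanishes on them.

For the positive eigenvalue at η₂ put s = √h, A = -s⁻¹ R · s² R s⁻¹ and J = (1 + A)⁻¹; on ψ with ∫
sψ = 0 the map ψ ↦ -s U(sψ) is L L* with L of finite rank. With f = sψ and ψ = (1 - J) y, the
equation G_h f = t f follows from (1 - J) y + t J y = L L* (1 - J) y. This asks for a fixed vector
of the positive semidefinite matrix L* (1 - J) ((1 - J) + tJ)⁻¹ L. Its norm tends to 0 as t → ∞ and
exceeds 1 for some t > 0 by instability, so it equals 1 for some t > 0 (`exists_pencil_solution`,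
`isEigenvalueG_of_pencil`).

The Sobolev theory rests on polynomials. The operator 1 - Δ preserves their degree and is definite,
hence onto; Δ commutes with every R_i, so 1 - Δ controls all second derivatives. This gives
polynomial approximation, elliptic regularity and integration by parts in H² (`exists_poly_approx`).
-/

theorem moment_integrable (k : ℕ) (η : ℝ) (a b : ℝ) :
    IntervalIntegrable (fun z : ℝ => z ^ k * Real.exp (η * z ^ 2)) volume a b :=
  (by fun_prop : Continuous fun z : ℝ => z ^ k * Real.exp (η * z ^ 2)).intervalIntegrable _ _

theorem hasDerivAt_moment (k : ℕ) (η : ℝ) :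
    HasDerivAt (moment k) (moment (k + 2) η) η := by
  unfold moment
  refine (intervalIntegral.hasDerivAt_integral_of_dominated_loc_of_deriv_le
    (F := fun η z : ℝ => z ^ k * Real.exp (η * z ^ 2))
    (F' := fun η z : ℝ => z ^ (k + 2) * Real.exp (η * z ^ 2))
    (bound := fun _ => Real.exp (|η| + 1)) (Metric.ball_mem_nhds η one_pos)
    ?_ (moment_integrable k η _ _) ?_ ?_ ?_ ?_).2
  · exact .of_forall fun x => (by fun_prop : Continuous fun z : ℝ =>
      z ^ k * Real.exp (x * z ^ 2)).aestronglyMeasurable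
  · exact (by fun_prop : Continuous fun z : ℝ =>
      z ^ (k + 2) * Real.exp (η * z ^ 2)).aestronglyMeasurable
  · refine .of_forall fun z hz x hx => ?_
    rw [Set.uIoc_of_le (by norm_num)] at hz
    have hz1 : |z| ≤ 1 := abs_le.2 ⟨hz.1.le, hz.2⟩
    have h1 : |z| ^ (k + 2) ≤ 1 := pow_le_one₀ (abs_nonneg z) hz1
    have hx' : |x| ≤ |η| + 1 := by
      have := abs_sub_abs_le_abs_sub x η
      rw [Metric.mem_ball, Real.dist_eq] at hx
      linarith
    have hz2 : z ^ 2 ≤ 1 := by rw [← sq_abs]; exact pow_le_one₀ (abs_nonneg z) hz1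
    have h2 : x * z ^ 2 ≤ |η| + 1 := by
      calc x * z ^ 2 ≤ |x| * z ^ 2 := by gcongr; exact le_abs_self x
        _ ≤ |x| * 1 := by gcongr
        _ ≤ _ := by linarith
    rw [norm_mul, norm_pow, Real.norm_eq_abs, Real.norm_eq_abs, Real.abs_exp]
    calc _ ≤ 1 * Real.exp (|η| + 1) := by gcongr
      _ = _ := one_mul _
  · exact intervalIntegrable_const
  · refine .of_forall fun z _ x _ => ?_
    have h := (((hasDerivAt_id x).mul_const (z ^ 2)).exp).const_mul (z ^ k)
    refine h.congr_deriv ?_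
    simp only [id]
    ring

/-- The integral of the derivative of z^(k+1) (1 - z²) exp (η z²), a function that vanishes at both
endpoints. -/
theorem moment_by_parts (k : ℕ) (η : ℝ) :
    (k + 1) * moment k η - (k + 3) * moment (k + 2) η
      + 2 * η * (moment (k + 2) η - moment (k + 4) η) = 0 := by
  have hd : ∀ z : ℝ, HasDerivAt (fun z : ℝ => z ^ (k + 1) * (1 - z ^ 2) * Real.exp (η * z ^ 2))
      ((k + 1) * (z ^ k * Real.exp (η * z ^ 2)) - (k + 3) * (z ^ (k + 2) * Real.exp (η * z ^ 2))
      + 2 * η * (z ^ (k + 2) * Real.exp (η * z ^ 2) - z ^ (k + 4) * Real.exp (η * z ^ 2))) z := by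
    intro z
    have h := (((hasDerivAt_id z).pow (k + 1)).mul (((hasDerivAt_id z).pow 2).const_sub 1)).mul
      ((((hasDerivAt_id z).pow 2).const_mul η).exp)
    refine h.congr_deriv ?_
    simp
    ring
  have h := intervalIntegral.integral_eq_sub_of_hasDerivAt (a := -1) (b := 1)
    (fun z _ => hd z) (Continuous.intervalIntegrable (by fun_prop) _ _)
  rw [intervalIntegral.integral_add, intervalIntegral.integral_sub,
    intervalIntegral.integral_const_mul, intervalIntegral.integral_const_mul,
    intervalIntegral.integral_const_mul, intervalIntegral.integral_sub] at h
  · unfold moment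
    rw [h]
    norm_num
  all_goals
    first
      | exact moment_integrable _ _ _ _
      | exact (by fun_prop : Continuous _).intervalIntegrable _ _

theorem one_sub_sq_pos_of_mem {z : ℝ} (hz : z ∈ Set.Ioo (-1 : ℝ) 1) : 0 < 1 - z ^ 2 := by
  nlinarith [hz.1, hz.2]

/-- Common source of the strict moment inequalities below: each integrand there is nonnegative with
finitely many zeros inside the interval. -/
theorem integral_neg_one_one_pos {P : ℝ → ℝ} (hP : Continuous P)
    (h0 : ∀ z ∈ Set.Ioo (-1 : ℝ) 1, 0 ≤ P z)
    {S : Set ℝ} (hS : S.Finite) (hS' : ∀ z ∈ Set.Ioo (-1 : ℝ) 1, P z = 0 → z ∈ S) :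
    0 < ∫ z in (-1 : ℝ)..1, P z := by
  have hinf : (Set.Ioo (-1 : ℝ) 1 \ S).Nonempty :=
    ((Set.Ioo_infinite (by norm_num)).sdiff hS).nonempty
  obtain ⟨c, hc, hcS⟩ := hinf
  have hcl : ∀ z ∈ Set.Icc (-1 : ℝ) 1, 0 ≤ P z := by
    rw [← closure_Ioo (by norm_num : (-1 : ℝ) ≠ 1)]
    exact fun z hz => closure_minimal (t := {z | 0 ≤ P z}) h0
      (isClosed_le continuous_const hP) hz
  refine intervalIntegral.integral_pos (by norm_num) hP.continuousOn
    (fun z hz => hcl z (Set.Ioc_subset_Icc_self hz))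
    ⟨c, Set.Ioo_subset_Icc_self hc, ?_⟩
  exact lt_of_le_of_ne (h0 c hc) fun h => hcS (hS' c hc h.symm)

theorem moment_zero_pos (η : ℝ) : 0 < moment 0 η :=
  integral_neg_one_one_pos (by fun_prop) (fun z _ => by positivity) Set.finite_empty
    (fun z _ h => by simp [Real.exp_ne_zero] at h)

theorem moment_two_pos (η : ℝ) : 0 < moment 2 η :=
  integral_neg_one_one_pos (by fun_prop) (fun z _ => by positivity) (Set.finite_singleton 0)
    (fun z _ h => by simpa [Real.exp_ne_zero] using h)

theorem moment_two_sub_four_pos (η : ℝ) : 0 < moment 2 η - moment 4 η := by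
  have h : 0 < ∫ z in (-1 : ℝ)..1,
      (z ^ 2 * Real.exp (η * z ^ 2) - z ^ 4 * Real.exp (η * z ^ 2)) := by
    have e : ∀ z : ℝ, z ^ 2 * Real.exp (η * z ^ 2) - z ^ 4 * Real.exp (η * z ^ 2)
      = z ^ 2 * (1 - z ^ 2) * Real.exp (η * z ^ 2) := fun z => by ring
    simp only [e]
    refine integral_neg_one_one_pos (by fun_prop) (fun z hz => ?_) (Set.finite_singleton 0)
      (fun z hz h => ?_)
    · have := one_sub_sq_pos_of_mem hz
      positivity
    · simpa [Real.exp_ne_zero, (one_sub_sq_pos_of_mem hz).ne'] using h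
  rwa [intervalIntegral.integral_sub (moment_integrable _ _ _ _) (moment_integrable _ _ _ _)] at h

theorem moment_two_four_six_pos (η : ℝ) :
    0 < moment 2 η - 2 * moment 4 η + moment 6 η := by
  have h : 0 < ∫ z in (-1 : ℝ)..1, (z ^ 2 * Real.exp (η * z ^ 2)
      - 2 * (z ^ 4 * Real.exp (η * z ^ 2)) + z ^ 6 * Real.exp (η * z ^ 2)) := by
    have e : ∀ z : ℝ, z ^ 2 * Real.exp (η * z ^ 2)
      - 2 * (z ^ 4 * Real.exp (η * z ^ 2)) + z ^ 6 * Real.exp (η * z ^ 2)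
      = z ^ 2 * (1 - z ^ 2) ^ 2 * Real.exp (η * z ^ 2) := fun z => by ring
    simp only [e]
    refine integral_neg_one_one_pos (by fun_prop) (fun z hz => by positivity)
      (Set.finite_singleton 0) (fun z hz h => ?_)
    simpa [Real.exp_ne_zero, (one_sub_sq_pos_of_mem hz).ne'] using h
  rwa [intervalIntegral.integral_add (((moment_integrable _ _ _ _).sub
    ((moment_integrable _ _ _ _).const_mul _))) (moment_integrable _ _ _ _),
    intervalIntegral.integral_sub (moment_integrable _ _ _ _)
      ((moment_integrable _ _ _ _).const_mul _), intervalIntegral.integral_const_mul] at h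

/-- Strict Cauchy–Schwarz: the integrand (a z² - b)² exp (η z²) has at most two zeros. -/
theorem moment_variance_pos (η : ℝ) :
    0 < moment 0 η * moment 4 η - moment 2 η ^ 2 := by
  set a := moment 0 η with ha
  set b := moment 2 η with hb
  have a0 : 0 < a := moment_zero_pos η
  have h : 0 < ∫ z in (-1 : ℝ)..1, (a ^ 2 * (z ^ 4 * Real.exp (η * z ^ 2))
      - 2 * a * b * (z ^ 2 * Real.exp (η * z ^ 2)) + b ^ 2 * (z ^ 0 * Real.exp (η * z ^ 2))) := by
    have e : ∀ z : ℝ, a ^ 2 * (z ^ 4 * Real.exp (η * z ^ 2))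
      - 2 * a * b * (z ^ 2 * Real.exp (η * z ^ 2)) + b ^ 2 * (z ^ 0 * Real.exp (η * z ^ 2))
      = (a * z ^ 2 - b) ^ 2 * Real.exp (η * z ^ 2) := fun z => by ring
    simp only [e]
    refine integral_neg_one_one_pos (by fun_prop) (fun z hz => by positivity)
      (S := {√(b / a), -√(b / a)}) (by simp) (fun z hz h => ?_)
    have h1 : z ^ 2 = b / a := by
      rw [eq_div_iff a0.ne']
      have : a * z ^ 2 - b = 0 := by simpa [Real.exp_ne_zero] using h
      linarith
    rw [Set.mem_insert_iff, Set.mem_singleton_iff, ← sq_eq_sq_iff_eq_or_eq_neg, h1,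
      Real.sq_sqrt (h1 ▸ sq_nonneg z)]
  rw [intervalIntegral.integral_add (((moment_integrable _ _ _ _).const_mul _).sub
    ((moment_integrable _ _ _ _).const_mul _)) ((moment_integrable _ _ _ _).const_mul _),
    intervalIntegral.integral_sub ((moment_integrable _ _ _ _).const_mul _)
      ((moment_integrable _ _ _ _).const_mul _), intervalIntegral.integral_const_mul,
    intervalIntegral.integral_const_mul, intervalIntegral.integral_const_mul] at h
  change 0 < a ^ 2 * moment 4 η - 2 * a * b * b + b ^ 2 * a at h
  have : a ^ 2 * moment 4 η - 2 * a * b * b + b ^ 2 * a = a * (a * moment 4 η - b ^ 2) := by ring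
  rw [this] at h
  exact (mul_pos_iff_of_pos_left a0).1 h

/-- The average of `z ^ k` for the weight `exp (η z²)` on `[-1, 1]`. -/
def avg (k : ℕ) (η : ℝ) : ℝ := moment k η / moment 0 η

/-- The average of `z² - z⁴`. -/
def gap (η : ℝ) : ℝ := avg 2 η - avg 4 η

/-- The quantity whose sign decides the monotonicity of `gap`. -/
def disc (η : ℝ) : ℝ := 5 * avg 4 η - 2 * avg 2 η - 3 * avg 2 η ^ 2

/-- The variance of `z²`. -/
def var2 (η : ℝ) : ℝ := avg 4 η - avg 2 η ^ 2

theorem var2_pos (η : ℝ) : 0 < var2 η := by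
  have h0 := moment_zero_pos η
  have : var2 η = (moment 0 η * moment 4 η - moment 2 η ^ 2) / moment 0 η ^ 2 := by
    unfold var2 avg; field_simp
  rw [this]
  exact div_pos (moment_variance_pos η) (by positivity)

theorem gap_pos (η : ℝ) : 0 < gap η := by
  have : gap η = (moment 2 η - moment 4 η) / moment 0 η := by unfold gap avg; ring
  rw [this]
  exact div_pos (moment_two_sub_four_pos η) (moment_zero_pos η)

theorem avg_two_pos (η : ℝ) : 0 < avg 2 η := div_pos (moment_two_pos η) (moment_zero_pos η)

theorem avg_two_lt_one (η : ℝ) : avg 2 η < 1 := by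
  have h1 := var2_pos η
  have h2 := gap_pos η
  have h3 := avg_two_pos η
  unfold var2 at h1
  unfold gap at h2
  nlinarith

theorem avg_two_four_six_pos (η : ℝ) : 0 < avg 2 η - 2 * avg 4 η + avg 6 η := by
  have : avg 2 η - 2 * avg 4 η + avg 6 η
      = (moment 2 η - 2 * moment 4 η + moment 6 η) / moment 0 η := by unfold avg; ring
  rw [this]
  exact div_pos (moment_two_four_six_pos η) (moment_zero_pos η)

theorem avg_zero (η : ℝ) : avg 0 η = 1 := div_self (moment_zero_pos η).ne'

theorem avg_by_parts (k : ℕ) (η : ℝ) :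
    (k + 1) * avg k η - (k + 3) * avg (k + 2) η
      + 2 * η * (avg (k + 2) η - avg (k + 4) η) = 0 := by
  have := moment_by_parts k η
  unfold avg
  have h0 := (moment_zero_pos η).ne'
  field_simp
  linarith

theorem avg_by_parts_zero (η : ℝ) : 3 * avg 2 η - 1 = 2 * η * gap η := by
  have := avg_by_parts 0 η
  rw [avg_zero] at this
  unfold gap
  norm_num at this ⊢
  linarith

theorem avg_by_parts_two (η : ℝ) : 5 * avg 4 η - 3 * avg 2 η = 2 * η * (avg 4 η - avg 6 η) := by
  have := avg_by_parts 2 η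
  norm_num at this
  linarith

/-- Differentiating an exponential average in its parameter gives a covariance, here that of z^k and
z². -/
theorem hasDerivAt_avg (k : ℕ) (η : ℝ) :
    HasDerivAt (avg k) (avg (k + 2) η - avg k η * avg 2 η) η := by
  have h0 := (moment_zero_pos η).ne'
  have h := (hasDerivAt_moment k η).div (hasDerivAt_moment 0 η) h0
  refine h.congr_deriv ?_
  unfold avg
  field_simp

theorem hasDerivAt_gap (η : ℝ) :
    HasDerivAt gap (avg 4 η - avg 6 η - avg 2 η * gap η) η := by
  refine ((hasDerivAt_avg 2 η).sub (hasDerivAt_avg 4 η)).congr_deriv ?_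
  unfold gap
  ring

/-- The second factor is the derivative of `gap`. The identity is the integration by parts for k = 2
minus ⟨z²⟩ times the one for k = 0. -/
theorem disc_eq (η : ℝ) : disc η = 2 * η * (avg 4 η - avg 6 η - avg 2 η * gap η) := by
  have h1 := avg_by_parts_zero η
  have h2 := avg_by_parts_two η
  unfold disc
  linear_combination h2 - avg 2 η * h1

theorem hasDerivAt_disc (η : ℝ) : HasDerivAt disc
    ((3 - 6 * avg 2 η) * var2 η - 5 * (avg 4 η - avg 6 η - avg 2 η * gap η)) η := by
  have h := (((hasDerivAt_avg 4 η).const_mul 5).sub ((hasDerivAt_avg 2 η).const_mul 2)).sub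
    (((hasDerivAt_avg 2 η).pow 2).const_mul 3)
  refine h.congr_deriv ?_
  unfold gap var2
  norm_num
  ring

theorem strictMono_avg_two : StrictMono (avg 2) :=
  strictMono_of_hasDerivAt_pos (fun x => hasDerivAt_avg 2 x) (fun x => by
    have := var2_pos x
    unfold var2 at this
    norm_num
    linarith)

/-- The equation 2η disc' + 5 disc = 2η (3 - 6⟨z²⟩) Var(z²) has integrating factor |η|^(5/2).
Substituting η = e t² with e = ±1 turns it into t⁵, which is smooth at the origin. -/
theorem hasDerivAt_pow_five_mul_disc (e t : ℝ) :
    HasDerivAt (fun t => t ^ 5 * disc (e * t ^ 2))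
      (2 * e * t ^ 6 * ((3 - 6 * avg 2 (e * t ^ 2)) * var2 (e * t ^ 2))) t := by
  have h1 : HasDerivAt (fun t : ℝ => e * t ^ 2) (e * (2 * t)) t := by
    simpa using (hasDerivAt_pow 2 t).const_mul e
  have h := (hasDerivAt_pow 5 t).mul ((hasDerivAt_disc (e * t ^ 2)).comp t h1)
  refine h.congr_deriv ?_
  simp only [Function.comp, disc_eq]
  push_cast
  ring

/-- For η < 0 one has ⟨z²⟩ < 1/3, so t⁵ · disc starts from 0 and decreases. -/
theorem disc_neg_of_neg {η : ℝ} (hη : η < 0) : disc η < 0 := by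
  have hF : StrictAntiOn (fun t => t ^ 5 * disc ((-1) * t ^ 2)) (Set.Ici 0) := by
    refine strictAntiOn_of_hasDerivWithinAt_neg (convex_Ici 0)
      (fun t _ => (hasDerivAt_pow_five_mul_disc (-1) t).continuousAt.continuousWithinAt)
      (fun t _ => (hasDerivAt_pow_five_mul_disc (-1) t).hasDerivWithinAt) ?_
    intro t ht
    rw [interior_Ici] at ht
    have ht : 0 < t := ht
    have h1 := avg_by_parts_zero (-1 * t ^ 2)
    have h2 := gap_pos (-1 * t ^ 2)
    have h3 := var2_pos (-1 * t ^ 2)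
    have h4 : 0 < 3 - 6 * avg 2 (-1 * t ^ 2) := by nlinarith [mul_pos (pow_pos ht 2) h2]
    have := mul_pos (pow_pos ht 6) (mul_pos h4 h3)
    linarith
  have hs : 0 < √(-η) := Real.sqrt_pos.2 (by linarith)
  have h := hF Set.self_mem_Ici hs.le hs
  simp only at h
  rw [Real.sq_sqrt (by linarith)] at h
  norm_num at h
  exact (pos_iff_neg_of_mul_neg h).1 (pow_pos hs 5)

/-- On η > 0 the function t⁵ · disc starts from 0, increases while ⟨z²⟩ < 1/2 and decreases
afterwards. Once it is nonpositive, it is already on the decreasing part. -/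
theorem disc_neg_of_lt {a b : ℝ} (ha : 0 < a) (hda : disc a ≤ 0) (hab : a < b) : disc b < 0 := by
  have hc : ∀ S : Set ℝ, ContinuousOn (fun t => t ^ 5 * disc (1 * t ^ 2)) S := fun S t _ =>
    (hasDerivAt_pow_five_mul_disc 1 t).continuousAt.continuousWithinAt
  have hsa : 0 < √a := Real.sqrt_pos.2 ha
  have hb : 0 < b := ha.trans hab
  have hs : 1 / 2 < avg 2 a := by
    by_contra! hle
    have hF : StrictMonoOn (fun t => t ^ 5 * disc (1 * t ^ 2)) (Set.Icc 0 (√a)) := by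
      refine strictMonoOn_of_hasDerivWithinAt_pos (convex_Icc _ _) (hc _)
        (fun t _ => (hasDerivAt_pow_five_mul_disc 1 t).hasDerivWithinAt) ?_
      intro t ht
      rw [interior_Icc] at ht
      have ht2 : 1 * t ^ 2 < a := by
        rw [one_mul]; exact (Real.lt_sqrt ht.1.le).1 ht.2
      have h1 := strictMono_avg_two ht2
      have h3 := var2_pos (1 * t ^ 2)
      have h4 : 0 < 3 - 6 * avg 2 (1 * t ^ 2) := by linarith
      have := mul_pos (pow_pos ht.1 6) (mul_pos h4 h3)
      linarith
    have h := hF (Set.left_mem_Icc.2 hsa.le) (Set.right_mem_Icc.2 hsa.le) hsa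
    simp only at h
    rw [Real.sq_sqrt ha.le] at h
    norm_num at h
    exact absurd ((mul_pos_iff_of_pos_left (pow_pos hsa 5)).1 h) (not_lt.2 hda)
  have hF : StrictAntiOn (fun t => t ^ 5 * disc (1 * t ^ 2)) (Set.Ici (√a)) := by
    refine strictAntiOn_of_hasDerivWithinAt_neg (convex_Ici _) (hc _)
      (fun t _ => (hasDerivAt_pow_five_mul_disc 1 t).hasDerivWithinAt) ?_
    intro t ht
    rw [interior_Ici] at ht
    have ht : √a < t := ht
    have ht0 : 0 < t := hsa.trans ht
    have ht2 : a < 1 * t ^ 2 := by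
      rw [one_mul]; exact (Real.sqrt_lt' ht0).1 ht
    have h1 := strictMono_avg_two ht2
    have h3 := var2_pos (1 * t ^ 2)
    have h4 : 0 < 6 * avg 2 (1 * t ^ 2) - 3 := by linarith
    have := mul_pos (pow_pos ht0 6) (mul_pos h4 h3)
    linarith
  have hlt : √a < √b := Real.sqrt_lt_sqrt ha.le hab
  have h := hF Set.self_mem_Ici hlt.le hlt
  simp only at h
  rw [one_mul, one_mul, Real.sq_sqrt ha.le, Real.sq_sqrt hb.le] at h
  have h5 : √b ^ 5 * disc b < 0 :=
    h.trans_le (mul_nonpos_of_nonneg_of_nonpos (pow_pos hsa 5).le hda)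
  exact (pos_iff_neg_of_mul_neg h5).1 (pow_pos (hsa.trans hlt) 5)

theorem moment_at_zero (k : ℕ) (hk : Even k) : moment k 0 = 2 / (k + 1) := by
  unfold moment
  simp [integral_pow, hk.add_one.neg_one_pow]
  norm_num

theorem deriv_gap_zero_pos :
    0 < avg 4 0 - avg 6 0 - avg 2 0 * gap 0 := by
  unfold gap avg
  rw [moment_at_zero 0 (by decide), moment_at_zero 2 (by decide), moment_at_zero 4 (by decide),
    moment_at_zero 6 (by decide)]
  norm_num

theorem gap_zero : gap 0 = 2 / 15 := by
  unfold gap avg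
  rw [moment_at_zero 0 (by decide), moment_at_zero 2 (by decide), moment_at_zero 4 (by decide)]
  norm_num

theorem disc_nonpos_of_deriv_gap_nonpos {η : ℝ}
    (h : avg 4 η - avg 6 η - avg 2 η * gap η ≤ 0) : 0 < η ∧ disc η ≤ 0 := by
  have hd := disc_eq η
  have hη : 0 < η := by
    rcases lt_trichotomy η 0 with h0 | h0 | h0
    · have := disc_neg_of_neg h0
      nlinarith
    · subst h0
      exact absurd deriv_gap_zero_pos (not_lt.2 h)
    · exact h0
  exact ⟨hη, by rw [hd]; exact mul_nonpos_of_nonneg_of_nonpos (by linarith) h⟩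

theorem continuous_gap : Continuous gap :=
  continuous_iff_continuousAt.2 fun x => (hasDerivAt_gap x).continuousAt

/-- Rolle would give two critical points of `gap`. The first lies at some η > 0 and makes `disc`
negative at the second, where it must vanish. -/
theorem gap_no_three {a b c : ℝ} (hab : a < b) (hbc : b < c) (h1 : gap a = gap b)
    (h2 : gap b = gap c) : False := by
  obtain ⟨x, hx, hx'⟩ := exists_hasDerivAt_eq_zero hab continuous_gap.continuousOn h1
    (fun x _ => hasDerivAt_gap x)
  obtain ⟨y, hy, hy'⟩ := exists_hasDerivAt_eq_zero hbc continuous_gap.continuousOn h2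
    (fun x _ => hasDerivAt_gap x)
  obtain ⟨hx0, hxd⟩ := disc_nonpos_of_deriv_gap_nonpos hx'.le
  have h := disc_neg_of_lt hx0 hxd (hx.2.trans hy.1)
  rw [disc_eq, hy', mul_zero] at h
  exact lt_irrefl _ h

/-- Since 0 < ⟨z²⟩ < 1, the quantity 2η · gap = 3⟨z²⟩ - 1 lies between -1 and 2. -/
theorem gap_lt_of_abs (η : ℝ) (hη : η ≠ 0) : gap η < 1 / |η| := by
  have h1 := avg_by_parts_zero η
  have h2 := avg_two_pos η
  have h3 := avg_two_lt_one η
  have h4 := gap_pos η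
  rw [lt_div_iff₀ (abs_pos.2 hη)]
  rcases abs_cases η with ⟨h, _⟩ | ⟨h, _⟩ <;> rw [h] <;> linarith

theorem mem_branchSet_iff {α η : ℝ} : η ∈ branchSet α ↔ α * gap η = 1 := by
  have h0 := (moment_zero_pos η).ne'
  unfold branchSet gap avg
  rw [Set.mem_ofPred_eq, div_sub_div_same, ← mul_div_assoc, div_eq_one_iff_eq h0, eq_comm]

theorem alphaStar_lt_iff_exists {α : ℝ} (hα : alphaStar < α) : 0 < α ∧ ∃ η, 1 < α * gap η := by
  have hne : {α | (branchSet α).Nonempty}.Nonempty :=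
    ⟨15 / 2, 0, mem_branchSet_iff.2 (by rw [gap_zero]; norm_num)⟩
  obtain ⟨β, ⟨η, hη⟩, hβ⟩ := exists_lt_of_csInf_lt hne hα
  rw [mem_branchSet_iff] at hη
  have hg := gap_pos η
  have hβ0 : 0 < β := by
    by_contra! h
    nlinarith
  exact ⟨hβ0.trans hβ, η, by nlinarith⟩

/-- Existence is the intermediate value theorem on either side of a point c with α · gap c > 1, and
`gap_no_three` excludes a third root. The signs of `disc` record on which side of the maximum of
`gap` each root lies. -/
theorem branchSet_eq_pair {α : ℝ} (hα : alphaStar < α) :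
    (branchSet α = {eta1 α, eta2 α} ∧ eta2 α < eta1 α) ∧
    0 < eta1 α ∧ disc (eta1 α) < 0 ∧ (0 < eta2 α → 0 < disc (eta2 α)) := by
  obtain ⟨hα0, c, hc⟩ := alphaStar_lt_iff_exists hα
  have hcont : Continuous fun η => α * gap η := continuous_const.mul continuous_gap
  -- The interval (-r, r) contains c, and r ≥ α makes α · gap < α / r ≤ 1 at both endpoints.
  set r := max (|c| + 1) α with hr
  have hr0 : 0 < r := lt_of_lt_of_le (by positivity) (le_max_left _ _)
  have hcr : |c| < r := lt_of_lt_of_le (by linarith) (le_max_left _ _)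
  have hlow : ∀ x, |x| = r → α * gap x < 1 := by
    intro x hx
    have hx0 : x ≠ 0 := by
      rw [← abs_pos, hx]; exact hr0
    have := gap_lt_of_abs x hx0
    rw [hx] at this
    calc α * gap x < α * (1 / r) := by gcongr
      _ = α / r := by ring
      _ ≤ 1 := (div_le_one hr0).2 (le_max_right _ _)
  obtain ⟨a, ha, ha1⟩ := intermediate_value_Ioo (abs_lt.1 hcr).1.le hcont.continuousOn
    (show (1 : ℝ) ∈ Set.Ioo _ _ from ⟨hlow _ (by rw [abs_neg, abs_of_pos hr0]), hc⟩)
  obtain ⟨b, hb, hb1⟩ := intermediate_value_Ioo' (abs_lt.1 hcr).2.le hcont.continuousOn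
    (show (1 : ℝ) ∈ Set.Ioo _ _ from ⟨hlow _ (abs_of_pos hr0), hc⟩)
  have hab : a < b := ha.2.trans hb.1
  have heq : ∀ x y, α * gap x = 1 → α * gap y = 1 → gap x = gap y := fun x y hx hy =>
    mul_left_cancel₀ hα0.ne' (hx.trans hy.symm)
  have hset : branchSet α = {b, a} := by
    ext x
    rw [mem_branchSet_iff, Set.mem_insert_iff, Set.mem_singleton_iff]
    constructor
    · intro hx
      by_contra! hne
      rcases lt_or_gt_of_ne hne.1 with h1 | h1
      · rcases lt_or_gt_of_ne hne.2 with h2 | h2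
        · exact gap_no_three h2 hab (heq _ _ hx ha1) (heq _ _ ha1 hb1)
        · exact gap_no_three h2 h1 (heq _ _ ha1 hx) (heq _ _ hx hb1)
      · exact gap_no_three hab h1 (heq _ _ ha1 hb1) (heq _ _ hb1 hx)
    · rintro (rfl | rfl)
      exacts [hb1, ha1]
  have e1 : eta1 α = b := by rw [eta1, hset, csSup_pair, sup_eq_left.2 hab.le]
  have e2 : eta2 α = a := by rw [eta2, hset, csInf_pair, inf_eq_right.2 hab.le]
  rw [e1, e2]
  refine ⟨⟨hset, hab⟩, ?_⟩
  have hcb : gap b < gap c := by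
    have : α * gap b < α * gap c := by rw [show α * gap b = 1 from hb1]; exact hc
    exact lt_of_mul_lt_mul_left this hα0.le
  have hca : gap a < gap c := by
    have : α * gap a < α * gap c := by rw [show α * gap a = 1 from ha1]; exact hc
    exact lt_of_mul_lt_mul_left this hα0.le
  -- The slope of `gap` from c down to the root b is negative, so `gap` has a negative derivative
  -- somewhere before b; this puts b in the decreasing regime.
  obtain ⟨x, hx, hx'⟩ := exists_hasDerivAt_eq_slope gap _ hb.1 continuous_gap.continuousOn
    (fun x _ => hasDerivAt_gap x)
  have hx1 : avg 4 x - avg 6 x - avg 2 x * gap x < 0 := by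
    rw [hx']; exact div_neg_of_neg_of_pos (by linarith) (by linarith [hb.1])
  obtain ⟨hx0, hxd⟩ := disc_nonpos_of_deriv_gap_nonpos hx1.le
  refine ⟨hx0.trans hx.2, disc_neg_of_lt hx0 hxd hx.2, fun ha0 => ?_⟩
  by_contra! had
  -- If `disc` were nonpositive at a > 0 it would be negative all the way to c, contradicting the
  -- rise of `gap` from a to c.
  obtain ⟨y, hy, hy'⟩ := exists_hasDerivAt_eq_slope gap _ ha.2 continuous_gap.continuousOn
    (fun x _ => hasDerivAt_gap x)
  have hy1 : 0 < avg 4 y - avg 6 y - avg 2 y * gap y := by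
    rw [hy']; exact div_pos (by linarith) (by linarith [ha.2])
  have := disc_neg_of_lt ha0 had hy.1
  rw [disc_eq] at this
  have hy0 : 0 < y := ha0.trans hy.1
  nlinarith [mul_pos hy0 hy1]

theorem eta2_ne_zero {α : ℝ} (hα : alphaStar < α) (h : α ≠ 15 / 2) : eta2 α ≠ 0 := by
  intro h0
  have hm : eta2 α ∈ branchSet α := by rw [(branchSet_eq_pair hα).1.1]; simp
  rw [mem_branchSet_iff, h0, gap_zero] at hm
  exact h (by linarith)

end Moments

/-! ### Rotation fields, invariance of the surface measure, and integration by parts for smooth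
functions. -/

section SphereCalculus

open scoped Pointwise

/-- The derivative along the rotation field with axis `w`. -/
def rotAx (w : E3) (ψ : E3 → ℝ) (m : E3) : ℝ := fderiv ℝ ψ m (cross w m)

/-- The standard basis of `ℝ³`. -/
abbrev stdE (i : Fin 3) : E3 := EuclideanSpace.single i 1

theorem cross_ofLp (x y : E3) (i : Fin 3) : cross x y i =
    ![x 1 * y 2 - x 2 * y 1, x 2 * y 0 - x 0 * y 2, x 0 * y 1 - x 1 * y 0] i := by
  unfold cross
  simp [cross_apply]

theorem inner_E3 (x y : E3) : ⟪x, y⟫_ℝ = x 0 * y 0 + x 1 * y 1 + x 2 * y 2 := by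
  simp [PiLp.inner_apply, Fin.sum_univ_three, mul_comm]

theorem norm_sq_E3 (x : E3) : ‖x‖ ^ 2 = x 0 ^ 2 + x 1 ^ 2 + x 2 ^ 2 := by
  simp [EuclideanSpace.norm_sq_eq, Fin.sum_univ_three]

/-- Triple product: (m × ∇ψ) · e_i = ∇ψ · (e_i × m). -/
theorem rot_eq_rotAx (i : Fin 3) (ψ : E3 → ℝ) : rot i ψ = rotAx (stdE i) ψ := by
  funext m
  unfold rot rotAx
  have h : ∀ v, fderiv ℝ ψ m v = ⟪gradient ψ m, v⟫_ℝ := fun v => by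
    rw [gradient, InnerProductSpace.toDual_symm_apply]
  rw [h, inner_E3]
  fin_cases i <;> simp [cross_ofLp] <;> ring

theorem rotAx_eq_sum (w : E3) (ψ : E3 → ℝ) (m : E3) :
    rotAx w ψ m = ∑ i, w i * rot i ψ m := by
  have h : cross w m = ∑ i, w i • cross (stdE i) m := by
    ext j
    simp only [Fin.sum_univ_three]
    fin_cases j <;> simp [cross_ofLp] <;> ring
  simp only [rot_eq_rotAx, rotAx]
  rw [h, map_sum]
  simp

theorem contDiff_rot {n : ℕ∞} {k : ℕ∞} (i : Fin 3) {ψ : E3 → ℝ} (hψ : ContDiff ℝ n ψ)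
    (hk : k + 1 ≤ n) : ContDiff ℝ k (rot i ψ) := by
  rw [rot_eq_rotAx]
  unfold rotAx
  have h1 : ContDiff ℝ k (fderiv ℝ ψ) := hψ.fderiv_right (by exact_mod_cast hk)
  have h2 : ContDiff ℝ k (fun m : E3 => cross (stdE i) m) := by
    rw [contDiff_euclidean]
    intro j
    simp only [cross_ofLp]
    fin_cases j <;> simp only [Fin.zero_eta, Fin.mk_one, Fin.reduceFinMk, Matrix.cons_val] <;> fun_prop
  exact h1.clm_apply h2

theorem contDiff_rot_infty (i : Fin 3) {ψ : E3 → ℝ} (hψ : ContDiff ℝ ∞ ψ) :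
    ContDiff ℝ ∞ (rot i ψ) := contDiff_rot (n := ⊤) (k := ⊤) i hψ le_rfl

theorem continuous_rot (i : Fin 3) {ψ : E3 → ℝ} (hψ : ContDiff ℝ 1 ψ) :
    Continuous (rot i ψ) :=
  (contDiff_rot (n := 1) (k := 0) i hψ le_rfl).continuous

theorem rotAx_add (w : E3) {φ ψ : E3 → ℝ} {m : E3} (hφ : DifferentiableAt ℝ φ m)
    (hψ : DifferentiableAt ℝ ψ m) :
    rotAx w (fun x => φ x + ψ x) m = rotAx w φ m + rotAx w ψ m := by
  unfold rotAx
  rw [fderiv_fun_add hφ hψ]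
  rfl

theorem rotAx_const_mul (w : E3) (c : ℝ) {ψ : E3 → ℝ} {m : E3}
    (hψ : DifferentiableAt ℝ ψ m) :
    rotAx w (fun x => c * ψ x) m = c * rotAx w ψ m := by
  unfold rotAx
  rw [fderiv_const_mul hψ]
  rfl

theorem rotAx_mul (w : E3) {φ ψ : E3 → ℝ} {m : E3} (hφ : DifferentiableAt ℝ φ m)
    (hψ : DifferentiableAt ℝ ψ m) :
    rotAx w (fun x => φ x * ψ x) m = φ m * rotAx w ψ m + ψ m * rotAx w φ m := by
  unfold rotAx
  rw [fderiv_fun_mul hφ hψ]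
  simp

theorem rotAx_comp (w : E3) {F : ℝ → ℝ} {F' : ℝ} {ψ : E3 → ℝ} {m : E3}
    (hF : HasDerivAt F F' (ψ m)) (hψ : DifferentiableAt ℝ ψ m) :
    rotAx w (fun x => F (ψ x)) m = F' * rotAx w ψ m := by
  unfold rotAx
  have := (hF.comp_hasFDerivAt m hψ.hasFDerivAt).fderiv
  simp only [Function.comp_def] at this
  rw [this]
  simp

theorem rotAx_const (w : E3) (c : ℝ) (m : E3) : rotAx w (fun _ => c) m = 0 := by
  simp [rotAx]

theorem rotAx_inner (w v m : E3) : rotAx w (fun x => ⟪x, v⟫_ℝ) m = ⟪cross w m, v⟫_ℝ := by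
  unfold rotAx
  have : HasFDerivAt (fun x : E3 => ⟪x, v⟫_ℝ) (innerSL ℝ v) m := by
    have h := (innerSL ℝ v).hasFDerivAt (x := m)
    refine h.congr_of_eventuallyEq (.of_forall fun x => ?_)
    simp [real_inner_comm]
  rw [this.fderiv]
  simp [real_inner_comm]

/-- The rotation with axis `e_i` and angle `t`. -/
def rotMap (i : Fin 3) (t : ℝ) (x : E3) : E3 :=
  Real.cos t • x + Real.sin t • cross (stdE i) x + ((1 - Real.cos t) * x i) • stdE i

theorem norm_rotMap (i : Fin 3) (t : ℝ) (x : E3) : ‖rotMap i t x‖ = ‖x‖ := by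
  rw [← sq_eq_sq₀ (norm_nonneg _) (norm_nonneg _), norm_sq_E3, norm_sq_E3]
  have := Real.sin_sq_add_cos_sq t
  fin_cases i <;> simp [rotMap, cross_ofLp]
  · linear_combination (x 1 ^ 2 + x 2 ^ 2) * this
  · linear_combination (x 0 ^ 2 + x 2 ^ 2) * this
  · linear_combination (x 0 ^ 2 + x 1 ^ 2) * this

theorem hasDerivAt_rotMap (i : Fin 3) (t : ℝ) (x : E3) :
    HasDerivAt (fun t => rotMap i t x) (cross (stdE i) (rotMap i t x)) t := by
  have h := (((Real.hasDerivAt_cos t).smul_const x).add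
    ((Real.hasDerivAt_sin t).smul_const (cross (stdE i) x))).add
    ((((Real.hasDerivAt_cos t).const_sub 1).mul_const (x i)).smul_const (stdE i))
  refine h.congr_deriv ?_
  ext j
  fin_cases i <;> fin_cases j <;> simp [rotMap, cross_ofLp] <;> ring

/-- `rotMap` as a linear isometry. -/
def rotIso (i : Fin 3) (t : ℝ) : E3 ≃ₗᵢ[ℝ] E3 :=
  LinearIsometry.toLinearIsometryEquiv
    { toFun := rotMap i t
      map_add' := fun x y => by
        ext j; fin_cases i <;> fin_cases j <;> simp [rotMap, cross_ofLp] <;> ring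
      map_smul' := fun c x => by
        ext j; fin_cases i <;> fin_cases j <;> simp [rotMap, cross_ofLp] <;> ring
      norm_map' := norm_rotMap i t } rfl

/-- The action of a linear isometry on the sphere. -/
def sphereMap (ρ : E3 ≃ₗᵢ[ℝ] E3) (m : S2) : S2 := ⟨ρ m, by simp⟩

/-- The surface measure of a set is a multiple of the volume of the cone over it, and the isometry
of space carries cones to cones. -/
theorem measurePreserving_sphereMap (ρ : E3 ≃ₗᵢ[ℝ] E3) :
    MeasurePreserving (sphereMap ρ) σ σ := by
  have hc : Continuous (sphereMap ρ) := by
    unfold sphereMap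
    fun_prop
  refine ⟨hc.measurable, ?_⟩
  ext s hs
  rw [Measure.map_apply hc.measurable hs]
  unfold σ
  rw [Measure.toSphere_apply' _ (hc.measurable hs), Measure.toSphere_apply' _ hs]
  congr 1
  have h : Set.Ioo (0 : ℝ) 1 • ((↑) '' (sphereMap ρ ⁻¹' s) : Set E3)
      = ρ ⁻¹' (Set.Ioo (0 : ℝ) 1 • ((↑) '' s : Set E3)) := by
    ext x
    simp only [Set.mem_smul, Set.mem_preimage, Set.mem_image]
    constructor
    · rintro ⟨r, hr, _, ⟨m, hm, rfl⟩, rfl⟩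
      exact ⟨r, hr, _, ⟨_, hm, rfl⟩, by simp [sphereMap]⟩
    · rintro ⟨r, hr, _, ⟨m, hm, rfl⟩, hx⟩
      refine ⟨r, hr, _, ⟨sphereMap ρ.symm m, ?_, rfl⟩, ?_⟩
      · have : sphereMap ρ (sphereMap ρ.symm m) = m := by ext; simp [sphereMap]
        rwa [this]
      · apply ρ.injective
        simp [sphereMap, hx]
  rw [h]
  exact ρ.measurePreserving.measure_preimage_emb ρ.toHomeomorph.measurableEmbedding _

instance : IsFiniteMeasure σ := inferInstanceAs (IsFiniteMeasure (Measure.toSphere _))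

instance : σ.IsOpenPosMeasure :=
  inferInstanceAs (Measure.IsOpenPosMeasure (Measure.toSphere _))

theorem sigma_ne_zero : σ ≠ 0 := Measure.toSphere_ne_zero _

theorem integrable_of_continuous {f : S2 → ℝ} (hf : Continuous f) : Integrable f σ :=
  by
  rw [← integrableOn_univ]
  exact hf.continuousOn.integrableOn_compact isCompact_univ

theorem memLp_of_continuous {f : S2 → ℝ} (hf : Continuous f) : MemLp f 2 σ := by
  obtain ⟨C, hC⟩ := isCompact_univ.exists_bound_of_continuousOn hf.continuousOn
  exact MemLp.of_bound hf.aestronglyMeasurable C (.of_forall fun x => hC x trivial)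

/-- By rotation invariance the integral of φ composed with the rotation by angle t does not depend
on t; its derivative at t = 0 is the integral in question. -/
theorem integral_rot (i : Fin 3) {φ : E3 → ℝ} (hφ : ContDiff ℝ 1 φ) :
    ∫ m : S2, rot i φ m ∂σ = 0 := by
  have hc : Continuous fun m : S2 => φ m := hφ.continuous.comp continuous_subtype_val
  have hr : Continuous fun m : S2 => rot i φ m :=
    (continuous_rot i hφ).comp continuous_subtype_val
  obtain ⟨C, hC⟩ := isCompact_univ.exists_bound_of_continuousOn hr.continuousOn
  have hcont : ∀ t, Continuous (sphereMap (rotIso i t)) := fun t => by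
    unfold sphereMap
    fun_prop
  have h := (hasDerivAt_integral_of_dominated_loc_of_deriv_le (μ := σ)
    (F := fun t m => φ (sphereMap (rotIso i t) m))
    (F' := fun t m => rot i φ (sphereMap (rotIso i t) m)) (x₀ := 0) (bound := fun _ => C)
    Filter.univ_mem (.of_forall fun t => (hc.comp (hcont t)).aestronglyMeasurable)
    (integrable_of_continuous (hc.comp (hcont 0)))
    (hr.comp (hcont 0)).aestronglyMeasurable (.of_forall fun m t _ => hC _ trivial)
    (integrable_const _) (.of_forall fun m t _ => by
      rw [rot_eq_rotAx]
      exact ((hφ.differentiable one_ne_zero).differentiableAt.hasFDerivAt).comp_hasDerivAt t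
        (hasDerivAt_rotMap i t m))).2
  have h1 : (fun t => ∫ m, φ (sphereMap (rotIso i t) m) ∂σ) = fun _ => ∫ m : S2, φ m ∂σ := by
    funext t
    have := (measurePreserving_sphereMap (rotIso i t)).map_eq
    conv_rhs => rw [← this]
    rw [integral_map (hcont t).aemeasurable hc.aestronglyMeasurable]
  rw [h1] at h
  have h2 := h.unique (hasDerivAt_const _ _)
  have h3 : ∀ m : S2, sphereMap (rotIso i 0) m = m := fun m => by
    ext1
    change rotMap i 0 m = m
    simp [rotMap]
  simpa [h3] using h2

theorem integral_rotAx (w : E3) {φ : E3 → ℝ} (hφ : ContDiff ℝ 1 φ) :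
    ∫ m : S2, rotAx w φ m ∂σ = 0 := by
  simp only [rotAx_eq_sum]
  rw [integral_finsetSum]
  · simp [integral_const_mul, integral_rot _ hφ]
  · exact fun i _ => (integrable_of_continuous
      ((continuous_rot i hφ).comp continuous_subtype_val)).const_mul _

theorem rot_add (i : Fin 3) {φ ψ : E3 → ℝ} (hφ : ContDiff ℝ 1 φ) (hψ : ContDiff ℝ 1 ψ) (m : E3) :
    rot i (fun x => φ x + ψ x) m = rot i φ m + rot i ψ m := by
  rw [rot_eq_rotAx, rot_eq_rotAx, rot_eq_rotAx]
  exact rotAx_add _ (hφ.differentiable one_ne_zero _) (hψ.differentiable one_ne_zero _)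

theorem rot_mul (i : Fin 3) {φ ψ : E3 → ℝ} (hφ : ContDiff ℝ 1 φ) (hψ : ContDiff ℝ 1 ψ) (m : E3) :
    rot i (fun x => φ x * ψ x) m = φ m * rot i ψ m + ψ m * rot i φ m := by
  rw [rot_eq_rotAx, rot_eq_rotAx, rot_eq_rotAx]
  exact rotAx_mul _ (hφ.differentiable one_ne_zero _) (hψ.differentiable one_ne_zero _)

theorem integral_mul_rot (i : Fin 3) {φ ψ : E3 → ℝ} (hφ : ContDiff ℝ 1 φ)
    (hψ : ContDiff ℝ 1 ψ) :
    ∫ m : S2, rot i φ m * ψ m ∂σ = - ∫ m : S2, φ m * rot i ψ m ∂σ := by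
  have h := integral_rot i (hφ.mul hψ)
  have hc : ∀ {f : E3 → ℝ}, Continuous f → Continuous fun m : S2 => f m :=
    fun hf => hf.comp continuous_subtype_val
  simp only [rot_mul i hφ hψ] at h
  rw [integral_add] at h
  · simp only [mul_comm (rot i φ _)]
    linarith
  · exact integrable_of_continuous ((hc hφ.continuous).mul (hc (continuous_rot i hψ)))
  · exact integrable_of_continuous ((hc hψ.continuous).mul (hc (continuous_rot i hφ)))

/-- A function with vanishing rotational gradient is constant on the sphere. -/
theorem eq_of_rot_eq_zero {φ : E3 → ℝ} (hφ : ContDiff ℝ 1 φ)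
    (h : ∀ i, ∀ m : S2, rot i φ m = 0) (x y : S2) : φ x = φ y := by
  have hinv : ∀ i t, ∀ x : E3, ‖x‖ = 1 → φ (rotMap i t x) = φ x := by
    intro i t x hx
    have hd : ∀ t, HasDerivAt (fun t => φ (rotMap i t x)) 0 t := fun t => by
      have h1 := ((hφ.differentiable one_ne_zero).differentiableAt.hasFDerivAt).comp_hasDerivAt t
        (hasDerivAt_rotMap i t x)
      refine h1.congr_deriv ?_
      have h2 := h i ⟨rotMap i t x, by simp [norm_rotMap, hx]⟩
      rwa [rot_eq_rotAx] at h2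
    have h3 := is_const_of_deriv_eq_zero (fun t => (hd t).differentiableAt)
      (fun t => (hd t).deriv) t 0
    simpa [rotMap] using h3
  have hpolar : ∀ a b : ℝ, ∃ r θ : ℝ, a = r * Real.cos θ ∧ b = r * Real.sin θ ∧
      r ^ 2 = a ^ 2 + b ^ 2 ∧ 0 ≤ r := fun a b => by
    refine ⟨‖(⟨a, b⟩ : ℂ)‖, Complex.arg ⟨a, b⟩, (Complex.norm_mul_cos_arg ⟨a, b⟩).symm,
      (Complex.norm_mul_sin_arg ⟨a, b⟩).symm, ?_, norm_nonneg _⟩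
    rw [Complex.sq_norm, Complex.normSq_mk]
    ring
  -- Spherical coordinates: a rotation about the third axis moves x into the plane of the first and
  -- third axes, and one about the second axis takes it to the pole. φ is constant along both
  -- orbits.
  have hpole : ∀ x : E3, ‖x‖ = 1 → φ x = φ (stdE 2) := by
    intro x hx
    obtain ⟨r, θ, h0, h1, hr, -⟩ := hpolar (x 0) (x 1)
    obtain ⟨ρ, β, h2, h3, hρ, hρ0⟩ := hpolar (x 2) r
    have hρ1 : ρ = 1 := by
      have h4 := norm_sq_E3 x
      rw [hx] at h4
      nlinarith
    rw [← hinv 2 (-θ) x hx, ← hinv 1 (-β) _ ((norm_rotMap _ _ _).trans hx)]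
    congr 1
    have c1 := Real.sin_sq_add_cos_sq θ
    have c2 := Real.sin_sq_add_cos_sq β
    rw [hρ1, one_mul] at h2 h3
    ext j
    fin_cases j <;> simp [rotMap, cross_ofLp, h0, h1, h2]
    · rw [h3]
      linear_combination (Real.cos β * Real.sin β) * c1
    · ring
    · rw [h3]
      linear_combination c2 + Real.sin β ^ 2 * c1
  rw [hpole x (by simp), hpole y (by simp)]

end SphereCalculus

/-! ### Rotation fields as derivations of the polynomial ring. -/

section Polynomials

/-- Polynomials in the coordinates of `ℝ³`. -/
abbrev Poly : Type := MvPolynomial (Fin 3) ℝ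

/-- The polynomial function on `ℝ³`. -/
def pev (p : Poly) (x : E3) : ℝ := MvPolynomial.eval x.ofLp p

theorem contDiff_pev (p : Poly) : ContDiff ℝ ∞ (pev p) := by
  unfold pev
  induction p using MvPolynomial.induction_on with
  | C a => simpa using contDiff_const
  | add p q hp hq => simpa using hp.add hq
  | mul_X p i hp => simpa using hp.mul (by fun_prop)

theorem continuous_pev (p : Poly) : Continuous fun m : S2 => pev p m :=
  (contDiff_pev p).continuous.comp continuous_subtype_val

/-- The rotation field `X_j ∂_k - X_k ∂_j`. -/
def rotPD (j k : Fin 3) : Derivation ℝ Poly Poly :=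
  (MvPolynomial.X j : Poly) • MvPolynomial.pderiv k - (MvPolynomial.X k : Poly) • MvPolynomial.pderiv j

/-- The rotational gradient of polynomials. -/
def rotP (i : Fin 3) : Derivation ℝ Poly Poly := rotPD (i + 1) (i + 2)

theorem rotP_X (i l : Fin 3) : pev (rotP i (MvPolynomial.X l)) = rot i (fun x => x l) := by
  funext m
  have h : rot i (fun x => x l) m = cross (stdE i) m l := by
    have h1 : (fun x : E3 => x l) = fun x => ⟪x, stdE l⟫_ℝ := by
      funext x
      simp [EuclideanSpace.inner_single_right]
    rw [rot_eq_rotAx, h1, rotAx_inner]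
    simp [EuclideanSpace.inner_single_right]
  rw [h]
  unfold pev rotP rotPD
  fin_cases i <;> fin_cases l <;> simp [cross_ofLp, MvPolynomial.pderiv_X]

theorem rot_pev (i : Fin 3) (p : Poly) : rot i (pev p) = pev (rotP i p) := by
  have h1 : ∀ q, ContDiff ℝ 1 (pev q) := fun q => (contDiff_pev q).of_le (by exact_mod_cast le_top)
  induction p using MvPolynomial.induction_on with
  | C a =>
    funext m
    have : pev (MvPolynomial.C a) = fun _ => a := by funext x; simp [pev]
    rw [this, rot_eq_rotAx, rotAx_const, ← MvPolynomial.algebraMap_eq, Derivation.map_algebraMap]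
    simp [pev]
  | add p q hp hq =>
    funext m
    have : pev (p + q) = fun x => pev p x + pev q x := by funext x; simp [pev]
    rw [this, rot_add i (h1 p) (h1 q), hp, hq]
    simp [pev]
  | mul_X p l hp =>
    funext m
    have h2 : pev (MvPolynomial.X l) = fun x => x l := by funext x; simp [pev]
    have : pev (p * MvPolynomial.X l) = fun x => pev p x * pev (MvPolynomial.X l) x := by
      funext x; simp [pev]
    rw [this, rot_mul i (h1 p) (h1 _), hp, h2, ← rotP_X, Derivation.leibniz]
    simp [pev]

theorem rotPD_mem (j k : Fin 3) (d : ℕ) {p : Poly}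
    (hp : p ∈ MvPolynomial.restrictTotalDegree (Fin 3) ℝ d) :
    (MvPolynomial.X j : Poly) * MvPolynomial.pderiv k p
      ∈ MvPolynomial.restrictTotalDegree (Fin 3) ℝ d := by
  rw [p.as_sum, map_sum, Finset.mul_sum]
  refine Submodule.sum_mem _ fun s hs => ?_
  rw [MvPolynomial.mem_restrictTotalDegree] at hp
  have hsd : s.degree ≤ d := by
    have := MvPolynomial.le_totalDegree hs
    exact this.trans hp
  rw [MvPolynomial.pderiv_monomial]
  by_cases hk : s k = 0
  · simp [hk]
  rw [MvPolynomial.X, MvPolynomial.monomial_mul, MvPolynomial.mem_restrictTotalDegree]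
  refine (MvPolynomial.totalDegree_monomial_le _ _).trans ?_
  change (Finsupp.single j 1 + (s - Finsupp.single k 1)).degree ≤ d
  have hle : Finsupp.single k 1 ≤ s := by
    rw [Finsupp.single_le_iff]; omega
  have h1 : (s - Finsupp.single k 1).degree + 1 = s.degree := by
    conv_rhs => rw [← tsub_add_cancel_of_le hle]
    rw [map_add, Finsupp.degree_single]
  rw [map_add, Finsupp.degree_single]
  omega

theorem rotP_mem (i : Fin 3) (d : ℕ) {p : Poly}
    (hp : p ∈ MvPolynomial.restrictTotalDegree (Fin 3) ℝ d) :
    rotP i p ∈ MvPolynomial.restrictTotalDegree (Fin 3) ℝ d := by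
  unfold rotP rotPD
  simpa using Submodule.sub_mem _ (rotPD_mem _ _ d hp) (rotPD_mem _ _ d hp)

/-- The commutation relation of so(3). Both sides are derivations, so it is enough to compare them
on the coordinates. -/
theorem rotP_comm (i : Fin 3) (p : Poly) :
    rotP i (rotP (i + 1) p) - rotP (i + 1) (rotP i p) = - rotP (i + 2) p := by
  have h : ⁅rotP i, rotP (i + 1)⁆ = - rotP (i + 2) := by
    apply MvPolynomial.derivation_ext
    intro l
    rw [Derivation.commutator_apply]
    unfold rotP rotPD
    fin_cases i <;> fin_cases l <;> simp [MvPolynomial.pderiv_X]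
  rw [← Derivation.commutator_apply, h]
  simp

/-- The Laplace–Beltrami operator on polynomials. -/
def lapP : Poly →ₗ[ℝ] Poly := ∑ i, (rotP i).toLinearMap ∘ₗ (rotP i).toLinearMap

theorem lapP_apply (p : Poly) : lapP p = ∑ i, rotP i (rotP i p) := by simp [lapP]

/-- The Laplacian is the Casimir element of so(3), which is central. -/
theorem lapP_rotP (i : Fin 3) (p : Poly) : lapP (rotP i p) = rotP i (lapP p) := by
  have c0 := rotP_comm 0
  have c1 := rotP_comm 1
  have c2 := rotP_comm 2
  norm_num at c0 c1 c2
  simp only [show (2 : Fin 3) + 1 = 0 from rfl, show (2 : Fin 3) + 2 = 1 from rfl,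
    show (1 : Fin 3) + 2 = 0 from rfl, show (1 : Fin 3) + 1 = 2 from rfl] at c0 c1 c2
  rw [lapP_apply, lapP_apply, Fin.sum_univ_three, Fin.sum_univ_three, map_add, map_add]
  have e0 := fun p => eq_add_of_sub_eq (c0 p)
  have e1 := fun p => eq_add_of_sub_eq (c1 p)
  have e2 := fun p => eq_add_of_sub_eq (c2 p)
  fin_cases i <;> simp only [Fin.zero_eta, Fin.mk_one, Fin.reduceFinMk, e0, e1, e2, map_add, map_neg]
    <;> abel

/-- The operator `1 - Δ`. -/
def helm : Poly →ₗ[ℝ] Poly := LinearMap.id - lapP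

theorem helm_apply (p : Poly) : helm p = p - ∑ i, rotP i (rotP i p) := by
  simp [helm, lapP_apply]

end Polynomials

/-! ### Polynomials in L²(S²): density, the second order a priori estimate, and solvability of 1 -
Δ. -/

section PolyClass

/-- Restriction of polynomials to the sphere. -/
def polyS : Poly →ₐ[ℝ] C(S2, ℝ) :=
  MvPolynomial.aeval fun j => ⟨fun m => (m : E3) j, by fun_prop⟩

theorem polyS_apply (p : Poly) (m : S2) : polyS p m = pev p m := by
  unfold polyS pev
  induction p using MvPolynomial.induction_on with
  | C a => simp
  | add p q hp hq => simp [hp, hq]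
  | mul_X p i hp => simp [hp]

/-- Stone–Weierstrass: the coordinates separate points. -/
theorem polyS_denseRange : DenseRange polyS := by
  have h := ContinuousMap.subalgebra_topologicalClosure_eq_top_of_separatesPoints polyS.range (by
    intro x y hxy
    obtain ⟨j, hj⟩ : ∃ j, (x : E3) j ≠ (y : E3) j := by
      by_contra! h
      exact hxy (Subtype.ext (by ext j; exact h j))
    refine ⟨_, ⟨polyS (MvPolynomial.X j), ⟨_, rfl⟩, rfl⟩, ?_⟩
    simpa [polyS_apply, pev] using hj)
  intro f
  have : f ∈ (polyS.range).topologicalClosure := by rw [h]; trivial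
  exact this

/-- The class of a polynomial in `L²(S²)`. -/
def pl : Poly →ₗ[ℝ] L2S :=
  (ContinuousMap.toLp 2 σ ℝ : C(S2, ℝ) →L[ℝ] L2S).toLinearMap ∘ₗ polyS.toLinearMap

theorem coeFn_pl (p : Poly) : ∀ᵐ m ∂σ, pl p m = pev p m := by
  filter_upwards [ContinuousMap.coeFn_toLp (p := 2) (𝕜 := ℝ) σ (polyS p)] with m hm
  rw [← polyS_apply, ← hm]
  rfl

theorem denseRange_pl : DenseRange pl :=
  (ContinuousMap.toLp_denseRange ℝ σ ℝ (by norm_num)).comp polyS_denseRange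
    (ContinuousLinearMap.continuous _)

theorem inner_L2S (f g : L2S) : ⟪f, g⟫_ℝ = ∫ m, f m * g m ∂σ := by
  rw [L2.inner_def]
  simp [mul_comm]

theorem inner_L2S_eq {f g : L2S} {f' g' : S2 → ℝ} (hf : f =ᵐ[σ] f') (hg : g =ᵐ[σ] g') :
    ⟪f, g⟫_ℝ = ∫ m, f' m * g' m ∂σ := by
  rw [inner_L2S]
  refine integral_congr_ae ?_
  filter_upwards [hf, hg] with m h1 h2
  rw [h1, h2]

theorem eq_of_inner_pl {u v : L2S} (h : ∀ p, ⟪u, pl p⟫_ℝ = ⟪v, pl p⟫_ℝ) : u = v := by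
  refine ext_inner_right ℝ fun w => ?_
  exact congrFun (denseRange_pl.equalizer (g := fun w => ⟪u, w⟫_ℝ) (h := fun w => ⟪v, w⟫_ℝ)
    (by fun_prop) (by fun_prop) (funext h)) w

theorem inner_rotP (i : Fin 3) (p q : Poly) :
    ⟪pl (rotP i p), pl q⟫_ℝ = - ⟪pl p, pl (rotP i q)⟫_ℝ := by
  have h1 : ∀ q, ContDiff ℝ 1 (pev q) := fun q => (contDiff_pev q).of_le (by exact_mod_cast le_top)
  rw [inner_L2S_eq (coeFn_pl _) (coeFn_pl _), inner_L2S_eq (coeFn_pl _) (coeFn_pl _),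
    ← rot_pev, ← rot_pev]
  exact integral_mul_rot i (h1 p) (h1 q)

theorem inner_lapP (p q : Poly) :
    ⟪pl p, pl (lapP q)⟫_ℝ = - ∑ i, ⟪pl (rotP i p), pl (rotP i q)⟫_ℝ := by
  rw [lapP_apply, map_sum, inner_sum, ← Finset.sum_neg_distrib]
  refine Finset.sum_congr rfl fun i _ => ?_
  rw [inner_rotP]
  simp

theorem inner_helm_comm (p q : Poly) : ⟪pl (helm p), pl q⟫_ℝ = ⟪pl p, pl (helm q)⟫_ℝ := by
  have h := inner_lapP p q
  have h' := inner_lapP q p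
  simp only [helm, LinearMap.sub_apply, LinearMap.id_apply, map_sub, inner_sub_left, inner_sub_right]
  rw [h, real_inner_comm _ (pl (lapP p)), h']
  simp [real_inner_comm]

/-- Two integrations by parts. Since Δ commutes with each R_j, no curvature term appears. -/
theorem sum_norm_rotP_rotP (p : Poly) :
    ∑ j, ∑ i, ‖pl (rotP i (rotP j p))‖ ^ 2 = ‖pl (lapP p)‖ ^ 2 := by
  have h : ∀ j, ∑ i, ‖pl (rotP i (rotP j p))‖ ^ 2 = ⟪pl (rotP j (rotP j p)), pl (lapP p)⟫_ℝ := by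
    intro j
    have h1 := inner_lapP (rotP j p) (rotP j p)
    rw [lapP_rotP, eq_neg_iff_add_eq_zero, ← neg_eq_iff_add_eq_zero] at h1
    have h2 := inner_rotP j (rotP j p) (lapP p)
    simp only [← real_inner_self_eq_norm_sq]
    rw [h2, h1]
  simp only [h]
  rw [← sum_inner, ← map_sum, ← lapP_apply, real_inner_self_eq_norm_sq]

/-- The cross term is twice the Dirichlet energy, so all terms are nonnegative and 1 - Δ dominates
every derivative of order at most two. -/
theorem norm_sq_helm (p : Poly) :
    ‖pl (helm p)‖ ^ 2 = ‖pl p‖ ^ 2 + 2 * ∑ i, ‖pl (rotP i p)‖ ^ 2 + ‖pl (lapP p)‖ ^ 2 := by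
  have h := inner_lapP p p
  simp only [real_inner_self_eq_norm_sq] at h
  simp only [helm, LinearMap.sub_apply, LinearMap.id_apply, map_sub]
  rw [norm_sub_sq_real, h]
  ring

theorem norm_pl_le (p : Poly) : ‖pl p‖ ≤ ‖pl (helm p)‖ := by
  rw [← sq_le_sq₀ (norm_nonneg _) (norm_nonneg _), norm_sq_helm]
  have : 0 ≤ ∑ i, ‖pl (rotP i p)‖ ^ 2 := Finset.sum_nonneg fun i _ => sq_nonneg _
  nlinarith [sq_nonneg ‖pl (lapP p)‖]

theorem norm_rotP_le (i : Fin 3) (p : Poly) : ‖pl (rotP i p)‖ ≤ ‖pl (helm p)‖ := by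
  rw [← sq_le_sq₀ (norm_nonneg _) (norm_nonneg _), norm_sq_helm]
  have := Finset.single_le_sum (f := fun i => ‖pl (rotP i p)‖ ^ 2) (fun i _ => sq_nonneg _)
    (Finset.mem_univ i)
  nlinarith [sq_nonneg ‖pl (lapP p)‖, sq_nonneg ‖pl p‖, sq_nonneg ‖pl (rotP i p)‖]

theorem norm_rotP_rotP_le (i j : Fin 3) (p : Poly) :
    ‖pl (rotP i (rotP j p))‖ ≤ ‖pl (helm p)‖ := by
  rw [← sq_le_sq₀ (norm_nonneg _) (norm_nonneg _), norm_sq_helm, ← sum_norm_rotP_rotP]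
  have h1 := Finset.single_le_sum (f := fun j => ∑ i, ‖pl (rotP i (rotP j p))‖ ^ 2)
    (fun j _ => Finset.sum_nonneg fun i _ => sq_nonneg _) (Finset.mem_univ j)
  have h2 := Finset.single_le_sum (f := fun i => ‖pl (rotP i (rotP j p))‖ ^ 2)
    (fun i _ => sq_nonneg _) (Finset.mem_univ i)
  have h3 : 0 ≤ ∑ i, ‖pl (rotP i p)‖ ^ 2 := Finset.sum_nonneg fun i _ => sq_nonneg _
  nlinarith [sq_nonneg ‖pl p‖]

/-- An operator on polynomials that preserves degrees is onto, as an operator on functions on the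
sphere, as soon as its quadratic form is definite. -/
theorem exists_pl_eq_of_definite (A : Poly →ₗ[ℝ] Poly)
    (hA : ∀ d, ∀ p ∈ MvPolynomial.restrictTotalDegree (Fin 3) ℝ d,
      A p ∈ MvPolynomial.restrictTotalDegree (Fin 3) ℝ d)
    (hdef : ∀ p, ⟪pl p, pl (A p)⟫_ℝ = 0 → pl p = 0) (p : Poly) : ∃ q, pl (A q) = pl p := by
  set W := MvPolynomial.restrictTotalDegree (Fin 3) ℝ p.totalDegree with hW
  have hp : p ∈ W := (MvPolynomial.mem_restrictTotalDegree _ _ _).2 le_rfl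
  set S : Submodule ℝ L2S := W.map (pl ∘ₗ A) with hS
  have : FiniteDimensional ℝ S := inferInstanceAs (Module.Finite ℝ (W.map (pl ∘ₗ A)))
  obtain ⟨a, ha, b, hb, hab⟩ := S.exists_add_mem_mem_orthogonal (pl p)
  obtain ⟨q, hq, hqa⟩ := ha
  have hb' : pl (p - A q) = b := by
    rw [map_sub, hab, ← hqa]
    simp
  have hr : p - A q ∈ W := Submodule.sub_mem _ hp (hA _ _ hq)
  -- The remainder r = p - A q of the orthogonal projection onto A(W) again lies in W. It is
  -- therefore orthogonal to A r, and definiteness makes it vanish on the sphere.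
  have h0 : pl (p - A q) = 0 := by
    apply hdef
    rw [real_inner_comm, hb']
    exact (Submodule.mem_orthogonal _ _).1 hb _ ⟨_, hr, rfl⟩
  exact ⟨q, by rw [map_sub, sub_eq_zero] at h0; exact h0.symm⟩

theorem lapP_mem (d : ℕ) {p : Poly} (hp : p ∈ MvPolynomial.restrictTotalDegree (Fin 3) ℝ d) :
    lapP p ∈ MvPolynomial.restrictTotalDegree (Fin 3) ℝ d := by
  rw [lapP_apply]
  exact Submodule.sum_mem _ fun i _ => rotP_mem i d (rotP_mem i d hp)

theorem exists_helm_eq (p : Poly) : ∃ q, pl (helm q) = pl p := by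
  refine exists_pl_eq_of_definite helm (fun d p hp => Submodule.sub_mem _ hp (lapP_mem d hp)) ?_ p
  intro p hp
  have h := inner_lapP p p
  simp only [real_inner_self_eq_norm_sq] at h
  simp only [helm, LinearMap.sub_apply, LinearMap.id_apply, map_sub, inner_sub_right, h,
    real_inner_self_eq_norm_sq] at hp
  have : 0 ≤ ∑ i, ‖pl (rotP i p)‖ ^ 2 := Finset.sum_nonneg fun i _ => sq_nonneg _
  have h0 : ‖pl p‖ ^ 2 = 0 := by nlinarith [sq_nonneg ‖pl p‖]
  simpa using h0

theorem denseRange_helm : DenseRange fun p => pl (helm p) := by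
  refine denseRange_pl.mono ?_
  rintro _ ⟨p, rfl⟩
  exact exists_helm_eq p

end PolyClass

/-! ### Weak derivatives, Sobolev spaces and elliptic regularity. -/

section Weak

open Filter Topology

theorem hasWeakRot_congr {i : Fin 3} {f f' g g' : S2 → ℝ} (hf : f =ᵐ[σ] f') (hg : g =ᵐ[σ] g')
    (h : HasWeakRot i f g) : HasWeakRot i f' g' := by
  intro ψ hψ
  have h1 : ∫ m, g' m * ψ m ∂σ = ∫ m, g m * ψ m ∂σ :=
    integral_congr_ae (by filter_upwards [hg] with m hm; rw [hm])
  have h2 : ∫ m, f' m * rot i ψ m ∂σ = ∫ m, f m * rot i ψ m ∂σ :=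
    integral_congr_ae (by filter_upwards [hf] with m hm; rw [hm])
  rw [h1, h2, h ψ hψ]

theorem memLp_of_contDiff {ψ : E3 → ℝ} (hψ : ContDiff ℝ ∞ ψ) : MemLp (fun m : S2 => ψ m) 2 σ :=
  memLp_of_continuous (hψ.continuous.comp continuous_subtype_val)

theorem contDiff_one {ψ : E3 → ℝ} (hψ : ContDiff ℝ ∞ ψ) : ContDiff ℝ 1 ψ :=
  hψ.of_le (by exact_mod_cast le_top)

theorem hasWeakRot_of_contDiff (i : Fin 3) {ψ : E3 → ℝ} (hψ : ContDiff ℝ ∞ ψ) :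
    HasWeakRot i (fun m => ψ m) (fun m => rot i ψ m) :=
  fun _ hφ => integral_mul_rot i (contDiff_one hψ) (contDiff_one hφ)

theorem integrable_mul_of_memLp {f g : S2 → ℝ} (hf : MemLp f 2 σ) (hg : MemLp g 2 σ) :
    Integrable (fun m => f m * g m) σ := hf.integrable_mul hg

theorem exists_tendsto_of_norm_le_helm {χ : ℕ → Poly} {F : L2S}
    (hχ : Tendsto (fun n => pl (helm (χ n))) atTop (𝓝 F)) (A : Poly →ₗ[ℝ] Poly)
    (hA : ∀ p, ‖pl (A p)‖ ≤ ‖pl (helm p)‖) :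
    ∃ g, Tendsto (fun n => pl (A (χ n))) atTop (𝓝 g) := by
  apply cauchySeq_tendsto_of_complete
  have hc := hχ.cauchySeq
  rw [Metric.cauchySeq_iff] at hc ⊢
  intro ε hε
  obtain ⟨N, hN⟩ := hc ε hε
  refine ⟨N, fun m hm n hn => lt_of_le_of_lt ?_ (hN m hm n hn)⟩
  rw [dist_eq_norm, dist_eq_norm, ← map_sub, ← map_sub, ← map_sub, ← map_sub]
  exact hA _

/-- A weak solution of `(1 - Δ) u = F` is a limit of polynomials in the second order Sobolev
norm. -/
theorem exists_poly_approx {u F : L2S} (h : ∀ p, ⟪u, pl (helm p)⟫_ℝ = ⟪F, pl p⟫_ℝ) :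
    ∃ (χ : ℕ → Poly) (g : Fin 3 → L2S) (k : Fin 3 → Fin 3 → L2S),
      Tendsto (fun n => pl (χ n)) atTop (𝓝 u) ∧
      (∀ i, Tendsto (fun n => pl (rotP i (χ n))) atTop (𝓝 (g i))) ∧
      ∀ i j, Tendsto (fun n => pl (rotP i (rotP j (χ n)))) atTop (𝓝 (k i j)) := by
  obtain ⟨x, hx, hxF⟩ := mem_closure_iff_seq_limit.1 (denseRange_helm F)
  choose χ hχ using hx
  have hF : Tendsto (fun n => pl (helm (χ n))) atTop (𝓝 F) := by
    simpa only [hχ] using hxF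
  obtain ⟨v, hv⟩ := exists_tendsto_of_norm_le_helm hF LinearMap.id norm_pl_le
  choose g hg using fun i => exists_tendsto_of_norm_le_helm hF (rotP i).toLinearMap (norm_rotP_le i)
  choose k hk using fun i j => exists_tendsto_of_norm_le_helm hF
    ((rotP i).toLinearMap ∘ₗ (rotP j).toLinearMap) (norm_rotP_rotP_le i j)
  refine ⟨χ, g, k, ?_, hg, hk⟩
  -- The limit v and the given weak solution u have the same pairings with the functions (1 - Δ) p,
  -- which are dense.
  have huv : v = u := by
    refine ext_inner_right ℝ fun w => ?_
    refine congrFun (denseRange_helm.equalizer (g := fun w => ⟪v, w⟫_ℝ) (h := fun w => ⟪u, w⟫_ℝ)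
      (by fun_prop) (by fun_prop) (funext fun p => ?_)) w
    simp only [Function.comp]
    rw [h]
    refine tendsto_nhds_unique (hv.inner (tendsto_const_nhds (x := pl (helm p)))) ?_
    refine (hF.inner (tendsto_const_nhds (x := pl p))).congr fun n => ?_
    rw [inner_helm_comm]
    rfl
  rwa [← huv]

theorem inner_toLp_pl {f : S2 → ℝ} (hf : MemLp f 2 σ) (p : Poly) :
    ⟪hf.toLp f, pl p⟫_ℝ = ∫ m, f m * pev p m ∂σ :=
  inner_L2S_eq hf.coeFn_toLp (coeFn_pl p)

theorem tendsto_weak {i : Fin 3} {χ : ℕ → Poly} {u g : L2S}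
    (hu : Tendsto (fun n => pl (χ n)) atTop (𝓝 u))
    (hg : Tendsto (fun n => pl (rotP i (χ n))) atTop (𝓝 g)) (p : Poly) :
    ⟪g, pl p⟫_ℝ = - ⟪u, pl (rotP i p)⟫_ℝ := by
  refine tendsto_nhds_unique (hg.inner (tendsto_const_nhds (x := pl p))) ?_
  refine (hu.inner (tendsto_const_nhds (x := pl (rotP i p)))).neg.congr fun n => ?_
  rw [inner_rotP]

theorem contDiff_lap {ψ : E3 → ℝ} (hψ : ContDiff ℝ ∞ ψ) :
    ContDiff ℝ ∞ fun x => ψ x - ∑ i, rot i (rot i ψ) x :=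
  hψ.sub (ContDiff.sum fun i _ => contDiff_rot_infty i (contDiff_rot_infty i hψ))

theorem integral_finsetSum_mul {f : Fin 3 → S2 → ℝ} {g : S2 → ℝ} (hf : ∀ i, MemLp (f i) 2 σ)
    (hg : MemLp g 2 σ) :
    ∫ m, (∑ i, f i m) * g m ∂σ = ∑ i, ∫ m, f i m * g m ∂σ := by
  simp only [Finset.sum_mul]
  exact integral_finsetSum _ fun i _ => integrable_mul_of_memLp (hf i) hg

/-- Weak derivatives can be tested with polynomials only. -/
theorem hasWeakRot_of_poly {i : Fin 3} {f g : L2S}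
    (h : ∀ p, ⟪g, pl p⟫_ℝ = - ⟪f, pl (rotP i p)⟫_ℝ) : HasWeakRot i f g := by
  intro ψ hψ
  have hm : ∀ {φ : E3 → ℝ}, ContDiff ℝ ∞ φ → MemLp (fun m : S2 => φ m) 2 σ := memLp_of_contDiff
  have hmp : ∀ p, MemLp (fun m : S2 => pev p m) 2 σ := fun p => hm (contDiff_pev p)
  -- The test function ψ is itself a weak solution, with right-hand side ψ - Δψ. Polynomials thus
  -- approximate it together with its derivatives, and the identity for polynomials passes to the
  -- limit.
  obtain ⟨χ, g', k, h1, h2, -⟩ := exists_poly_approx (u := (hm hψ).toLp) (F := (hm (contDiff_lap hψ)).toLp)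
    (fun p => by
      rw [inner_toLp_pl, inner_toLp_pl]
      have e1 : ∀ m : E3, pev (helm p) m = pev p m - ∑ i, pev (rotP i (rotP i p)) m := fun m => by
        simp [pev, helm_apply]
      simp only [e1, mul_sub, sub_mul]
      have hr : ∀ i, MemLp (fun m : S2 => rot i (rot i ψ) m) 2 σ := fun i =>
        hm (contDiff_rot_infty i (contDiff_rot_infty i hψ))
      rw [integral_sub (integrable_mul_of_memLp (hm hψ) (hmp p)), 
        integral_sub (integrable_mul_of_memLp (hm hψ) (hmp p)), integral_finsetSum_mul hr (hmp p)]
      · congr 1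
        simp only [mul_comm (ψ _), integral_finsetSum_mul (fun i => hmp _) (hm hψ)]
        refine Finset.sum_congr rfl fun i _ => ?_
        have a1 := integral_mul_rot i (contDiff_one (contDiff_rot_infty i hψ))
          (contDiff_one (contDiff_pev p))
        have a2 := integral_mul_rot i (contDiff_one hψ)
          (contDiff_one (contDiff_rot_infty i (contDiff_pev p)))
        simp only [rot_pev] at a1 a2
        rw [a1, a2, neg_neg]
        simp only [mul_comm]
      · exact integrable_mul_of_memLp (memLp_finsetSum _ fun i _ => hr i) (hmp p)
      · exact integrable_mul_of_memLp (hm hψ) (memLp_finsetSum _ fun i _ => hmp _))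
  have hg' : g' i = (hm (contDiff_rot_infty i hψ)).toLp := by
    refine eq_of_inner_pl fun p => ?_
    rw [tendsto_weak h1 (h2 i), inner_toLp_pl, inner_toLp_pl, ← rot_pev,
      integral_mul_rot i (contDiff_one hψ) (contDiff_one (contDiff_pev p))]
  have h3 := tendsto_nhds_unique ((tendsto_const_nhds (x := g)).inner h1)
    (((tendsto_const_nhds (x := f)).inner (h2 i)).neg.congr fun n => (h (χ n)).symm)
  rw [hg'] at h3
  rwa [inner_L2S_eq (ae_eq_refl _) (MemLp.coeFn_toLp _),
    inner_L2S_eq (ae_eq_refl _) (MemLp.coeFn_toLp _)] at h3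

theorem HasWeakRot.inner_pl {i : Fin 3} {f g : L2S} (h : HasWeakRot i f g) (p : Poly) :
    ⟪g, pl p⟫_ℝ = - ⟪f, pl (rotP i p)⟫_ℝ := by
  rw [inner_L2S_eq (ae_eq_refl _) (coeFn_pl _), inner_L2S_eq (ae_eq_refl _) (coeFn_pl _), ← rot_pev]
  exact h _ (contDiff_pev p)

theorem HasWeakRot.toLp {i : Fin 3} {f g : S2 → ℝ} (h : HasWeakRot i f g) (hf : MemLp f 2 σ)
    (hg : MemLp g 2 σ) : HasWeakRot i (hf.toLp f) (hg.toLp g) :=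
  hasWeakRot_congr hf.coeFn_toLp.symm hg.coeFn_toLp.symm h

theorem HasWeakRot.unique {i : Fin 3} {f g g' : S2 → ℝ} (hg : MemLp g 2 σ) (hg' : MemLp g' 2 σ)
    (h : HasWeakRot i f g) (h' : HasWeakRot i f g') : g =ᵐ[σ] g' := by
  have : hg.toLp g = hg'.toLp g' := by
    refine eq_of_inner_pl fun p => ?_
    rw [inner_toLp_pl, inner_toLp_pl, h _ (contDiff_pev p), h' _ (contDiff_pev p)]
  exact (MemLp.toLp_eq_toLp_iff _ _).1 this

theorem weakRot_ae {i : Fin 3} {f g : S2 → ℝ} (hg : MemLp g 2 σ) (h : HasWeakRot i f g) :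
    weakRot i f =ᵐ[σ] g := by
  have hex : ∃ g : S2 → ℝ, MemLp g 2 σ ∧ HasWeakRot i f g := ⟨g, hg, h⟩
  unfold weakRot
  rw [dif_pos hex]
  exact HasWeakRot.unique hex.choose_spec.1 hg hex.choose_spec.2 h

theorem HasWeakRot.add {i : Fin 3} {f g f' g' : S2 → ℝ} (hf : MemLp f 2 σ) (hg : MemLp g 2 σ)
    (hf' : MemLp f' 2 σ) (hg' : MemLp g' 2 σ) (h : HasWeakRot i f g) (h' : HasWeakRot i f' g') :
    HasWeakRot i (fun m => f m + f' m) (fun m => g m + g' m) := by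
  intro ψ hψ
  have hψm := memLp_of_contDiff hψ
  have hrm := memLp_of_contDiff (contDiff_rot_infty i hψ)
  simp only [add_mul]
  rw [integral_add (integrable_mul_of_memLp hg hψm) (integrable_mul_of_memLp hg' hψm),
    integral_add (integrable_mul_of_memLp hf hrm) (integrable_mul_of_memLp hf' hrm), h ψ hψ, h' ψ hψ]
  ring

theorem memLp_contDiff_mul {a : E3 → ℝ} (ha : ContDiff ℝ ∞ a) {f : S2 → ℝ} (hf : MemLp f 2 σ) :
    MemLp (fun m : S2 => a m * f m) 2 σ := by
  have hc : Continuous fun m : S2 => a m := ha.continuous.comp continuous_subtype_val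
  obtain ⟨C, hC⟩ := isCompact_univ.exists_bound_of_continuousOn hc.continuousOn
  refine (hf.const_mul C).mono (hc.aestronglyMeasurable.mul hf.1) (.of_forall fun m => ?_)
  rw [norm_mul, norm_mul]
  gcongr
  exact (hC m trivial).trans (le_abs_self C)

theorem HasWeakRot.mul {i : Fin 3} {f g : S2 → ℝ} (hf : MemLp f 2 σ) (hg : MemLp g 2 σ)
    {a : E3 → ℝ} (ha : ContDiff ℝ ∞ a) (h : HasWeakRot i f g) :
    HasWeakRot i (fun m : S2 => a m * f m) (fun m => a m * g m + rot i a m * f m) := by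
  intro ψ hψ
  have hψm := memLp_of_contDiff hψ
  have hrm := memLp_of_contDiff (contDiff_rot_infty i hψ)
  have h1 := h _ (ha.mul hψ)
  simp only [rot_mul i (contDiff_one ha) (contDiff_one hψ)] at h1
  have e1 : ∀ m : S2, (a m * g m + rot i a m * f m) * ψ m
      = g m * (a m * ψ m) + (rot i a m * f m) * ψ m := fun m => by ring
  have e2 : ∀ m : S2, f m * (a m * rot i ψ m + ψ m * rot i a m)
      = a m * f m * rot i ψ m + (rot i a m * f m) * ψ m := fun m => by ring
  have i1 := integrable_mul_of_memLp (memLp_contDiff_mul (contDiff_rot_infty i ha) hf) hψm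
  simp only [e2] at h1
  simp only [e1]
  rw [integral_add (integrable_mul_of_memLp hg (memLp_of_contDiff (ha.mul hψ))) i1, h1,
    integral_add (integrable_mul_of_memLp (memLp_contDiff_mul ha hf) hrm) i1]
  ring

theorem MemH.memLp {k : ℕ} {f : S2 → ℝ} (h : MemH k f) : MemLp f 2 σ := by
  cases k with
  | zero => exact h
  | succ k => exact h.1

theorem MemH.add {k : ℕ} : ∀ {f g : S2 → ℝ}, MemH k f → MemH k g → MemH k fun m => f m + g m := by
  induction k with
  | zero => exact fun hf hg => MemLp.add hf hg
  | succ k ih =>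
    intro f g hf hg
    refine ⟨hf.1.add hg.1, fun i => ?_⟩
    obtain ⟨f', hf', hf''⟩ := hf.2 i
    obtain ⟨g', hg', hg''⟩ := hg.2 i
    exact ⟨_, ih hf' hg', hf''.add hf.1 hf'.memLp hg.1 hg'.memLp hg''⟩

theorem MemH.of_succ {k : ℕ} : ∀ {f : S2 → ℝ}, MemH (k + 1) f → MemH k f := by
  induction k with
  | zero => exact fun hf => hf.1
  | succ k ih =>
    intro f hf
    refine ⟨hf.1, fun i => ?_⟩
    obtain ⟨g, hg, hg'⟩ := hf.2 i
    exact ⟨g, ih hg, hg'⟩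

theorem MemH.mul {k : ℕ} : ∀ {f : S2 → ℝ} {a : E3 → ℝ}, ContDiff ℝ ∞ a → MemH k f →
    MemH k fun m : S2 => a m * f m := by
  induction k with
  | zero => exact fun ha hf => memLp_contDiff_mul ha hf
  | succ k ih =>
    intro f a ha hf
    refine ⟨memLp_contDiff_mul ha hf.1, fun i => ?_⟩
    obtain ⟨g, hg, hg'⟩ := hf.2 i
    exact ⟨_, (ih ha hg).add (ih (contDiff_rot_infty i ha) hf.of_succ), hg'.mul hf.1 hg.memLp ha⟩

theorem memH_of_contDiff (k : ℕ) : ∀ {ψ : E3 → ℝ}, ContDiff ℝ ∞ ψ → MemH k fun m => ψ m := by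
  induction k with
  | zero => exact fun h => memLp_of_contDiff h
  | succ k ih => exact fun h => ⟨memLp_of_contDiff h, fun i =>
      ⟨_, ih (contDiff_rot_infty i h), hasWeakRot_of_contDiff i h⟩⟩

theorem MemH.congr {k : ℕ} {f f' : S2 → ℝ} (hff : f =ᵐ[σ] f') (h : MemH k f) : MemH k f' := by
  cases k with
  | zero => exact MemLp.ae_eq hff h
  | succ k =>
    refine ⟨MemLp.ae_eq hff h.1, fun i => ?_⟩
    obtain ⟨g, hg, hg'⟩ := h.2 i
    exact ⟨g, hg, hasWeakRot_congr hff (ae_eq_refl _) hg'⟩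

/-- Elliptic regularity: a weak solution of `(1 - Δ) u = F` with `F ∈ L²` lies in `H²`. -/
theorem memH_two_of_weak {u F : L2S} (h : ∀ p, ⟪u, pl (helm p)⟫_ℝ = ⟪F, pl p⟫_ℝ) : MemH 2 u := by
  obtain ⟨χ, g, k, h0, h1, h2⟩ := exists_poly_approx h
  exact ⟨Lp.memLp u, fun j => ⟨g j, ⟨Lp.memLp _, fun i => ⟨k i j, Lp.memLp _,
    hasWeakRot_of_poly (tendsto_weak (h1 j) (h2 i j))⟩⟩, hasWeakRot_of_poly (tendsto_weak h0 (h1 j))⟩⟩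

/-- The converse of elliptic regularity, with F = u - Σ R_i R_i u; it makes `exists_poly_approx`
available for every function in H². -/
theorem MemH.exists_weak_helm {u : L2S} (h : MemH 2 u) :
    ∃ F : L2S, ∀ p, ⟪u, pl (helm p)⟫_ℝ = ⟪F, pl p⟫_ℝ := by
  choose g hg hgu using h.2
  choose k hk hkg using fun i => (hg i).2 i
  have hk' : ∀ i, MemLp (k i) 2 σ := hk
  refine ⟨u - ∑ i, (hk' i).toLp (k i), fun p => ?_⟩
  rw [helm_apply, map_sub, inner_sub_right, inner_sub_left, map_sum, inner_sum, sum_inner]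
  congr 1
  refine Finset.sum_congr rfl fun i _ => ?_
  have h1 := hkg i _ (contDiff_pev p)
  have h2 := hgu i _ (contDiff_pev (rotP i p))
  rw [rot_pev] at h1 h2
  rw [inner_L2S_eq (ae_eq_refl _) (coeFn_pl _), inner_toLp_pl, h1, h2, neg_neg]

/-- Integration by parts for Sobolev functions. -/
theorem HasWeakRot.integral_mul {i : Fin 3} {f g f' g' : S2 → ℝ} (hf : MemLp f 2 σ)
    (hg : MemLp g 2 σ) (hg' : MemLp g' 2 σ) (h : HasWeakRot i f g) (hf' : MemH 2 f')
    (h' : HasWeakRot i f' g') : ∫ m, g m * f' m ∂σ = - ∫ m, f m * g' m ∂σ := by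
  have hl := hf'.memLp
  -- Only the second factor is approximated by polynomials; for the first its weak derivative
  -- suffices.
  obtain ⟨F, hF⟩ := MemH.exists_weak_helm (u := hl.toLp f') (hf'.congr hl.coeFn_toLp.symm)
  obtain ⟨χ, G, k, h0, h1, -⟩ := exists_poly_approx hF
  have hG : G i = hg'.toLp g' := by
    refine eq_of_inner_pl fun p => ?_
    rw [tendsto_weak h0 (h1 i), inner_toLp_pl, inner_toLp_pl, h' _ (contDiff_pev p), rot_pev]
  have h3 := tendsto_nhds_unique ((tendsto_const_nhds (x := hg.toLp g)).inner h0)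
    (((tendsto_const_nhds (x := hf.toLp f)).inner (h1 i)).neg.congr fun n =>
      ((h.toLp hf hg).inner_pl (χ n)).symm)
  rw [hG] at h3
  rwa [inner_L2S_eq (MemLp.coeFn_toLp _) (MemLp.coeFn_toLp _),
    inner_L2S_eq (MemLp.coeFn_toLp _) (MemLp.coeFn_toLp _)] at h3

theorem pev_C (c : ℝ) (x : E3) : pev (MvPolynomial.C c) x = c := by simp [pev]

theorem inner_pl_C (u : L2S) (c : ℝ) : ⟪u, pl (MvPolynomial.C c)⟫_ℝ = c * ∫ m, u m ∂σ := by
  rw [inner_L2S_eq (ae_eq_refl _) (coeFn_pl _)]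
  simp only [pev_C]
  rw [integral_mul_const, mul_comm]

theorem sigma_univ_pos : 0 < σ.real Set.univ := by
  rw [measureReal_def]
  exact ENNReal.toReal_pos (by simpa using sigma_ne_zero) (measure_ne_top _ _)

theorem continuous_eq_of_ae {f g : S2 → ℝ} (hf : Continuous f) (hg : Continuous g)
    (h : f =ᵐ[σ] g) : f = g := (Continuous.ae_eq_iff_eq σ hf hg).1 h

/-- The operator `p ↦ ∫ p - Δ p` on polynomials. -/
def meanSubLap : Poly →ₗ[ℝ] Poly :=
  LinearMap.smulRight (innerₛₗ ℝ (pl (MvPolynomial.C 1)) ∘ₗ pl) (MvPolynomial.C 1 : Poly) - lapP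

theorem meanSubLap_apply (p : Poly) :
    meanSubLap p = ⟪pl (MvPolynomial.C 1), pl p⟫_ℝ • (MvPolynomial.C 1 : Poly) - lapP p := by
  simp [meanSubLap]

/-- The quadratic form is (∫ p)² plus the Dirichlet energy. The mean term removes the constants, the
only obstruction to the definiteness of -Δ. -/
theorem exists_meanSubLap_eq (p : Poly) : ∃ q, pl (meanSubLap q) = pl p := by
  refine exists_pl_eq_of_definite meanSubLap (fun d p hp => ?_) (fun p hp => ?_) p
  · rw [meanSubLap_apply]
    refine Submodule.sub_mem _ (Submodule.smul_mem _ _ ?_) (lapP_mem d hp)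
    rw [MvPolynomial.mem_restrictTotalDegree]
    simp
  · have h := inner_lapP p p
    simp only [real_inner_self_eq_norm_sq] at h
    rw [meanSubLap_apply, map_sub, map_smul, inner_sub_right, inner_smul_right, h,
      real_inner_comm (pl (MvPolynomial.C 1))] at hp
    have h1 : 0 ≤ ∑ i, ‖pl (rotP i p)‖ ^ 2 := Finset.sum_nonneg fun i _ => sq_nonneg _
    have h2 : ⟪pl (MvPolynomial.C 1), pl p⟫_ℝ = 0 := by
      rw [← mul_self_eq_zero]
      linarith [mul_self_nonneg ⟪pl (MvPolynomial.C 1), pl p⟫_ℝ]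
    have h3 : ∑ i, ‖pl (rotP i p)‖ ^ 2 = 0 := by
      rw [h2] at hp
      linarith
    have h4 : ∀ i, pl (rotP i p) = 0 := fun i => by
      have := (Finset.sum_eq_zero_iff_of_nonneg fun i _ => sq_nonneg _).1 h3 i (Finset.mem_univ i)
      simpa using this
    have h5 : ∀ i, ∀ m : S2, rot i (pev p) m = 0 := by
      intro i
      refine congrFun (continuous_eq_of_ae (g := fun _ => 0) ?_ continuous_const ?_)
      · rw [rot_pev]; exact continuous_pev _
      · have := coeFn_pl (rotP i p)
        rw [h4 i] at this
        filter_upwards [this, Lp.coeFn_zero ℝ 2 σ] with m h6 h7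
        rw [rot_pev, ← h6, h7]
        rfl
    obtain ⟨m₀⟩ : Nonempty S2 := ⟨⟨stdE 0, by simp⟩⟩
    have h6 : pl p = pl (MvPolynomial.C (pev p m₀)) := by
      apply Lp.ext
      filter_upwards [coeFn_pl p, coeFn_pl (MvPolynomial.C (pev p m₀))] with m h7 h8
      rw [h7, h8, pev_C]
      exact eq_of_rot_eq_zero (contDiff_one (contDiff_pev p)) h5 m m₀
    rw [real_inner_comm, inner_pl_C, one_mul, integral_congr_ae (coeFn_pl p)] at h2
    have h7 : ∀ m : S2, pev p m = pev p m₀ := fun m =>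
      eq_of_rot_eq_zero (contDiff_one (contDiff_pev p)) h5 m m₀
    simp only [h7, integral_const, smul_eq_mul] at h2
    rw [h6, (mul_eq_zero.1 h2).resolve_left sigma_univ_pos.ne']
    simp

/-- A function whose weak rotational gradient vanishes is constant. -/
theorem ae_const_of_hasWeakRot_zero {u : S2 → ℝ} (hu : MemLp u 2 σ)
    (h : ∀ i, HasWeakRot i u 0) : ∃ c : ℝ, ∀ᵐ m ∂σ, u m = c := by
  set U := hu.toLp u
  have hU : ∀ i p, ⟪U, pl (rotP i p)⟫_ℝ = 0 := fun i p => by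
    rw [inner_toLp_pl, ← rot_pev]
    have := h i _ (contDiff_pev p)
    simpa using this.symm
  set e := pl (MvPolynomial.C 1) with he
  have he0 : ⟪e, e⟫_ℝ ≠ 0 := by
    rw [he, inner_L2S_eq (coeFn_pl _) (coeFn_pl _)]
    simp only [pev_C]
    simp [sigma_univ_pos.ne']
  set c := ⟪U, e⟫_ℝ / ⟪e, e⟫_ℝ
  -- Every polynomial test function has the form ⟨1, q⟩ · 1 - Δq on the sphere. A function with zero
  -- weak gradient sees only the first term, so its pairings are proportional to those of the
  -- constant e.
  have hUc : U = c • e := by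
    refine eq_of_inner_pl fun p => ?_
    obtain ⟨q, hq⟩ := exists_meanSubLap_eq p
    have h1 : ∀ v : L2S, (∀ i p, ⟪v, pl (rotP i p)⟫_ℝ = 0) →
        ⟪v, pl p⟫_ℝ = ⟪e, pl q⟫_ℝ * ⟪v, e⟫_ℝ := fun v hv => by
      rw [← hq, meanSubLap_apply, map_sub, inner_sub_right, lapP_apply, map_sum, inner_sum,
        map_smul, inner_smul_right]
      simp [hv, he]
    rw [h1 U hU, h1 (c • e), inner_smul_left]
    · simp only [c, RCLike.conj_to_real]
      field_simp
    · intro i p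
      have := inner_rotP i (MvPolynomial.C 1) p
      rw [← MvPolynomial.algebraMap_eq, Derivation.map_algebraMap, map_zero, inner_zero_left,
        zero_eq_neg, MvPolynomial.algebraMap_eq] at this
      rw [inner_smul_left, he, this, mul_zero]
  refine ⟨c, ?_⟩
  have h2 : hu.toLp u =ᵐ[σ] fun m => c * e m := by
    change U =ᵐ[σ] _
    rw [hUc]
    exact Lp.coeFn_smul c e
  filter_upwards [hu.coeFn_toLp, h2, coeFn_pl (MvPolynomial.C 1)] with m h3 h4 h5
  rw [← h3, h4, he, h5, pev_C, mul_one]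

end Weak

/-! ### Moments of an axially symmetric weight, from invariance under rotations. -/

section AxialMoments

variable (b : OrthonormalBasis (Fin 3) ℝ E3) (η : ℝ)

theorem exists_orthonormalBasis_axis {n : E3} (hn : ‖n‖ = 1) :
    ∃ b : OrthonormalBasis (Fin 3) ℝ E3, b 2 = n := by
  have h : Orthonormal ℝ (({2} : Set (Fin 3)).domRestrict fun _ => n) := by
    constructor
    · exact fun _ => hn
    · intro i j hij
      exact absurd (Subsingleton.elim i j) hij
  obtain ⟨b, hb⟩ := h.exists_orthonormalBasis_extension_of_card_eq (by simp)
  exact ⟨b, hb 2 rfl⟩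

/-- The coordinates with respect to an orthonormal basis. -/
def co (k : Fin 3) (x : E3) : ℝ := ⟪x, b k⟫_ℝ

theorem contDiff_co (k : Fin 3) : ContDiff ℝ ∞ (co b k) :=
  contDiff_id.inner ℝ contDiff_const

theorem sum_co_mul_co (x y : E3) : ∑ k, co b k x * co b k y = ⟪x, y⟫_ℝ := by
  rw [← b.sum_inner_mul_inner x y]
  exact Finset.sum_congr rfl fun k _ => by rw [co, co, real_inner_comm y]

theorem sum_co_sq (m : S2) : co b 0 m ^ 2 + co b 1 m ^ 2 + co b 2 m ^ 2 = 1 := by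
  have h := sum_co_mul_co b m m
  rw [Fin.sum_univ_three, real_inner_self_eq_norm_sq, norm_eq_of_mem_sphere] at h
  linarith

theorem cross_cross_eq (a c m : E3) :
    cross (cross a c) m = ⟪m, a⟫_ℝ • c - ⟪m, c⟫_ℝ • a := by
  ext j
  simp only [inner_E3]
  fin_cases j <;> simp [cross_ofLp] <;> ring

/-- The rotation field in the plane of the `k`-th and `l`-th coordinate. -/
def axis (k l : Fin 3) : E3 := cross (b k) (b l)

/-- In the adapted coordinates this field is x_k ∂_l - x_l ∂_k. As its axis is b_k × b_l, the
orientation of the basis plays no role. -/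
theorem rotAx_co (k l j : Fin 3) (m : E3) :
    rotAx (axis b k l) (co b j) m
      = co b k m * (if l = j then 1 else 0) - co b l m * (if k = j then 1 else 0) := by
  unfold co axis
  rw [rotAx_inner, cross_cross_eq, inner_sub_left, inner_smul_left, inner_smul_left,
    b.inner_eq_ite, b.inner_eq_ite]
  simp

theorem rotAx_pow (w : E3) {ψ : E3 → ℝ} (hψ : ContDiff ℝ ∞ ψ) (k : ℕ) (m : E3) :
    rotAx w (fun x => ψ x ^ k) m = k * ψ m ^ (k - 1) * rotAx w ψ m :=
  rotAx_comp w (hasDerivAt_pow k (ψ m)) ((contDiff_one hψ).differentiable one_ne_zero _)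

/-- The weight `exp (η z²)`. -/
def wt (x : E3) : ℝ := Real.exp (η * co b 2 x ^ 2)

theorem contDiff_wt : ContDiff ℝ ∞ (wt b η) := by
  have := contDiff_co b 2
  unfold wt
  fun_prop

theorem rotAx_wt (w m : E3) :
    rotAx w (wt b η) m = wt b η m * (2 * η * co b 2 m * rotAx w (co b 2) m) := by
  have hd : ∀ {ψ : E3 → ℝ}, ContDiff ℝ ∞ ψ → Differentiable ℝ ψ := fun h =>
    (contDiff_one h).differentiable one_ne_zero
  have h1 : ContDiff ℝ ∞ fun x => co b 2 x ^ 2 := (contDiff_co b 2).pow 2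
  unfold wt
  rw [rotAx_comp w (Real.hasDerivAt_exp _) (hd (contDiff_const.mul h1) m),
    rotAx_const_mul w η (hd h1 m), rotAx_pow w (contDiff_co b 2)]
  norm_num
  ring

/-- The weighted moments of the monomials on the sphere. -/
def mom (i j k : ℕ) : ℝ :=
  ∫ m : S2, co b 0 m ^ i * co b 1 m ^ j * co b 2 m ^ k * wt b η m ∂σ

theorem mom_integrable (i j k : ℕ) :
    Integrable (fun m : S2 => co b 0 m ^ i * co b 1 m ^ j * co b 2 m ^ k * wt b η m) σ := by
  have h0 := contDiff_co b 0
  have h1 := contDiff_co b 1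
  have h2 := contDiff_co b 2
  have h3 := contDiff_wt b η
  have h : ContDiff ℝ ∞ fun m => co b 0 m ^ i * co b 1 m ^ j * co b 2 m ^ k * wt b η m := by
    fun_prop
  exact integrable_of_continuous (h.continuous.comp continuous_subtype_val)

theorem rotAx_monomial (w : E3) (i j k : ℕ) (m : E3) :
    rotAx w (fun m => co b 0 m ^ i * co b 1 m ^ j * co b 2 m ^ k * wt b η m) m =
    (i * co b 0 m ^ (i - 1) * co b 1 m ^ j * co b 2 m ^ k * rotAx w (co b 0) m
    + j * co b 0 m ^ i * co b 1 m ^ (j - 1) * co b 2 m ^ k * rotAx w (co b 1) m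
    + k * co b 0 m ^ i * co b 1 m ^ j * co b 2 m ^ (k - 1) * rotAx w (co b 2) m
    + 2 * η * co b 0 m ^ i * co b 1 m ^ j * co b 2 m ^ (k + 1) * rotAx w (co b 2) m)
    * wt b η m := by
  have h0 := contDiff_co b 0
  have h1 := contDiff_co b 1
  have h2 := contDiff_co b 2
  have h3 := contDiff_wt b η
  have hd : ∀ {ψ : E3 → ℝ}, ContDiff ℝ ∞ ψ → Differentiable ℝ ψ := fun h =>
    (contDiff_one h).differentiable one_ne_zero
  have c0 := h0.pow i
  have c1 := h1.pow j
  have c2 := h2.pow k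
  rw [rotAx_mul w (hd ((c0.mul c1).mul c2) m) (hd h3 m), rotAx_mul w (hd (c0.mul c1) m) (hd c2 m),
    rotAx_mul w (hd c0 m) (hd c1 m), rotAx_pow w h0, rotAx_pow w h1, rotAx_pow w h2, rotAx_wt]
  ring

theorem integral_rotAx_monomial (w : E3) (i j k : ℕ) :
    ∫ m : S2, rotAx w (fun m => co b 0 m ^ i * co b 1 m ^ j * co b 2 m ^ k * wt b η m) m ∂σ = 0 := by
  have h0 := contDiff_co b 0
  have h1 := contDiff_co b 1
  have h2 := contDiff_co b 2
  have h3 := contDiff_wt b η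
  exact integral_rotAx w (contDiff_one (by fun_prop))

/-- The rotation about the axis of symmetry leaves the weight and z alone, and its derivative of the
monomial has integral zero. The truncated exponents at i = 0 or j = 0 come with coefficient zero. -/
theorem mom_rot (i j k : ℕ) : j * mom b η (i + 1) (j - 1) k = i * mom b η (i - 1) (j + 1) k := by
  have h := integral_rotAx_monomial b η (axis b 0 1) i j k
  simp only [rotAx_monomial, rotAx_co] at h
  simp only [reduceIte, show (1 : Fin 3) ≠ 0 by decide, show (0 : Fin 3) ≠ 1 by decide,
    show (1 : Fin 3) ≠ 2 by decide, show (0 : Fin 3) ≠ 2 by decide] at h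
  have e : ∀ m : E3, (i * co b 0 m ^ (i - 1) * co b 1 m ^ j * co b 2 m ^ k *
      (co b 0 m * 0 - co b 1 m * 1)
      + j * co b 0 m ^ i * co b 1 m ^ (j - 1) * co b 2 m ^ k * (co b 0 m * 1 - co b 1 m * 0)
      + k * co b 0 m ^ i * co b 1 m ^ j * co b 2 m ^ (k - 1) * (co b 0 m * 0 - co b 1 m * 0)
      + 2 * η * co b 0 m ^ i * co b 1 m ^ j * co b 2 m ^ (k + 1) * (co b 0 m * 0 - co b 1 m * 0))
      * wt b η m
      = j * (co b 0 m ^ (i + 1) * co b 1 m ^ (j - 1) * co b 2 m ^ k * wt b η m)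
        - i * (co b 0 m ^ (i - 1) * co b 1 m ^ (j + 1) * co b 2 m ^ k * wt b η m) :=
    fun m => by ring
  simp only [e] at h
  rw [integral_sub ((mom_integrable _ _ _ _ _).const_mul _)
    ((mom_integrable _ _ _ _ _).const_mul _), integral_const_mul, integral_const_mul] at h
  unfold mom
  linarith

theorem mom_sphere (i j k : ℕ) :
    mom b η (i + 2) j k + mom b η i (j + 2) k + mom b η i j (k + 2) = mom b η i j k := by
  unfold mom
  rw [← integral_add (mom_integrable _ _ _ _ _) (mom_integrable _ _ _ _ _),
    ← integral_add (by
      exact (mom_integrable b η (i + 2) j k).add (mom_integrable b η i (j + 2) k))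
      (mom_integrable _ _ _ _ _)]
  refine integral_congr_ae (.of_forall fun m => ?_)
  have := sum_co_sq b m
  simp only
  linear_combination (co b 0 m ^ i * co b 1 m ^ j * co b 2 m ^ k * wt b η m) * this

theorem mom_odd (k : ℕ) : mom b η 1 0 k = 0 ∧ mom b η 0 1 k = 0 ∧ mom b η 1 1 k = 0 ∧
    mom b η 1 2 k = 0 ∧ mom b η 2 1 k = 0 ∧ mom b η 3 0 k = 0 ∧ mom b η 0 3 k = 0 ∧
    mom b η 3 1 k = 0 ∧ mom b η 1 3 k = 0 := by
  have h1 := mom_rot b η 0 1 k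
  have h2 := mom_rot b η 1 0 k
  have h3 := mom_rot b η 2 0 k
  have h4 := mom_rot b η 0 3 k
  have h5 := mom_rot b η 3 0 k
  have h6 := mom_rot b η 1 2 k
  have h7 := mom_rot b η 2 1 k
  have h8 := mom_rot b η 4 0 k
  have h9 := mom_rot b η 0 4 k
  norm_num at h1 h2 h3 h4 h5 h6 h7 h8 h9
  rw [h4] at h7
  rw [h5] at h6
  refine ⟨h1, h2.symm, h3, h4, h5, by linarith, by linarith, h8, h9⟩

/-- Axial symmetry fixes the ratios of moments of equal degree in x and y; the relation x² + y² + z²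
= 1 then expresses them by axial moments. -/
theorem mom_even (k : ℕ) : mom b η 2 0 k = (mom b η 0 0 k - mom b η 0 0 (k + 2)) / 2 ∧
    mom b η 0 2 k = (mom b η 0 0 k - mom b η 0 0 (k + 2)) / 2 ∧
    mom b η 2 2 k = (mom b η 0 0 k - 2 * mom b η 0 0 (k + 2) + mom b η 0 0 (k + 4)) / 8 ∧
    mom b η 4 0 k = 3 * mom b η 2 2 k ∧ mom b η 0 4 k = 3 * mom b η 2 2 k := by
  have h1 := mom_rot b η 1 1
  have h2 := mom_rot b η 1 3 k
  have h3 := mom_rot b η 3 1 k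
  have h4 := mom_sphere b η 0 0
  have h5 := mom_sphere b η 2 0 k
  norm_num at h1 h2 h3 h4 h5
  have a1 := h1 k
  have a2 := h1 (k + 2)
  have a3 := h4 k
  have a4 := h4 (k + 2)
  refine ⟨by linarith, by linarith, ?_, by linarith, by linarith⟩
  rw [show k + 2 + 2 = k + 4 from rfl] at a4
  linarith

end AxialMoments

/-! ### Archimedes' theorem: reduction of axial integrals on the sphere to [-1, 1]. -/

section HatBox

variable (b : OrthonormalBasis (Fin 3) ℝ E3)

theorem integrable_axial {G : ℝ → ℝ} (hG : Continuous G) :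
    Integrable (fun m : S2 => G (co b 2 m)) σ :=
  integrable_of_continuous (hG.comp ((contDiff_co b 2).continuous.comp continuous_subtype_val))

/-- Rotating x z^(k+1) in the xz-plane without weight gives the recursion m_{k+2} = (k+1)/(k+3) ·
m_k, which the integrals of z^k on [-1, 1] also satisfy. The constant is fixed by k = 0, so the
value of the area is never needed. -/
theorem integral_axial_pow (k : ℕ) :
    ∫ m : S2, co b 2 m ^ k ∂σ = σ.real Set.univ / 2 * ∫ z in (-1 : ℝ)..1, z ^ k := by
  have hmom : ∀ k, mom b 0 0 0 k = ∫ m : S2, co b 2 m ^ k ∂σ := fun k => by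
    simp [mom, wt]
  rw [← hmom, integral_pow]
  have hrec : ∀ k : ℕ, (k + 1) * mom b 0 2 0 k = mom b 0 0 0 (k + 2) := by
    intro k
    have h := integral_rotAx_monomial b 0 (axis b 0 2) 1 0 (k + 1)
    have e : ∀ m : E3, rotAx (axis b 0 2)
        (fun m => co b 0 m ^ 1 * co b 1 m ^ 0 * co b 2 m ^ (k + 1) * wt b 0 m) m
        = (k + 1) * (co b 0 m ^ 2 * co b 1 m ^ 0 * co b 2 m ^ k * wt b 0 m)
          - co b 0 m ^ 0 * co b 1 m ^ 0 * co b 2 m ^ (k + 2) * wt b 0 m := fun m => by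
      rw [rotAx_monomial, rotAx_co, rotAx_co, rotAx_co]
      simp
      ring
    simp only [e] at h
    rw [integral_sub ((mom_integrable _ _ _ _ _).const_mul _) (mom_integrable _ _ _ _ _),
      integral_const_mul] at h
    unfold mom
    linarith
  have hz : mom b 0 0 0 1 = 0 := by
    have h := integral_rotAx (axis b 0 2) (contDiff_one (contDiff_co b 0))
    simp only [rotAx_co] at h
    simp only [reduceIte, show (2 : Fin 3) ≠ 0 by decide, mul_zero, mul_one, zero_sub,
      integral_neg, neg_eq_zero] at h
    rw [hmom]
    simpa using h
  have hstep : ∀ k : ℕ, mom b 0 0 0 (k + 2) = (k + 1) / (k + 3) * mom b 0 0 0 k := by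
    intro k
    have h1 := hrec k
    rw [(mom_even b 0 k).1] at h1
    have : (k + 3 : ℝ) ≠ 0 := by positivity
    field_simp
    linarith
  induction k using Nat.twoStepInduction with
  | zero => rw [hmom]; simp; norm_num
  | one => rw [hz]; norm_num
  | more k ih _ =>
    rw [hstep, ih]
    have h1 : (k + 1 : ℝ) ≠ 0 := by positivity
    have h3 : (k + 3 : ℝ) ≠ 0 := by positivity
    have h4 : (k + 2 + 1 : ℝ) ≠ 0 := by positivity
    push_cast
    have h5 : (-1 : ℝ) ^ (k + 2 + 1) = (-1) ^ (k + 1) := by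
      rw [show k + 2 + 1 = k + 1 + 2 by ring, pow_add, neg_one_sq, mul_one]
    rw [h5]
    simp only [one_pow]
    field_simp
    ring

theorem integral_axial_poly (P : Polynomial ℝ) :
    ∫ m : S2, P.eval (co b 2 m) ∂σ = σ.real Set.univ / 2 * ∫ z in (-1 : ℝ)..1, P.eval z := by
  induction P using Polynomial.induction_on' with
  | add p q hp hq =>
    simp only [Polynomial.eval_add]
    rw [integral_add (integrable_axial b p.continuous) (integrable_axial b q.continuous),
      intervalIntegral.integral_add (p.continuous.intervalIntegrable _ _)
        (q.continuous.intervalIntegrable _ _), hp, hq, mul_add]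
  | monomial k a =>
    simp only [Polynomial.eval_monomial]
    rw [integral_const_mul, intervalIntegral.integral_const_mul, integral_axial_pow]
    ring

theorem co_mem_Icc (k : Fin 3) (m : S2) : co b k m ∈ Set.Icc (-1 : ℝ) 1 := by
  rw [Set.mem_Icc, ← abs_le]
  have := abs_real_inner_le_norm (m : E3) (b k)
  simpa [co] using this

/-- Archimedes' hat-box theorem. -/
theorem integral_axial {G : ℝ → ℝ} (hG : Continuous G) :
    ∫ m : S2, G (co b 2 m) ∂σ = σ.real Set.univ / 2 * ∫ z in (-1 : ℝ)..1, G z := by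
  set s := σ.real Set.univ with hs
  have hs0 : 0 < s := sigma_univ_pos
  refine eq_of_forall_dist_le fun ε hε => ?_
  -- With this accuracy the errors on the sphere and on the interval, the latter multiplied by s /
  -- 2, are at most ε / 2 each.
  obtain ⟨P, hP⟩ := exists_polynomial_near_of_continuousOn (-1) 1 G hG.continuousOn (ε / (2 * s))
    (by positivity)
  have h1 : |∫ m : S2, (G (co b 2 m) - P.eval (co b 2 m)) ∂σ| ≤ ε / (2 * s) * s := by
    refine norm_integral_le_of_norm_le_const (μ := σ) (f := fun m : S2 => G (co b 2 m) - P.eval (co b 2 m)) (.of_forall fun m => ?_)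
    rw [Real.norm_eq_abs, abs_sub_comm]
    exact (hP _ (co_mem_Icc b 2 m)).le
  have h2 : |∫ z in (-1 : ℝ)..1, (G z - P.eval z)| ≤ ε / (2 * s) * |1 - (-1)| := by
    refine intervalIntegral.norm_integral_le_of_norm_le_const (f := fun z => G z - P.eval z) fun z hz => ?_
    rw [Set.uIoc_of_le (by norm_num)] at hz
    rw [Real.norm_eq_abs, abs_sub_comm]
    exact (hP _ (Set.Ioc_subset_Icc_self hz)).le
  rw [integral_sub (integrable_axial b hG) (integrable_axial b P.continuous)] at h1
  rw [intervalIntegral.integral_sub (hG.intervalIntegrable _ _)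
    (P.continuous.intervalIntegrable _ _)] at h2
  have h3 := integral_axial_poly b P
  rw [← hs] at h3
  norm_num at h2
  have e1 : ε / (2 * s) * s = ε / 2 := by field_simp
  have e2 : ε / (2 * s) * 2 = ε / s := by field_simp
  rw [e1] at h1
  rw [e2] at h2
  rw [Real.dist_eq]
  have h5 : |s / 2 * ((∫ z in (-1 : ℝ)..1, G z) - ∫ z in (-1 : ℝ)..1, P.eval z)| ≤ ε / 2 := by
    rw [abs_mul, abs_of_pos (by positivity : 0 < s / 2)]
    calc _ ≤ s / 2 * (ε / s) := by gcongr
      _ = ε / 2 := by field_simp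
  rw [mul_sub, ← h3] at h5
  rw [abs_le] at h1 h5 ⊢
  constructor <;> linarith [h1.1, h1.2, h5.1, h5.2]

theorem mom_axial (η : ℝ) (k : ℕ) : mom b η 0 0 k = σ.real Set.univ / 2 * moment k η := by
  have h := integral_axial b (G := fun z => z ^ k * Real.exp (η * z ^ 2)) (by fun_prop)
  unfold moment
  rw [← h]
  simp [mom, wt]

theorem mom_zero_pos (η : ℝ) : 0 < mom b η 0 0 0 := by
  rw [mom_axial]
  exact mul_pos (half_pos sigma_univ_pos) (moment_zero_pos η)

theorem mom_axial_div (η : ℝ) (k : ℕ) : mom b η 0 0 k = mom b η 0 0 0 * avg k η := by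
  rw [mom_axial, mom_axial, avg]
  have := (moment_zero_pos η).ne'
  field_simp

theorem density_eq (η : ℝ) (x : E3) : density η (b 2) x = wt b η x / mom b η 0 0 0 := by
  unfold density mom wt co
  simp

end HatBox

/-! ### The second variation, diagonalized on the five traceless quadratic forms. -/

section SecondVariation

variable (b : OrthonormalBasis (Fin 3) ℝ E3) (η : ℝ)

/-- The monomials in the adapted coordinates, as continuous functions on the sphere. -/
def mono (i j k : ℕ) : C(S2, ℝ) :=
  ⟨fun m => co b 0 m ^ i * co b 1 m ^ j * co b 2 m ^ k, by unfold co; fun_prop⟩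

/-- Integration against the density. -/
def expect : C(S2, ℝ) →ₗ[ℝ] ℝ where
  toFun f := ∫ m, f m * density η (b 2) m ∂σ
  map_add' f g := by
    have hc : Continuous fun m : S2 => density η (b 2) m := by unfold density; fun_prop
    simp only [ContinuousMap.add_apply, add_mul]
    exact integral_add (integrable_of_continuous (f.continuous.mul hc))
      (integrable_of_continuous (g.continuous.mul hc))
  map_smul' c f := by
    simp only [ContinuousMap.smul_apply, smul_eq_mul, mul_assoc, RingHom.id_apply]
    exact integral_const_mul _ _

theorem expect_apply (f : C(S2, ℝ)) : expect b η f = ∫ m, f m * density η (b 2) m ∂σ := rfl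

theorem expect_mono (i j k : ℕ) : expect b η (mono b i j k) = mom b η i j k / mom b η 0 0 0 := by
  rw [expect_apply]
  conv_rhs => rw [mom, ← integral_div]
  refine integral_congr_ae (.of_forall fun m => ?_)
  simp only [density_eq, mono, ContinuousMap.coe_mk]
  ring

/-- The second moment of `x y`. -/
def mix (η : ℝ) : ℝ := (1 - 2 * avg 2 η + avg 4 η) / 8

theorem expect_values :
    expect b η (mono b 0 0 0) = 1 ∧ expect b η (mono b 0 0 2) = avg 2 η ∧
    expect b η (mono b 0 0 4) = avg 4 η ∧
    expect b η (mono b 2 0 0) = (1 - avg 2 η) / 2 ∧ expect b η (mono b 0 2 0) = (1 - avg 2 η) / 2 ∧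
    expect b η (mono b 2 0 2) = gap η / 2 ∧ expect b η (mono b 0 2 2) = gap η / 2 ∧
    expect b η (mono b 2 2 0) = mix η ∧ expect b η (mono b 4 0 0) = 3 * mix η ∧
    expect b η (mono b 0 4 0) = 3 * mix η := by
  have hN := (mom_zero_pos b η).ne'
  have h0 := mom_even b η 0
  have h2 := mom_even b η 2
  have a2 := mom_axial_div b η 2
  have a4 := mom_axial_div b η 4
  norm_num at h0 h2
  simp only [expect_mono, h0, h2, a2, a4, gap, mix]
  refine ⟨?_, ?_, ?_, ?_, ?_, ?_, ?_, ?_, ?_, ?_⟩ <;> field_simp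

theorem expect_odd (k : ℕ) :
    expect b η (mono b 1 0 k) = 0 ∧ expect b η (mono b 0 1 k) = 0 ∧
    expect b η (mono b 1 1 k) = 0 ∧ expect b η (mono b 1 2 k) = 0 ∧
    expect b η (mono b 2 1 k) = 0 ∧ expect b η (mono b 3 0 k) = 0 ∧
    expect b η (mono b 0 3 k) = 0 ∧ expect b η (mono b 3 1 k) = 0 ∧
    expect b η (mono b 1 3 k) = 0 := by
  have h := mom_odd b η k
  simp only [expect_mono, h]
  simp

/-- A general traceless quadratic form, made mean free on the sphere. -/
def quad (c : Fin 5 → ℝ) (x : E3) : ℝ :=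
  c 0 * (co b 2 x ^ 2 - avg 2 η) + c 1 * (co b 0 x ^ 2 - co b 1 x ^ 2) + c 2 * (co b 0 x * co b 1 x)
    + c 3 * (co b 0 x * co b 2 x) + c 4 * (co b 1 x * co b 2 x)

theorem contDiff_quad (c : Fin 5 → ℝ) : ContDiff ℝ ∞ (quad b η c) := by
  have h0 := contDiff_co b 0
  have h1 := contDiff_co b 1
  have h2 := contDiff_co b 2
  unfold quad
  fun_prop

theorem integral_quad (c : Fin 5 → ℝ) : ∫ m : S2, quad b η c m * density η (b 2) m ∂σ = 0 := by
  have e : (⟨fun m : S2 => quad b η c m, (contDiff_quad b η c).continuous.comp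
      continuous_subtype_val⟩ : C(S2, ℝ)) = c 0 • (mono b 0 0 2 - avg 2 η • mono b 0 0 0)
      + c 1 • (mono b 2 0 0 - mono b 0 2 0) + c 2 • mono b 1 1 0 + c 3 • mono b 1 0 1
      + c 4 • mono b 0 1 1 := by
    ext m
    simp [mono, quad]
  refine (congrArg (expect b η) e).trans ?_
  simp only [map_add, map_sub, map_smul, expect_values, expect_odd]
  simp

/-- Parity and the symmetry between x and y remove all cross terms: the five modes are orthogonal
for the density. -/
theorem integral_quad_mul (c d : Fin 5 → ℝ) :
    ∫ m : S2, quad b η c m * quad b η d m * density η (b 2) m ∂σ =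
      c 0 * d 0 * var2 η + 4 * (c 1 * d 1) * mix η + c 2 * d 2 * mix η
      + (c 3 * d 3 + c 4 * d 4) * (gap η / 2) := by
  have e : (⟨fun m : S2 => quad b η c m * quad b η d m,
      ((contDiff_quad b η c).mul (contDiff_quad b η d)).continuous.comp
      continuous_subtype_val⟩ : C(S2, ℝ)) =
      (c 0 * d 0) • (mono b 0 0 4 - (2 * avg 2 η) • mono b 0 0 2 + (avg 2 η ^ 2) • mono b 0 0 0)
      + (c 0 * d 1 + c 1 * d 0) • (mono b 2 0 2 - mono b 0 2 2
        - avg 2 η • (mono b 2 0 0 - mono b 0 2 0))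
      + (c 0 * d 2 + c 2 * d 0) • (mono b 1 1 2 - avg 2 η • mono b 1 1 0)
      + (c 0 * d 3 + c 3 * d 0) • (mono b 1 0 3 - avg 2 η • mono b 1 0 1)
      + (c 0 * d 4 + c 4 * d 0) • (mono b 0 1 3 - avg 2 η • mono b 0 1 1)
      + (c 1 * d 1) • (mono b 4 0 0 - (2 : ℝ) • mono b 2 2 0 + mono b 0 4 0)
      + (c 1 * d 2 + c 2 * d 1) • (mono b 3 1 0 - mono b 1 3 0)
      + (c 1 * d 3 + c 3 * d 1) • (mono b 3 0 1 - mono b 1 2 1)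
      + (c 1 * d 4 + c 4 * d 1) • (mono b 2 1 1 - mono b 0 3 1)
      + (c 2 * d 2) • mono b 2 2 0
      + (c 2 * d 3 + c 3 * d 2) • mono b 2 1 1
      + (c 2 * d 4 + c 4 * d 2) • mono b 1 2 1
      + (c 3 * d 3) • mono b 2 0 2 + (c 3 * d 4 + c 4 * d 3) • mono b 1 1 2
      + (c 4 * d 4) • mono b 0 2 2 := by
    ext m
    simp [mono, quad]
    ring
  refine (congrArg (expect b η) e).trans ?_
  simp only [map_add, map_sub, map_smul, expect_values, expect_odd, var2, smul_eq_mul]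
  ring

theorem density_pos (x : E3) : 0 < density η (b 2) x := by
  rw [density_eq]
  exact div_pos (Real.exp_pos _) (mom_zero_pos b η)

theorem contDiff_density : ContDiff ℝ ∞ (density η (b 2)) := by
  have : density η (b 2) = fun x => wt b η x / mom b η 0 0 0 := funext (density_eq b η)
  rw [this]
  exact (contDiff_wt b η).div_const _

theorem contDiff_inv_density : ContDiff ℝ ∞ fun x => (density η (b 2) x)⁻¹ :=
  (contDiff_density b η).inv fun x => (density_pos b η x).ne'

theorem integral_density : ∫ m : S2, density η (b 2) m ∂σ = 1 := by
  have h := (expect_values b η).1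
  rw [expect_apply] at h
  simpa [mono] using h

/-- The second moments of a function on the sphere. -/
def smom (f : S2 → ℝ) (k l : Fin 3) : ℝ := ∫ m : S2, co b k m * co b l m * f m ∂σ

theorem smom_comm (f : S2 → ℝ) (k l : Fin 3) : smom b f k l = smom b f l k := by
  unfold smom
  simp only [mul_comm (co b k _)]

theorem norm_sq_eq_sum_co (x : E3) : ‖x‖ ^ 2 = co b 0 x ^ 2 + co b 1 x ^ 2 + co b 2 x ^ 2 := by
  have h := sum_co_mul_co b x x
  rw [Fin.sum_univ_three, real_inner_self_eq_norm_sq] at h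
  linarith

theorem norm_cross_sq (x y : E3) : ‖cross x y‖ ^ 2 = ‖x‖ ^ 2 * ‖y‖ ^ 2 - ⟪x, y⟫_ℝ ^ 2 := by
  rw [norm_sq_E3, norm_sq_E3, norm_sq_E3, inner_E3]
  simp [cross_ofLp]
  ring

theorem integrable_of_memLp {f : S2 → ℝ} (hf : MemLp f 2 σ) : Integrable f σ :=
  hf.integrable (by norm_num)

theorem integrable_co_co_mul {f : S2 → ℝ} (hf : MemLp f 2 σ) (k l : Fin 3) :
    Integrable (fun m : S2 => co b k m * co b l m * f m) σ :=
  integrable_of_memLp (memLp_contDiff_mul ((contDiff_co b k).mul (contDiff_co b l)) hf)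

/-- Lagrange's identity |x × m|² = |x|² |m|² - (x·m)²: the potential depends on f only through its
mass and second moments. -/
theorem potential_eq (α : ℝ) {f : S2 → ℝ} (hf : MemLp f 2 σ) (x : E3) :
    potential α f x = α * (‖x‖ ^ 2 * ∫ m, f m ∂σ
      - ∑ k, ∑ l, smom b f k l * (co b k x * co b l x)) := by
  have e : ∀ m : S2, ‖cross x m‖ ^ 2 * f m = ‖x‖ ^ 2 * f m
      - ∑ k, ∑ l, co b k m * co b l m * f m * (co b k x * co b l x) := fun m => by
    rw [norm_cross_sq, norm_eq_of_mem_sphere, ← sum_co_mul_co b]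
    simp only [Fin.sum_univ_three]
    ring
  unfold potential smom
  simp only [e]
  rw [integral_sub ((integrable_of_memLp hf).const_mul _), integral_const_mul, integral_finsetSum]
  · congr 2
    refine Finset.sum_congr rfl fun k _ => ?_
    rw [integral_finsetSum]
    · exact Finset.sum_congr rfl fun l _ => integral_mul_const _ _
    · exact fun l _ => (integrable_co_co_mul b hf k l).mul_const _
  · exact fun k _ => integrable_finsetSum _ fun l _ => (integrable_co_co_mul b hf k l).mul_const _
  · exact integrable_finsetSum _ fun k _ => integrable_finsetSum _ fun l _ =>
      (integrable_co_co_mul b hf k l).mul_const _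

theorem smom_trace {f : S2 → ℝ} (hf : MemLp f 2 σ) :
    smom b f 0 0 + smom b f 1 1 + smom b f 2 2 = ∫ m, f m ∂σ := by
  unfold smom
  rw [← integral_add (integrable_co_co_mul b hf _ _) (integrable_co_co_mul b hf _ _),
    ← integral_add (by exact (integrable_co_co_mul b hf _ _).add (integrable_co_co_mul b hf _ _))
      (integrable_co_co_mul b hf _ _)]
  refine integral_congr_ae (.of_forall fun m => ?_)
  have := sum_co_sq b m
  simp only
  linear_combination f m * this

theorem memLp_density : MemLp (fun m : S2 => density η (b 2) m) 2 σ :=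
  memLp_of_contDiff (contDiff_density b η)

/-- The coefficient of z² is -α (3⟨z²⟩ - 1) / 2 = -α η · gap, which the branch equation turns into
-η. Hence U h cancels ln h up to a constant. -/
theorem potential_density {α : ℝ} (hη : η ∈ branchSet α) (x : E3) :
    potential α (fun m => density η (b 2) m) x
      = α * (1 + avg 2 η) / 2 * ‖x‖ ^ 2 - η * co b 2 x ^ 2 := by
  have hm : ∀ i j k (f : S2 → ℝ), (∀ m, mono b i j k m = f m) →
      ∫ m : S2, f m * density η (b 2) m ∂σ = expect b η (mono b i j k) := fun i j k f h => by
    rw [expect_apply]; simp only [h]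
  have v := expect_values b η
  have o := expect_odd b η
  have s00 : smom b (fun m => density η (b 2) m) 0 0 = (1 - avg 2 η) / 2 :=
    (hm 2 0 0 _ fun m => by simp [mono, sq]).trans v.2.2.2.1
  have s11 : smom b (fun m => density η (b 2) m) 1 1 = (1 - avg 2 η) / 2 :=
    (hm 0 2 0 _ fun m => by simp [mono, sq]).trans v.2.2.2.2.1
  have s22 : smom b (fun m => density η (b 2) m) 2 2 = avg 2 η :=
    (hm 0 0 2 _ fun m => by simp [mono, sq]).trans v.2.1
  have s01 : smom b (fun m => density η (b 2) m) 0 1 = 0 :=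
    (hm 1 1 0 _ fun m => by simp [mono]).trans (o 0).2.2.1
  have s02 : smom b (fun m => density η (b 2) m) 0 2 = 0 :=
    (hm 1 0 1 _ fun m => by simp [mono]).trans (o 1).1
  have s12 : smom b (fun m => density η (b 2) m) 1 2 = 0 :=
    (hm 0 1 1 _ fun m => by simp [mono]).trans (o 1).2.1
  rw [potential_eq b α (memLp_density b η), integral_density]
  simp only [Fin.sum_univ_three, s00, s11, s22, s01, s02, s12, smom_comm b _ 1 0, smom_comm b _ 2 0,
    smom_comm b _ 2 1]
  rw [mem_branchSet_iff] at hη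
  have h1 := avg_by_parts_zero η
  rw [norm_sq_eq_sum_co b]
  linear_combination (-η * co b 2 x ^ 2) * hη - α / 2 * co b 2 x ^ 2 * h1

theorem isCriticalPoint_density {α : ℝ} (hη : η ∈ branchSet α) :
    IsCriticalPoint α (fun m => density η (b 2) m) := by
  refine ⟨memLp_density b η, .of_forall fun m => density_pos b η m, integral_density b η,
    α * (1 + avg 2 η) / 2 - Real.log (mom b η 0 0 0), .of_forall fun m => ?_⟩
  simp only [density_eq b η m]
  rw [potential_density b η hη, norm_eq_of_mem_sphere, wt,
    Real.log_div (Real.exp_pos _).ne' (mom_zero_pos b η).ne', Real.log_exp]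
  ring

/-- The coefficients of the quadratic form of the second moments. -/
def qcoef (f : S2 → ℝ) : Fin 5 → ℝ :=
  ![3 / 2 * smom b f 2 2, (smom b f 0 0 - smom b f 1 1) / 2, 2 * smom b f 0 1, 2 * smom b f 0 2,
    2 * smom b f 1 2]

theorem potential_eq_quad (α : ℝ) {f : S2 → ℝ} (hf : MemLp f 2 σ) (h0 : ∫ m, f m ∂σ = 0) (m : S2) :
    potential α f m = α * ((1 / 2 - 3 / 2 * avg 2 η) * smom b f 2 2 - quad b η (qcoef b f) m) := by
  have ht := smom_trace b hf
  have hs := sum_co_sq b m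
  rw [h0] at ht
  rw [potential_eq b α hf, h0]
  simp only [Fin.sum_univ_three, smom_comm b f 1 0, smom_comm b f 2 0, smom_comm b f 2 1, quad, qcoef,
    Matrix.cons_val]
  linear_combination (-(α * (co b 0 m ^ 2 + co b 1 m ^ 2) / 2)) * ht
    + α * (smom b f 2 2 / 2) * hs

theorem integral_quad_mul_fun (c : Fin 5 → ℝ) {f : S2 → ℝ} (hf : MemLp f 2 σ)
    (h0 : ∫ m, f m ∂σ = 0) :
    ∫ m : S2, quad b η c m * f m ∂σ = c 0 * smom b f 2 2 + c 1 * (smom b f 0 0 - smom b f 1 1)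
      + c 2 * smom b f 0 1 + c 3 * smom b f 0 2 + c 4 * smom b f 1 2 := by
  have j := integrable_co_co_mul b hf
  have e : ∀ m : S2, quad b η c m * f m = c 0 * (co b 2 m * co b 2 m * f m)
      + (-(c 0 * avg 2 η)) * f m + c 1 * (co b 0 m * co b 0 m * f m)
      + (-c 1) * (co b 1 m * co b 1 m * f m) + c 2 * (co b 0 m * co b 1 m * f m)
      + c 3 * (co b 0 m * co b 2 m * f m) + c 4 * (co b 1 m * co b 2 m * f m) := fun m => by
    unfold quad; ring
  simp only [e]
  have jf := integrable_of_memLp hf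
  rw [integral_add (by fun_prop) (by fun_prop), integral_add (by fun_prop) (by fun_prop),
    integral_add (by fun_prop) (by fun_prop), integral_add (by fun_prop) (by fun_prop),
    integral_add (by fun_prop) (by fun_prop), integral_add (by fun_prop) (by fun_prop)]
  simp only [integral_const_mul, h0]
  unfold smom
  ring

/-- The completed square for the second variation. -/
theorem second_variation_eq {α : ℝ} {f : S2 → ℝ} (hf : MemLp f 2 σ) (h0 : ∫ m, f m ∂σ = 0) :
    ∫ m, opH α (fun m => density η (b 2) m) f m * f m ∂σ =
    ∫ m, (f m - α * density η (b 2) m * quad b η (qcoef b f) m) ^ 2 / density η (b 2) m ∂σ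
    + α * ((1 - 3 / 2 * α * var2 η) * (3 / 2 * smom b f 2 2 ^ 2)
      + (1 - 2 * α * mix η) * (2 * ((smom b f 0 0 - smom b f 1 1) / 2) ^ 2 + 2 * smom b f 0 1 ^ 2)
      + (1 - α * gap η) * (2 * smom b f 0 2 ^ 2 + 2 * smom b f 1 2 ^ 2)) := by
  set h : E3 → ℝ := density η (b 2) with hh
  set c := qcoef b f with hc
  set κ := (1 / 2 - 3 / 2 * avg 2 η) * smom b f 2 2 with hκ
  have hpos : ∀ m, 0 < h m := density_pos b η
  have hff : MemLp (fun m : S2 => (h m)⁻¹ * f m) 2 σ := memLp_contDiff_mul (contDiff_inv_density b η) hf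
  have hq : MemLp (fun m : S2 => quad b η c m) 2 σ := memLp_of_contDiff (contDiff_quad b η c)
  have i1 := integrable_mul_of_memLp hff hf
  have i2 := integrable_mul_of_memLp hq hf
  have i3 : Integrable (fun m : S2 => quad b η c m * quad b η c m * h m) σ :=
    integrable_of_memLp (memLp_of_contDiff (((contDiff_quad b η c).mul (contDiff_quad b η c)).mul
      (contDiff_density b η)))
  -- For f of mean zero the matrix M of second moments is traceless, and `quad` with the
  -- coefficients `qcoef` is the form of M up to a constant; its pairing with f is |M|².
  have hqf : ∫ m : S2, quad b η c m * f m ∂σ = ∑ k, ∑ l, smom b f k l ^ 2 := by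
    have ht := smom_trace b hf
    rw [h0] at ht
    rw [integral_quad_mul_fun b η c hf h0]
    simp only [Fin.sum_univ_three, smom_comm b f 1 0, smom_comm b f 2 0, smom_comm b f 2 1, hc, qcoef,
      Matrix.cons_val]
    linear_combination (-(1 / 2) * (smom b f 0 0 + smom b f 1 1 - smom b f 2 2)) * ht
  have e1 : ∀ m : S2, opH α (fun m => h m) f m * f m
      = (h m)⁻¹ * f m * f m + (α * κ) * f m + (-α) * (quad b η c m * f m) := fun m => by
    unfold opH
    rw [potential_eq_quad b η α hf h0]
    ring
  have e2 : ∀ m : S2, (f m - α * h m * quad b η c m) ^ 2 / h m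
      = (h m)⁻¹ * f m * f m + (-(2 * α)) * (quad b η c m * f m)
        + α ^ 2 * (quad b η c m * quad b η c m * h m) := fun m => by
    have := (hpos m).ne'
    field_simp
    ring
  have jf := integrable_of_memLp hf
  simp only [e1, e2]
  rw [integral_add (by fun_prop) (by fun_prop), integral_add (by fun_prop) (by fun_prop),
    integral_add (by fun_prop) (by fun_prop), integral_add (by fun_prop) (by fun_prop)]
  simp only [integral_const_mul, h0, hqf, hh, integral_quad_mul]
  have ht := smom_trace b hf
  rw [h0] at ht
  simp only [Fin.sum_univ_three, smom_comm b f 1 0, smom_comm b f 2 0, smom_comm b f 2 1, hc, qcoef,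
    Matrix.cons_val]
  linear_combination (α / 2 * (smom b f 0 0 + smom b f 1 1 - smom b f 2 2)) * ht

/-- Two identities decide the signs: gap - (3/2) var2 = -disc / 2 and gap - 2 mix = (η / 2) ⟨z² (1 -
z²)²⟩. Multiplication by α replaces α · gap by 1. -/
theorem stable_coefs {α η : ℝ} (hη : η ∈ branchSet α) (hα : 0 < α) (h0 : 0 < η) (hd : disc η < 0) :
    3 / 2 * α * var2 η < 1 ∧ 2 * α * mix η < 1 := by
  rw [mem_branchSet_iff] at hη
  have h1 := avg_by_parts_zero η
  have h2 := avg_by_parts_two η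
  have h3 := mul_pos h0 (avg_two_four_six_pos η)
  unfold disc at hd
  unfold gap at hη h1
  unfold var2 mix
  constructor
  · have : 3 / 2 * (avg 4 η - avg 2 η ^ 2) < avg 2 η - avg 4 η := by linarith
    nlinarith [mul_lt_mul_of_pos_left this hα]
  · have : 2 * ((1 - 2 * avg 2 η + avg 4 η) / 8) < avg 2 η - avg 4 η := by linarith
    nlinarith [mul_lt_mul_of_pos_left this hα]

/-- The same identities with the opposite signs. For η < 0 the mode xy is unstable, for η > 0 the
mode z². -/
theorem unstable_coefs {α η : ℝ} (hη : η ∈ branchSet α) (hα : 0 < α) (h0 : η ≠ 0)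
    (hd : 0 < η → 0 < disc η) : 1 < 3 / 2 * α * var2 η ∨ 1 < 2 * α * mix η := by
  rw [mem_branchSet_iff] at hη
  have h1 := avg_by_parts_zero η
  have h2 := avg_by_parts_two η
  unfold disc at hd
  unfold gap at hη h1
  unfold var2 mix
  rcases lt_or_gt_of_ne h0 with h | h
  · right
    have h3 := mul_pos (neg_pos.2 h) (avg_two_four_six_pos η)
    have : avg 2 η - avg 4 η < 2 * ((1 - 2 * avg 2 η + avg 4 η) / 8) := by linarith
    nlinarith [mul_lt_mul_of_pos_left this hα]
  · left
    have := hd h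
    have : avg 2 η - avg 4 η < 3 / 2 * (avg 4 η - avg 2 η ^ 2) := by linarith
    nlinarith [mul_lt_mul_of_pos_left this hα]

theorem mix_pos (η : ℝ) : 0 < mix η := by
  have h1 := var2_pos η
  have h2 := avg_two_lt_one η
  unfold var2 at h1
  unfold mix
  nlinarith [sq_nonneg (1 - avg 2 η)]

theorem secondVariationNonneg_density {α : ℝ} (hη : η ∈ branchSet α) (hα : 0 < α)
    (h1 : 3 / 2 * α * var2 η ≤ 1) (h2 : 2 * α * mix η ≤ 1) :
    SecondVariationNonneg α (fun m => density η (b 2) m) := by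
  intro f hf h0
  rw [second_variation_eq b η hf h0, mem_branchSet_iff.1 hη]
  have h3 : 0 ≤ ∫ m : S2, (f m - α * density η (b 2) m * quad b η (qcoef b f) m) ^ 2
      / density η (b 2) m ∂σ :=
    integral_nonneg fun m => div_nonneg (sq_nonneg _) (density_pos b η m).le
  have h4 : 0 ≤ 1 - 3 / 2 * α * var2 η := by linarith
  have h5 : 0 ≤ 1 - 2 * α * mix η := by linarith
  have : (0 : ℝ) ≤ 1 - 1 := by norm_num
  positivity

theorem smom_density_mul_quad (c : Fin 5 → ℝ) :
    smom b (fun m => density η (b 2) m * quad b η c m) 2 2 = c 0 * var2 η ∧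
    smom b (fun m => density η (b 2) m * quad b η c m) 0 0
      - smom b (fun m => density η (b 2) m * quad b η c m) 1 1 = 4 * c 1 * mix η ∧
    smom b (fun m => density η (b 2) m * quad b η c m) 0 1 = c 2 * mix η ∧
    smom b (fun m => density η (b 2) m * quad b η c m) 0 2 = c 3 * (gap η / 2) ∧
    smom b (fun m => density η (b 2) m * quad b η c m) 1 2 = c 4 * (gap η / 2) := by
  have hf : MemLp (fun m : S2 => density η (b 2) m * quad b η c m) 2 σ :=
    memLp_of_contDiff ((contDiff_density b η).mul (contDiff_quad b η c))
  have h0 : ∫ m : S2, density η (b 2) m * quad b η c m ∂σ = 0 := by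
    simpa only [mul_comm] using integral_quad b η c
  have h : ∀ d : Fin 5 → ℝ, _ := fun d => (integral_quad_mul_fun b η d hf h0).symm.trans
    ((integral_congr_ae (.of_forall fun m => by ring)).trans (integral_quad_mul b η d c))
  have e0 := h ![1, 0, 0, 0, 0]
  have e1 := h ![0, 1, 0, 0, 0]
  have e2 := h ![0, 0, 1, 0, 0]
  have e3 := h ![0, 0, 0, 1, 0]
  have e4 := h ![0, 0, 0, 0, 1]
  simp only [Matrix.cons_val, one_mul, zero_mul, mul_zero, add_zero, zero_add] at e0 e1 e2 e3 e4
  exact ⟨e0, e1, e2, e3, e4⟩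

/-- On functions h · q the second-moment map is diagonal; α times its eigenvalues are the numbers
compared with 1 in the stability criterion. -/
theorem qcoef_density_mul_quad (c : Fin 5 → ℝ) :
    qcoef b (fun m => density η (b 2) m * quad b η c m) =
      ![3 / 2 * c 0 * var2 η, 2 * c 1 * mix η, 2 * c 2 * mix η, c 3 * gap η, c 4 * gap η] := by
  obtain ⟨h0, h1, h2, h3, h4⟩ := smom_density_mul_quad b η c
  unfold qcoef
  rw [h0, h1, h2, h3, h4]
  ext j
  fin_cases j <;> simp
  all_goals ring

theorem second_variation_quad (α : ℝ) (c : Fin 5 → ℝ) :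
    ∫ m : S2, opH α (fun m => density η (b 2) m) (fun m => density η (b 2) m * quad b η c m) m
      * (density η (b 2) m * quad b η c m) ∂σ =
    c 0 ^ 2 * var2 η * (1 - 3 / 2 * α * var2 η) + (4 * c 1 ^ 2 + c 2 ^ 2) * mix η * (1 - 2 * α * mix η)
      + (c 3 ^ 2 + c 4 ^ 2) * (gap η / 2) * (1 - α * gap η) := by
  have hf : MemLp (fun m : S2 => density η (b 2) m * quad b η c m) 2 σ :=
    memLp_of_contDiff ((contDiff_density b η).mul (contDiff_quad b η c))
  have h0 : ∫ m : S2, density η (b 2) m * quad b η c m ∂σ = 0 := by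
    simpa only [mul_comm] using integral_quad b η c
  rw [second_variation_eq b η hf h0]
  have e : ∀ m : S2, (density η (b 2) m * quad b η c m - α * density η (b 2) m *
      quad b η (qcoef b fun m => density η (b 2) m * quad b η c m) m) ^ 2 / density η (b 2) m =
      quad b η (fun j => c j - α * qcoef b (fun m => density η (b 2) m * quad b η c m) j) m *
      quad b η (fun j => c j - α * qcoef b (fun m => density η (b 2) m * quad b η c m) j) m
      * density η (b 2) m := fun m => by
    have := (density_pos b η m).ne'
    unfold quad
    field_simp
    ring
  simp only [e]
  rw [integral_quad_mul, qcoef_density_mul_quad]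
  obtain ⟨h0, h1, h2, h3, h4⟩ := smom_density_mul_quad b η c
  rw [h0, h1, h2, h3, h4]
  simp only [Matrix.cons_val]
  ring

theorem not_secondVariationNonneg_density {α : ℝ}
    (h : 1 < 3 / 2 * α * var2 η ∨ 1 < 2 * α * mix η) :
    ¬ SecondVariationNonneg α (fun m => density η (b 2) m) := by
  intro hs
  have hs' : ∀ c : Fin 5 → ℝ, _ := fun c => hs
    (fun m => density η (b 2) m * quad b η c m)
    (memLp_of_contDiff ((contDiff_density b η).mul (contDiff_quad b η c)))
    (by simpa only [mul_comm] using integral_quad b η c)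
  simp only [second_variation_quad] at hs'
  -- The test functions are h (z² - ⟨z²⟩) and h xy.
  rcases h with h | h
  · have := hs' ![1, 0, 0, 0, 0]
    simp only [Matrix.cons_val] at this
    nlinarith [var2_pos η]
  · have := hs' ![0, 0, 1, 0, 0]
    simp only [Matrix.cons_val] at this
    nlinarith [mix_pos η]

end SecondVariation

/-! ### Divergence form of the linearized operator and the energy identity. -/

section Flux

variable (b : OrthonormalBasis (Fin 3) ℝ E3) (η : ℝ)

theorem contDiff_potential (α : ℝ) {f : S2 → ℝ} (hf : MemLp f 2 σ) :
    ContDiff ℝ ∞ (potential α f) := by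
  have h : potential α f = fun x => α * (‖x‖ ^ 2 * ∫ m, f m ∂σ
      - ∑ k, ∑ l, smom (EuclideanSpace.basisFun (Fin 3) ℝ) f k l *
        (co (EuclideanSpace.basisFun (Fin 3) ℝ) k x * co (EuclideanSpace.basisFun (Fin 3) ℝ) l x)) :=
    funext (potential_eq _ α hf)
  have hc := contDiff_co (EuclideanSpace.basisFun (Fin 3) ℝ)
  have hn : ContDiff ℝ ∞ fun x : E3 => ‖x‖ ^ 2 := contDiff_norm_sq ℝ
  rw [h]
  exact contDiff_const.mul ((hn.mul contDiff_const).sub (ContDiff.sum fun k _ =>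
    ContDiff.sum fun l _ => contDiff_const.mul ((hc k).mul (hc l))))

theorem potential_congr (α : ℝ) {f g : S2 → ℝ} (h : f =ᵐ[σ] g) : potential α f = potential α g := by
  funext x
  unfold potential
  congr 1
  exact integral_congr_ae (by filter_upwards [h] with m hm; rw [hm])

theorem rotAx_norm_sq (w m : E3) : rotAx w (fun x => ‖x‖ ^ 2) m = 0 := by
  unfold rotAx
  rw [fderiv_norm_sq_apply]
  simp only [smul_apply, innerSL_apply_apply, inner_E3, cross_ofLp]
  simp
  ring

theorem rot_density (i : Fin 3) (m : E3) :
    rot i (density η (b 2)) m = density η (b 2) m * (2 * η * co b 2 m * rot i (co b 2) m) := by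
  have h : density η (b 2) = fun x => (mom b η 0 0 0)⁻¹ * wt b η x := funext fun x => by
    rw [density_eq]; ring
  rw [rot_eq_rotAx, rot_eq_rotAx, h, rotAx_const_mul _ _
    ((contDiff_one (contDiff_wt b η)).differentiable one_ne_zero _), rotAx_wt]
  ring

theorem rot_potential_density {α : ℝ} (hη : η ∈ branchSet α) (i : Fin 3) (m : E3) :
    rot i (potential α (fun m => density η (b 2) m)) m = -(2 * η * co b 2 m * rot i (co b 2) m) := by
  have h : potential α (fun m => density η (b 2) m)
      = fun x => (α * (1 + avg 2 η) / 2) * ‖x‖ ^ 2 + (-η) * co b 2 x ^ 2 := funext fun x => by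
    rw [potential_density b η hη]; ring
  have h1 : ContDiff ℝ ∞ fun x : E3 => ‖x‖ ^ 2 := contDiff_norm_sq ℝ
  have h2 : ContDiff ℝ ∞ fun x => co b 2 x ^ 2 := (contDiff_co b 2).pow 2
  have hd : ∀ {ψ : E3 → ℝ}, ContDiff ℝ ∞ ψ → Differentiable ℝ ψ := fun h =>
    (contDiff_one h).differentiable one_ne_zero
  rw [rot_eq_rotAx, rot_eq_rotAx, h, rotAx_add _ (hd (contDiff_const.mul h1) m)
    (hd (contDiff_const.mul h2) m), rotAx_const_mul _ _ (hd h1 m), rotAx_const_mul _ _ (hd h2 m),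
    rotAx_norm_sq, rotAx_pow _ (contDiff_co b 2)]
  norm_num
  ring

theorem rot_inv_density (i : Fin 3) (m : E3) :
    rot i (fun x => (density η (b 2) x)⁻¹) m
      = -((density η (b 2) m)⁻¹ * (2 * η * co b 2 m * rot i (co b 2) m)) := by
  have h := (density_pos b η m).ne'
  have h1 := rot_density b η i m
  rw [rot_eq_rotAx] at h1 ⊢
  rw [rotAx_comp (F := fun x => x⁻¹) _ (hasDerivAt_inv h)
    ((contDiff_one (contDiff_density b η)).differentiable one_ne_zero _), h1]
  field_simp

/-- The linearized operator in divergence form: its flux is `h R (f / h + U f)`. -/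
theorem opG_divergence_form {α : ℝ} (hη : η ∈ branchSet α) {f : S2 → ℝ} (hf : MemH 2 f) :
    MemH 2 (opH α (fun m => density η (b 2) m) f) ∧
    ∃ g k : Fin 3 → S2 → ℝ, (∀ i, MemLp (g i) 2 σ) ∧ (∀ i, MemLp (k i) 2 σ) ∧
      (∀ i, HasWeakRot i (opH α (fun m => density η (b 2) m) f) (g i)) ∧
      (∀ i, HasWeakRot i (fun m => density η (b 2) m * g i m) (k i)) ∧
      opG α (fun m => density η (b 2) m) f =ᵐ[σ] fun m => ∑ i, k i m := by
  set h : E3 → ℝ := density η (b 2) with hh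
  have hpos : ∀ m, 0 < h m := density_pos b η
  have hinv : ContDiff ℝ ∞ fun x => (h x)⁻¹ := contDiff_inv_density b η
  have hU := contDiff_potential α hf.memLp
  have hu : opH α (fun m => h m) f = fun m : S2 => (h m)⁻¹ * f m + potential α f m := by
    funext m
    unfold opH
    rw [div_eq_inv_mul]
  choose f' hf' hff' using hf.2
  have hg : ∀ i, MemH 1 fun m : S2 => (h m)⁻¹ * f' i m + rot i (fun x => (h x)⁻¹) m * f m
      + rot i (potential α f) m := fun i =>
    ((MemH.mul hinv (hf' i)).add (MemH.mul (contDiff_rot_infty i hinv) hf.of_succ)).add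
      (memH_of_contDiff 1 (contDiff_rot_infty i hU))
  have hug : ∀ i, HasWeakRot i (opH α (fun m => h m) f) fun m : S2 =>
      (h m)⁻¹ * f' i m + rot i (fun x => (h x)⁻¹) m * f m + rot i (potential α f) m := fun i => by
    rw [hu]
    exact HasWeakRot.add (memLp_contDiff_mul hinv hf.memLp)
      ((MemH.mul hinv (hf' i)).add (MemH.mul (contDiff_rot_infty i hinv) hf.of_succ)).memLp
      (memLp_of_contDiff hU) (memLp_of_contDiff (contDiff_rot_infty i hU))
      (HasWeakRot.mul hf.memLp (hf' i).memLp hinv (hff' i)) (hasWeakRot_of_contDiff i hU)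
  have hhg := fun i => MemH.mul (contDiff_density b η) (hg i)
  choose k hk hkk using fun i => (hhg i).2 i
  refine ⟨?_, _, k, fun i => (hg i).memLp, hk, hug, hkk, ?_⟩
  · rw [hu]
    exact (MemH.mul hinv hf).add (memH_of_contDiff 2 hU)
  -- Criticality enters here: R (U h) = -R (ln h) = h R (1/h), so f R (U h) is the term that the
  -- product rule for f / h requires.
  · have hflux : ∀ i, (fun m' : S2 => weakRot i f m' + h m' * rot i (potential α f) m'
        + f m' * rot i (potential α fun m => h m) m') =ᵐ[σ] fun m => h m * ((h m)⁻¹ * f' i m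
        + rot i (fun x => (h x)⁻¹) m * f m + rot i (potential α f) m) := fun i => by
      filter_upwards [weakRot_ae (hf' i).memLp (hff' i)] with m hm
      have := (hpos m).ne'
      rw [hm, rot_potential_density b η hη, rot_inv_density]
      simp only [← hh]
      field_simp
      ring
    have hw : ∀ i, weakRot i (fun m' : S2 => weakRot i f m' + h m' * rot i (potential α f) m'
        + f m' * rot i (potential α fun m => h m) m') =ᵐ[σ] k i := fun i =>
      weakRot_ae (hk i) (hasWeakRot_congr (hflux i).symm (ae_eq_refl _) (hkk i))
    unfold opG
    filter_upwards [ae_all_iff.2 hw] with m hm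
    exact Finset.sum_congr rfl fun i _ => hm i

theorem integral_eq_zero_of_hasWeakRot {i : Fin 3} {f g : S2 → ℝ} (h : HasWeakRot i f g) :
    ∫ m, g m ∂σ = 0 := by
  have h1 := h (fun _ => 1) contDiff_const
  simpa [rot_eq_rotAx, rotAx_const] using h1

theorem hasWeakRot_zero (i : Fin 3) : HasWeakRot i (0 : S2 → ℝ) 0 := fun ψ _ => by simp

theorem integral_opG {α : ℝ} (hη : η ∈ branchSet α) {f : S2 → ℝ} (hf : MemH 2 f) :
    ∫ m, opG α (fun m => density η (b 2) m) f m ∂σ = 0 := by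
  obtain ⟨-, g, k, -, hk, -, hhk, hG⟩ := opG_divergence_form b η hη hf
  rw [integral_congr_ae hG, integral_finsetSum _ fun i _ => integrable_of_memLp (hk i)]
  exact Finset.sum_eq_zero fun i _ => integral_eq_zero_of_hasWeakRot (hhk i)

/-- If the rotational gradient of `f / h + U f` vanishes then so does the linearized operator. -/
theorem opG_eq_zero {α : ℝ} (hη : η ∈ branchSet α) {f : S2 → ℝ} (hf : MemH 2 f)
    (h0 : ∀ i, HasWeakRot i (opH α (fun m => density η (b 2) m) f) 0) :
    ∀ᵐ m ∂σ, opG α (fun m => density η (b 2) m) f m = 0 := by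
  obtain ⟨-, g, k, hg, hk, hug, hhk, hG⟩ := opG_divergence_form b η hη hf
  have hg0 : ∀ i, g i =ᵐ[σ] 0 := fun i => (hug i).unique (hg i) MemLp.zero (h0 i)
  have hk0 : ∀ i, k i =ᵐ[σ] 0 := fun i => by
    refine HasWeakRot.unique (hk i) MemLp.zero (hhk i) (hasWeakRot_congr ?_ (ae_eq_refl _)
      (hasWeakRot_zero i))
    filter_upwards [hg0 i] with m hm
    simp [hm]
  filter_upwards [hG, ae_all_iff.2 hk0] with m h1 h2
  simp [h1, h2]

/-- Integration by parts equates the integral with -∫ h |R (H f)|². If it is nonnegative, the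
gradient of H f must vanish. -/
theorem hasWeakRot_zero_of_energy {α : ℝ} (hη : η ∈ branchSet α) {f : S2 → ℝ} (hf : MemH 2 f)
    (h0 : 0 ≤ ∫ m, opG α (fun m => density η (b 2) m) f m *
      opH α (fun m => density η (b 2) m) f m ∂σ) (i : Fin 3) :
    HasWeakRot i (opH α (fun m => density η (b 2) m) f) 0 := by
  obtain ⟨hu, g, k, hg, hk, hug, hhk, hG⟩ := opG_divergence_form b η hη hf
  set u := opH α (fun m => density η (b 2) m) f
  have hhg : ∀ i, MemLp (fun m : S2 => density η (b 2) m * g i m) 2 σ := fun i =>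
    memLp_contDiff_mul (contDiff_density b η) (hg i)
  have hint : ∀ i, Integrable (fun m : S2 => density η (b 2) m * g i m * g i m) σ := fun i =>
    integrable_mul_of_memLp (hhg i) (hg i)
  have hnn : ∀ i, 0 ≤ fun m : S2 => density η (b 2) m * g i m * g i m := fun i m => by
    have := density_pos b η m
    have := mul_self_nonneg (g i m)
    simp only [Pi.zero_apply, mul_assoc]
    positivity
  have h1 : ∫ m, opG α (fun m => density η (b 2) m) f m * u m ∂σ
      = - ∑ i, ∫ m : S2, density η (b 2) m * g i m * g i m ∂σ := by
    rw [integral_congr_ae (g := fun m => (∑ i, k i m) * u m)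
      (by filter_upwards [hG] with m hm; rw [hm]), integral_finsetSum_mul hk hu.memLp,
      ← Finset.sum_neg_distrib]
    exact Finset.sum_congr rfl fun i _ =>
      (hhk i).integral_mul (hhg i) (hk i) (hg i) hu (hug i)
  rw [h1] at h0
  have h2 : ∀ i, 0 ≤ ∫ m : S2, density η (b 2) m * g i m * g i m ∂σ := fun i =>
    integral_nonneg (hnn i)
  have h3 := (Finset.sum_eq_zero_iff_of_nonneg fun i _ => h2 i).1
    (le_antisymm (by linarith) (Finset.sum_nonneg fun i _ => h2 i)) i (Finset.mem_univ i)
  rw [integral_eq_zero_iff_of_nonneg (hnn i) (hint i)] at h3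
  refine hasWeakRot_congr (ae_eq_refl _) ?_ (hug i)
  filter_upwards [h3] with m hm
  have := (density_pos b η m).ne'
  simpa [this] using hm

/-- The range of the operator has mean zero, hence so does an eigenfunction f with μ > 0. Then ∫ (G
f)(H f) = μ ∫ f H f ≥ 0, the energy identity gives R (H f) = 0, hence G f = 0 and f = 0. -/
theorem not_isEigenvalueG {α : ℝ} (hη : η ∈ branchSet α)
    (hs : SecondVariationNonneg α (fun m => density η (b 2) m)) {μ : ℝ} (hμ : 0 < μ) :
    ¬ IsEigenvalueG α (fun m => density η (b 2) m) μ := by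
  rintro ⟨f, hf0, hf, hG⟩
  have h1 := integral_opG b η hη hf
  rw [integral_congr_ae hG, integral_const_mul] at h1
  have h2 := (mul_eq_zero.1 h1).resolve_left hμ.ne'
  have h3 : 0 ≤ ∫ m, opG α (fun m => density η (b 2) m) f m *
      opH α (fun m => density η (b 2) m) f m ∂σ := by
    have : ∫ m, opG α (fun m => density η (b 2) m) f m * opH α (fun m => density η (b 2) m) f m ∂σ
        = μ * ∫ m, opH α (fun m => density η (b 2) m) f m * f m ∂σ := by
      rw [← integral_const_mul]
      refine integral_congr_ae ?_
      filter_upwards [hG] with m hm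
      rw [hm]
      ring
    rw [this]
    exact mul_nonneg hμ.le (hs f (Lp.memLp f) h2)
  have h4 := opG_eq_zero b η hη hf (hasWeakRot_zero_of_energy b η hη hf h3)
  apply hf0
  apply Lp.ext
  filter_upwards [h4, hG, Lp.coeFn_zero ℝ 2 σ] with m a1 a2 a3
  rw [a3]
  rw [a1] at a2
  exact (mul_eq_zero.1 a2.symm).resolve_left hμ.ne'

end Flux

/-! ### The kernel on the stable branch and its description by rotations. -/

section Kernel

variable (b : OrthonormalBasis (Fin 3) ℝ E3) (η : ℝ)

theorem contDiff_density_mul_quad (c : Fin 5 → ℝ) :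
    ContDiff ℝ ∞ fun x => density η (b 2) x * quad b η c x :=
  (contDiff_density b η).mul (contDiff_quad b η c)

theorem integral_density_mul_quad (c : Fin 5 → ℝ) :
    ∫ m : S2, density η (b 2) m * quad b η c m ∂σ = 0 := by
  simpa only [mul_comm] using integral_quad b η c

/-- On the modes xz and yz the potential of h · q is -α · gap · q, and α · gap = 1. -/
theorem opH_density_mul_quad {α : ℝ} (hη : η ∈ branchSet α) (p q : ℝ) (m : S2) :
    opH α (fun m => density η (b 2) m)
      (fun m => density η (b 2) m * quad b η ![0, 0, 0, p, q] m) m = 0 := by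
  have hf : MemLp (fun m : S2 => density η (b 2) m * quad b η ![0, 0, 0, p, q] m) 2 σ :=
    memLp_of_contDiff (contDiff_density_mul_quad b η _)
  have hd := (density_pos b η m).ne'
  unfold opH
  rw [potential_eq_quad b η α hf (integral_density_mul_quad b η _), qcoef_density_mul_quad,
    (smom_density_mul_quad b η _).1]
  rw [mem_branchSet_iff] at hη
  simp only [quad, Matrix.cons_val]
  field_simp
  linear_combination (-2 * (co b 2 m * (p * co b 0 m + q * co b 1 m))) * hη

theorem opH_congr (α : ℝ) (h : S2 → ℝ) {f g : S2 → ℝ} (hfg : f =ᵐ[σ] g) :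
    opH α h f =ᵐ[σ] opH α h g := by
  filter_upwards [hfg] with m hm
  simp only [opH, hm, potential_congr α hfg]

theorem mem_kerG_of_eq {α : ℝ} (hη : η ∈ branchSet α) (φ : L2S) (p q : ℝ)
    (hφ : ∀ᵐ m : S2 ∂σ, φ m = density η (b 2) m * quad b η ![0, 0, 0, p, q] m) :
    φ ∈ kerG α (fun m => density η (b 2) m) := by
  have hH : MemH 2 φ := (memH_of_contDiff 2 (contDiff_density_mul_quad b η _)).congr
    (Filter.EventuallyEq.symm hφ)
  refine ⟨hH, ?_, opG_eq_zero b η hη hH fun i => ?_⟩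
  · rw [integral_congr_ae hφ]
    exact integral_density_mul_quad b η _
  · refine hasWeakRot_congr (f := 0) ?_ (ae_eq_refl _) (hasWeakRot_zero i)
    filter_upwards [opH_congr α (fun m => density η (b 2) m) hφ] with m hm
    rw [hm, opH_density_mul_quad b η hη]
    rfl

/-- The energy identity makes H φ constant; as φ has mean zero, its second variation is zero. Every
term of the completed square then vanishes: the square itself gives φ = α h · quad, and the strict
inequalities leave only the modes xz and yz. -/
theorem opH_eq_zero_of_mem_kerG {α : ℝ} (hη : η ∈ branchSet α) (hα : 0 < α)
    (h1 : 3 / 2 * α * var2 η < 1) (h2 : 2 * α * mix η < 1) {φ : L2S}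
    (hφ : φ ∈ kerG α (fun m => density η (b 2) m)) :
    ∃ p q : ℝ, ∀ᵐ m : S2 ∂σ, φ m = density η (b 2) m * quad b η ![0, 0, 0, p, q] m := by
  obtain ⟨hH, h0, hG⟩ := hφ
  have hE : 0 ≤ ∫ m, opG α (fun m => density η (b 2) m) φ m *
      opH α (fun m => density η (b 2) m) φ m ∂σ := by
    rw [integral_congr_ae (g := fun _ => 0) (by filter_upwards [hG] with m hm; simp [hm])]
    simp
  have hu := hasWeakRot_zero_of_energy b η hη hH hE
  obtain ⟨c, hc⟩ := ae_const_of_hasWeakRot_zero (opG_divergence_form b η hη hH).1.memLp hu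
  have hsv := second_variation_eq b η (α := α) (Lp.memLp φ) h0
  rw [integral_congr_ae (g := fun m => c * φ m) (by filter_upwards [hc] with m hm; rw [hm]),
    integral_const_mul, h0, mul_zero, mem_branchSet_iff.1 hη] at hsv
  set h : E3 → ℝ := density η (b 2) with hh
  have hpos : ∀ m, 0 < h m := density_pos b η
  set r : S2 → ℝ := fun m => φ m - α * h m * quad b η (qcoef b φ) m with hr
  have hrm : MemLp r 2 σ := (Lp.memLp φ).sub
    (memLp_of_contDiff ((contDiff_const.mul (contDiff_density b η)).mul (contDiff_quad b η _)))
  have hint : Integrable (fun m => r m ^ 2 / h m) σ := by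
    have := integrable_mul_of_memLp (memLp_contDiff_mul (contDiff_inv_density b η) hrm) hrm
    refine this.congr (.of_forall fun m => ?_)
    simp only
    rw [div_eq_inv_mul]
    ring
  have hnn : 0 ≤ fun m : S2 => r m ^ 2 / h m := fun m => div_nonneg (sq_nonneg _) (hpos m).le
  have a0 := integral_nonneg (μ := σ) hnn
  have a1 : 0 < 1 - 3 / 2 * α * var2 η := by linarith
  have a2 : 0 < 1 - 2 * α * mix η := by linarith
  have b1 := mul_nonneg (mul_nonneg hα.le a1.le) (sq_nonneg (smom b φ 2 2))
  have b2 := mul_nonneg (mul_nonneg hα.le a2.le) (sq_nonneg ((smom b φ 0 0 - smom b φ 1 1) / 2))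
  have b3 := mul_nonneg (mul_nonneg hα.le a2.le) (sq_nonneg (smom b φ 0 1))
  have z0 : ∫ m, r m ^ 2 / h m ∂σ = 0 := by linarith
  have z1 : smom b φ 2 2 = 0 := by
    have : α * (1 - 3 / 2 * α * var2 η) * smom b φ 2 2 ^ 2 = 0 := by linarith
    simpa [hα.ne', a1.ne'] using this
  have z2 : (smom b φ 0 0 - smom b φ 1 1) / 2 = 0 := by
    have : α * (1 - 2 * α * mix η) * ((smom b φ 0 0 - smom b φ 1 1) / 2) ^ 2 = 0 := by linarith
    exact pow_eq_zero_iff two_ne_zero |>.1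
      ((mul_eq_zero.1 this).resolve_left (mul_pos hα a2).ne')
  have z3 : smom b φ 0 1 = 0 := by
    have : α * (1 - 2 * α * mix η) * smom b φ 0 1 ^ 2 = 0 := by linarith
    simpa [hα.ne', a2.ne'] using this
  rw [integral_eq_zero_iff_of_nonneg hnn hint] at z0
  refine ⟨2 * α * smom b φ 0 2, 2 * α * smom b φ 1 2, ?_⟩
  filter_upwards [z0] with m hm
  have hr0 : r m = 0 := by simpa [(hpos m).ne'] using hm
  have : φ m = α * h m * quad b η (qcoef b φ) m := sub_eq_zero.1 hr0
  rw [this]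
  simp only [quad, qcoef, Matrix.cons_val, z1, z2, z3]
  ring

/-- Here R h = 2η z h R z and Θ · R z = (Θ × m) · n. The component of m along n contributes nothing,
which leaves z times a linear form in x and y. -/
theorem sum_mul_rot_density (Θ : E3) (m : S2) :
    ∑ i, Θ i * rot i (density η (b 2)) m = density η (b 2) m *
      quad b η ![0, 0, 0, 2 * η * ⟪cross Θ (b 0), b 2⟫_ℝ, 2 * η * ⟪cross Θ (b 1), b 2⟫_ℝ] m := by
  have hd := (contDiff_one (contDiff_co b 2)).differentiable one_ne_zero
  have h1 : ∑ i, Θ i * rot i (co b 2) m = ⟪cross Θ m, b 2⟫_ℝ := by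
    rw [← rotAx_eq_sum]
    exact rotAx_inner _ _ _
  have h2 : ⟪cross Θ m, b 2⟫_ℝ = co b 0 m * ⟪cross Θ (b 0), b 2⟫_ℝ
      + co b 1 m * ⟪cross Θ (b 1), b 2⟫_ℝ := by
    have h3 : (m : E3) = ∑ k, co b k m • b k := by
      conv_lhs => rw [← b.sum_repr' (m : E3)]
      exact Finset.sum_congr rfl fun k _ => by rw [co, real_inner_comm]
    have h4 : ⟪cross Θ (b 2), b 2⟫_ℝ = 0 := by
      rw [inner_E3]
      simp [cross_ofLp]
      ring
    have h5 : ∀ v : E3, ⟪cross Θ v, b 2⟫_ℝ = ⟪v, cross (b 2) Θ⟫_ℝ := fun v => by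
      rw [inner_E3, inner_E3]
      simp [cross_ofLp]
      ring
    rw [h5] at h4
    rw [h5, h5, h5]
    conv_lhs => rw [h3]
    rw [sum_inner, Fin.sum_univ_three]
    simp only [inner_smul_left, h4]
    simp
  simp only [rot_density]
  have h6 : ∑ i, Θ i * (density η (b 2) m * (2 * η * co b 2 m * rot i (co b 2) m))
      = density η (b 2) m * (2 * η * co b 2 m * ∑ i, Θ i * rot i (co b 2) m) := by
    simp only [Finset.mul_sum]
    exact Finset.sum_congr rfl fun i _ => by ring
  rw [h6, h1, h2]
  simp only [quad, Matrix.cons_val]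
  ring

theorem exists_sum_mul_rot_density (hη : η ≠ 0) (p q : ℝ) : ∃ Θ : E3, ∀ m : S2,
    ∑ i, Θ i * rot i (density η (b 2)) m
      = density η (b 2) m * quad b η ![0, 0, 0, p, q] m := by
  have h5 : ∀ k l j, ⟪cross (axis b k l) (b j), b 2⟫_ℝ
      = (if j = k then 1 else 0) * (if l = 2 then 1 else 0)
        - (if j = l then 1 else 0) * (if k = 2 then 1 else 0) := fun k l j => by
    unfold axis
    rw [cross_cross_eq, inner_sub_left, inner_smul_left, inner_smul_left, b.inner_eq_ite,
      b.inner_eq_ite, b.inner_eq_ite, b.inner_eq_ite]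
    simp
  have hadd : ∀ (s t : ℝ) (x y v : E3), ⟪cross (s • x + t • y) v, b 2⟫_ℝ
      = s * ⟪cross x v, b 2⟫_ℝ + t * ⟪cross y v, b 2⟫_ℝ := fun s t x y v => by
    rw [inner_E3, inner_E3, inner_E3]
    simp [cross_ofLp]
    ring
  -- Rotations about these two axes tilt n within the xz-plane and the yz-plane; the divisor 2η
  -- undoes the factor from differentiating the density.
  refine ⟨(p / (2 * η)) • axis b 0 2 + (q / (2 * η)) • axis b 1 2, fun m => ?_⟩
  rw [sum_mul_rot_density, hadd, hadd, h5, h5, h5, h5]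
  have e1 : 2 * η * (p / (2 * η)) = p := by field_simp
  have e2 : 2 * η * (q / (2 * η)) = q := by field_simp
  simp [e1, e2]

theorem kerG_eq {α : ℝ} (hη : η ∈ branchSet α) (hα : 0 < α)
    (h1 : 3 / 2 * α * var2 η < 1) (h2 : 2 * α * mix η < 1) :
    kerG α (fun m => density η (b 2) m) = {φ : L2S | ∃ p q : ℝ, ∀ᵐ m : S2 ∂σ,
      φ m = density η (b 2) m * quad b η ![0, 0, 0, p, q] m} :=
  Set.Subset.antisymm (fun _ hφ => opH_eq_zero_of_mem_kerG b η hη hα h1 h2 hφ)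
    (fun φ ⟨p, q, hφ⟩ => mem_kerG_of_eq b η hη φ p q hφ)

theorem exists_submodule_kerG {α : ℝ} (hη : η ∈ branchSet α) (hα : 0 < α)
    (h1 : 3 / 2 * α * var2 η < 1) (h2 : 2 * α * mix η < 1) :
    ∃ K : Submodule ℝ L2S, (K : Set L2S) = kerG α (fun m => density η (b 2) m) ∧
      Module.finrank ℝ K = 2 := by
  have hm : ∀ c : Fin 2 → ℝ, MemLp (fun m : S2 => density η (b 2) m *
      quad b η ![0, 0, 0, c 0, c 1] m) 2 σ := fun c =>
    memLp_of_contDiff (contDiff_density_mul_quad b η _)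
  let T : (Fin 2 → ℝ) →ₗ[ℝ] L2S :=
    { toFun := fun c => (hm c).toLp
      map_add' := fun c d => by
        rw [← MemLp.toLp_add]
        congr 1
        funext m
        simp only [quad, Pi.add_apply, Matrix.cons_val]
        ring
      map_smul' := fun a c => by
        rw [RingHom.id_apply, ← MemLp.toLp_const_smul]
        congr 1
        funext m
        simp only [quad, Pi.smul_apply, smul_eq_mul, Matrix.cons_val]
        ring }
  have hT : ∀ c, T c =ᵐ[σ] fun m : S2 => density η (b 2) m * quad b η ![0, 0, 0, c 0, c 1] m :=
    fun c => (hm c).coeFn_toLp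
  -- The weighted norm of the quadratic form with coefficients p, q is (p² + q²) gap / 2, which is
  -- positive unless p = q = 0.
  have hinj : Function.Injective T := by
    rw [injective_iff_map_eq_zero]
    intro c hc
    have h3 := integral_quad_mul b η ![0, 0, 0, c 0, c 1] ![0, 0, 0, c 0, c 1]
    have h4 := hT c
    rw [hc] at h4
    rw [integral_congr_ae (g := fun _ => 0)] at h3
    · simp only [integral_zero, Matrix.cons_val] at h3
      have hg := gap_pos η
      have h5 : c 0 * c 0 + c 1 * c 1 = 0 := by
        have : (c 0 * c 0 + c 1 * c 1) * (gap η / 2) = 0 := by linarith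
        exact (mul_eq_zero.1 this).resolve_right (by positivity)
      have h6 : c 0 = 0 := by nlinarith [mul_self_nonneg (c 0), mul_self_nonneg (c 1)]
      have h7 : c 1 = 0 := by nlinarith [mul_self_nonneg (c 0), mul_self_nonneg (c 1)]
      ext j
      fin_cases j <;> simp [h6, h7]
    · filter_upwards [h4, Lp.coeFn_zero ℝ 2 σ] with m a1 a2
      rw [a2] at a1
      have := (mul_eq_zero.1 a1.symm).resolve_left (density_pos b η m).ne'
      simp [this]
  refine ⟨LinearMap.range T, ?_, ?_⟩
  · rw [kerG_eq b η hη hα h1 h2]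
    ext φ
    simp only [SetLike.mem_coe, LinearMap.mem_range]
    constructor
    · rintro ⟨c, rfl⟩
      exact ⟨c 0, c 1, hT c⟩
    · rintro ⟨p, q, h⟩
      refine ⟨![p, q], Lp.ext ?_⟩
      filter_upwards [hT ![p, q], h] with m a1 a2
      rw [a1, a2]
      simp
  · rw [LinearMap.finrank_range_of_inj hinj]
    simp

end Kernel

/-! ### An abstract Birman–Schwinger argument for an operator J with 0 ≤ J ≤ 1. -/

section Hilbert

variable {X : Type*} [NormedAddCommGroup X] [InnerProductSpace ℝ X]
  {J : X →L[ℝ] X}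

/-- A positive semidefinite operator of norm one on a finite-dimensional space has the
eigenvalue one. -/
theorem exists_fixed_of_norm_eq_one {W : Type*} [NormedAddCommGroup W] [InnerProductSpace ℝ W]
    [FiniteDimensional ℝ W] {M : W →L[ℝ] W} (hs : ∀ p q, ⟪M p, q⟫_ℝ = ⟪p, M q⟫_ℝ)
    (hp : ∀ q, 0 ≤ ⟪M q, q⟫_ℝ) (h1 : ‖M‖ = 1) : ∃ q, q ≠ 0 ∧ M q = q := by
  have hnt : Nontrivial W := by
    by_contra hW
    rw [not_nontrivial_iff_subsingleton] at hW
    have : M = 0 := Subsingleton.elim _ _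
    simp [this] at h1
  obtain ⟨q, hq, hmax⟩ := (isCompact_sphere (0 : W) 1).exists_isMaxOn
    (NormedSpace.sphere_nonempty.2 zero_le_one) (f := fun q => ‖M q‖) (by fun_prop)
  have hq1 : ‖q‖ = 1 := by simpa using hq
  have hMq : ‖M q‖ = 1 := by
    refine le_antisymm ?_ ?_
    · simpa [h1, hq1] using M.le_opNorm q
    · rw [← h1]
      refine M.opNorm_le_of_unit_norm (norm_nonneg _) fun x hx => ?_
      exact hmax (show x ∈ Metric.sphere (0 : W) 1 by simpa using hx)
  refine ⟨q, by rintro rfl; simp at hq1, ?_⟩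
  -- Positivity at q - M q reads ⟨M q, q⟩ - 2‖M q‖² + ⟨M² q, M q⟩ ≥ 0. With ‖M q‖ = 1 and the last
  -- term at most 1 it forces ⟨M q, q⟩ ≥ 1, hence M q = q.
  have h2 := hp (q - M q)
  rw [map_sub, inner_sub_left, inner_sub_right, inner_sub_right, hs (M q) q,
    real_inner_self_eq_norm_sq, hMq] at h2
  have h3 : ⟪M (M q), M q⟫_ℝ ≤ 1 := by
    refine (real_inner_le_norm _ _).trans ?_
    have := M.le_opNorm (M q)
    rw [h1, hMq] at this
    rw [hMq]
    linarith
  have h4 : ‖M q - q‖ ^ 2 ≤ 0 := by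
    rw [norm_sub_sq_real, hMq, hq1]
    linarith
  have h5 : ‖M q - q‖ = 0 := by nlinarith [norm_nonneg (M q - q)]
  exact sub_eq_zero.1 (norm_eq_zero.1 h5)

theorem inner_sub_apply_nonneg (hJ : ∀ x, ‖J x‖ ^ 2 ≤ ⟪J x, x⟫_ℝ) (y : X) :
    0 ≤ ⟪y - J y, J y⟫_ℝ := by
  rw [inner_sub_left, real_inner_self_eq_norm_sq, real_inner_comm]
  linarith [hJ y]

theorem norm_apply_le (hJ : ∀ x, ‖J x‖ ^ 2 ≤ ⟪J x, x⟫_ℝ) (y : X) : ‖J y‖ ≤ ‖y‖ := by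
  have h1 := (hJ y).trans (real_inner_le_norm _ _)
  by_contra! h
  nlinarith [norm_nonneg y, norm_nonneg (J y)]

theorem norm_sub_apply_le (hJ : ∀ x, ‖J x‖ ^ 2 ≤ ⟪J x, x⟫_ℝ) (y : X) : ‖y - J y‖ ≤ ‖y‖ := by
  rw [← sq_le_sq₀ (norm_nonneg _) (norm_nonneg _), norm_sub_sq_real, real_inner_comm]
  nlinarith [hJ y, sq_nonneg ‖J y‖]

/-- In the expansion of ‖x‖² the cross term is 2t⟨y - J y, J y⟩ ≥ 0. The bounds are uniform in t,
which both limits below need. -/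
theorem norm_le_of_resolvent (hJ : ∀ x, ‖J x‖ ^ 2 ≤ ⟪J x, x⟫_ℝ) {t : ℝ} (ht : 0 < t) {x y : X}
    (h : (y - J y) + t • J y = x) : ‖y - J y‖ ≤ ‖x‖ ∧ t * ‖J y‖ ≤ ‖x‖ := by
  have h1 := inner_sub_apply_nonneg hJ y
  have h2 : ‖x‖ ^ 2 = ‖y - J y‖ ^ 2 + 2 * t * ⟪y - J y, J y⟫_ℝ + (t * ‖J y‖) ^ 2 := by
    rw [← h, norm_add_sq_real, inner_smul_right, norm_smul, Real.norm_of_nonneg ht.le]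
    ring
  have h3 : 0 ≤ 2 * t * ⟪y - J y, J y⟫_ℝ := by positivity
  constructor
  · rw [← sq_le_sq₀ (norm_nonneg _) (norm_nonneg _)]
    nlinarith [sq_nonneg (t * ‖J y‖)]
  · rw [← sq_le_sq₀ (by positivity) (norm_nonneg _)]
    nlinarith [sq_nonneg ‖y - J y‖]

/-- The operator `(1 - J) + t J`. -/
def pencil (J : X →L[ℝ] X) (t : ℝ) : X →L[ℝ] X := (1 - J) + t • J

theorem pencil_apply (t : ℝ) (y : X) : pencil J t y = (y - J y) + t • J y := rfl

variable [CompleteSpace X]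

/-- Lax–Milgram: the form of (1 - J) + tJ is bounded below by min 1 t. -/
theorem isUnit_pencil (hJ : ∀ x, ‖J x‖ ^ 2 ≤ ⟪J x, x⟫_ℝ) {t : ℝ} (ht : 0 < t) :
    IsUnit (pencil J t) := by
  have hc : 0 < min 1 t := lt_min one_pos ht
  refine ContinuousLinearMap.isUnit_of_forall_le_norm_inner_map _ (c := ⟨min 1 t, hc.le⟩) hc
    fun x => ?_
  change ‖x‖ ^ 2 * min 1 t ≤ _
  refine le_trans ?_ (le_abs_self _)
  have h1 := hJ x
  have h2 : ⟪J x, x⟫_ℝ ≤ ‖x‖ ^ 2 := by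
    have := real_inner_le_norm (J x) x
    have := norm_apply_le hJ x
    nlinarith [norm_nonneg x]
  rw [pencil_apply, inner_add_left, inner_sub_left, inner_smul_left, real_inner_self_eq_norm_sq]
  simp only [RCLike.conj_to_real]
  nlinarith [min_le_left 1 t, min_le_right 1 t, sq_nonneg ‖J x‖]

/-- The solution operator of the equation `(1 - J) y + t J y = x`. -/
def pencilInv (J : X →L[ℝ] X) (t : ℝ) : X →L[ℝ] X := Ring.inverse (pencil J t)

theorem pencilInv_spec (hJ : ∀ x, ‖J x‖ ^ 2 ≤ ⟪J x, x⟫_ℝ) {t : ℝ} (ht : 0 < t) (x : X) :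
    (pencilInv J t x - J (pencilInv J t x)) + t • J (pencilInv J t x) = x := by
  have h := Ring.mul_inverse_cancel _ (isUnit_pencil hJ ht)
  exact congrArg (fun T : X →L[ℝ] X => T x) h

theorem pencilInv_unique (hJ : ∀ x, ‖J x‖ ^ 2 ≤ ⟪J x, x⟫_ℝ) {t : ℝ} (ht : 0 < t) {x y : X}
    (h : (y - J y) + t • J y = x) : pencilInv J t x = y := by
  rw [← h]
  exact congrArg (fun T : X →L[ℝ] X => T y) (Ring.inverse_mul_cancel _ (isUnit_pencil hJ ht))

theorem continuousOn_pencilInv (hJ : ∀ x, ‖J x‖ ^ 2 ≤ ⟪J x, x⟫_ℝ) :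
    ContinuousOn (pencilInv J) (Set.Ioi 0) := by
  intro t ht
  obtain ⟨u, hu⟩ := isUnit_pencil hJ ht
  have h1 : ContinuousAt (pencil J) t := by
    unfold pencil
    fun_prop
  have h2 := NormedRing.inverse_continuousAt u
  rw [hu] at h2
  exact (ContinuousAt.comp (f := pencil J) h2 h1).continuousWithinAt

/-- For symmetric A the orthogonal complement of the range lies in the kernel; take orthogonal
complements once more. -/
theorem mem_closure_range_of_orthogonal_ker {A : X →L[ℝ] X} (hA : ∀ x y, ⟪A x, y⟫_ℝ = ⟪x, A y⟫_ℝ)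
    {z : X} (hz : ∀ a, A a = 0 → ⟪a, z⟫_ℝ = 0) : z ∈ closure (Set.range A) := by
  have h1 : z ∈ (LinearMap.ker A.toLinearMap)ᗮ := (Submodule.mem_orthogonal _ _).2 fun a ha => hz a ha
  have h2 : (LinearMap.range A.toLinearMap)ᗮ ≤ LinearMap.ker A.toLinearMap := by
    intro x hx
    refine ext_inner_right ℝ fun y => ?_
    change ⟪A x, y⟫_ℝ = _
    rw [hA, inner_zero_left]
    rw [Submodule.mem_orthogonal'] at hx
    exact hx _ ⟨y, rfl⟩
  have h3 := Submodule.orthogonal_le h2 h1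
  rw [Submodule.orthogonal_orthogonal_eq_closure] at h3
  exact h3

/-- The operator `(1 - J) ((1 - J) + t J)⁻¹` tends strongly to zero as `t → ∞`. -/
theorem pencil_tendsto_top (hJ : ∀ x, ‖J x‖ ^ 2 ≤ ⟪J x, x⟫_ℝ)
    (hs : ∀ x y, ⟪J x, y⟫_ℝ = ⟪x, J y⟫_ℝ) (hinj : ∀ x, J x = 0 → x = 0) (x : X) :
    Filter.Tendsto (fun t => pencilInv J t x - J (pencilInv J t x)) Filter.atTop (nhds 0) := by
  rw [Metric.tendsto_atTop]
  intro ε hε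
  have hx : x ∈ closure (Set.range J) :=
    mem_closure_range_of_orthogonal_ker hs fun a ha => by rw [hinj a ha, inner_zero_left]
  -- J is injective and symmetric, so x is close to some J ξ. On J ξ the solution operator commutes
  -- with J and gains a factor 1 / t; the remainder is handled by the uniform bound.
  obtain ⟨_, ⟨ξ, rfl⟩, hξ⟩ := Metric.mem_closure_iff.1 hx (ε / 2) (by positivity)
  refine ⟨max 1 (2 * (‖ξ‖ + 1) / ε), fun t ht => ?_⟩
  have ht1 : 1 ≤ t := (le_max_left _ _).trans ht
  have ht0 : 0 < t := by linarith
  have ht2 : 2 * (‖ξ‖ + 1) / ε ≤ t := (le_max_right _ _).trans ht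
  have h1 := pencilInv_spec hJ ht0 ξ
  set y := pencilInv J t ξ with hy
  have h2 : pencilInv J t (J ξ) = J y := by
    refine pencilInv_unique hJ ht0 ?_
    rw [← h1, map_add, map_sub, map_smul]
  have h3 : x = J ξ + (x - J ξ) := by abel
  have h4 := pencilInv_spec hJ ht0 (x - J ξ)
  have h5 := (norm_le_of_resolvent hJ ht0 h4).1
  have h6 : ‖J y - J (J y)‖ < ε / 2 := by
    refine (norm_sub_apply_le hJ _).trans_lt ?_
    have h7 := (norm_le_of_resolvent hJ ht0 h1).2
    rw [div_le_iff₀ hε] at ht2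
    nlinarith [norm_nonneg (J y)]
  rw [dist_eq_norm] at hξ
  rw [dist_zero_right, h3, map_add, h2, map_add, add_sub_add_comm]
  calc _ ≤ _ := norm_add_le _ _
    _ < ε / 2 + ε / 2 := by linarith
    _ = ε := by ring

/-- The operator `(1 - J) ((1 - J) + t J)⁻¹` tends strongly to the projection onto the orthogonal
complement of the kernel of `1 - J` as `t → 0`. -/
theorem pencil_tendsto_zero (hJ : ∀ x, ‖J x‖ ^ 2 ≤ ⟪J x, x⟫_ℝ)
    (hs : ∀ x y, ⟪J x, y⟫_ℝ = ⟪x, J y⟫_ℝ) {a z : X} (ha : J a = a)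
    (hz : ∀ a, J a = a → ⟪a, z⟫_ℝ = 0) {ε : ℝ} (hε : 0 < ε) : ∃ t, 0 < t ∧
    ‖(pencilInv J t (a + z) - J (pencilInv J t (a + z))) - z‖ < ε := by
  have hx : z ∈ closure (Set.range ((1 : X →L[ℝ] X) - J)) :=
    mem_closure_range_of_orthogonal_ker (fun x y => by
      simp [inner_sub_left, inner_sub_right, hs]) fun a ha => hz a (by
      have : a - J a = 0 := ha
      exact (sub_eq_zero.1 this).symm)
  obtain ⟨_, ⟨ξ, rfl⟩, hξ⟩ := Metric.mem_closure_iff.1 hx (ε / 2) (by positivity)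
  change dist z (ξ - J ξ) < _ at hξ
  refine ⟨ε / (2 * (‖ξ‖ + 1)), by positivity, ?_⟩
  set t := ε / (2 * (‖ξ‖ + 1)) with ht
  have ht0 : 0 < t := by positivity
  have h1 := pencilInv_spec hJ ht0 ξ
  set y := pencilInv J t ξ with hy
  have h2 : pencilInv J t (ξ - J ξ) = y - J y := by
    refine pencilInv_unique hJ ht0 ?_
    rw [← h1]
    simp only [map_add, map_sub, map_smul, smul_sub]
    abel
  -- The solution blows up along the fixed vector a, but 1 - J annihilates that part.
  have h0 : pencilInv J t a = t⁻¹ • a := by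
    refine pencilInv_unique hJ ht0 ?_
    rw [map_smul, ha, sub_self, zero_add, smul_inv_smul₀ ht0.ne']
  have h4 := pencilInv_spec hJ ht0 (z - (ξ - J ξ))
  set w := pencilInv J t (z - (ξ - J ξ)) with hw
  have h5 := (norm_le_of_resolvent hJ ht0 h4).2
  have h3 : a + z = a + ((ξ - J ξ) + (z - (ξ - J ξ))) := by abel
  have h6 : pencilInv J t (a + z) = t⁻¹ • a + ((y - J y) + w) := by
    rw [h3, map_add, map_add, h0, h2]
  have h7 : (pencilInv J t (a + z) - J (pencilInv J t (a + z))) - z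
      = -(t • J (y - J y)) - t • J w := by
    have e1 : z = (w - J w + t • J w) + (ξ - J ξ) := by rw [h4]; abel
    have e2 : ξ - J ξ = ((y - J y) - J (y - J y)) + t • J (y - J y) := by
      conv_lhs => rw [← h1]
      simp only [map_add, map_sub, map_smul, smul_sub]
      abel
    rw [h6, e1, e2]
    simp only [map_add, map_sub, map_smul, ha]
    abel
  rw [h7]
  rw [dist_eq_norm] at hξ
  have h8 : ‖t • J (y - J y)‖ < ε / 2 := by
    rw [norm_smul, Real.norm_of_nonneg ht0.le]
    have h9 := (norm_apply_le hJ (y - J y)).trans (norm_le_of_resolvent hJ ht0 h1).1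
    calc t * ‖J (y - J y)‖ ≤ t * ‖ξ‖ := by gcongr
      _ < t * (‖ξ‖ + 1) := by gcongr; linarith
      _ = ε / 2 := by rw [ht]; field_simp
  have h10 : ‖t • J w‖ < ε / 2 := by
    rw [norm_smul, Real.norm_of_nonneg ht0.le]
    exact h5.trans_lt hξ
  calc _ ≤ ‖-(t • J (y - J y))‖ + ‖t • J w‖ := norm_sub_le _ _
    _ < ε := by rw [norm_neg]; linarith

/-- If a finite-rank perturbation is strong enough, the equation
`(1 - J) y + t J y = L L* (1 - J) y` has a nontrivial solution for some `t > 0`. -/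
theorem exists_pencil_solution (hJ : ∀ x, ‖J x‖ ^ 2 ≤ ⟪J x, x⟫_ℝ)
    (hs : ∀ x y, ⟪J x, y⟫_ℝ = ⟪x, J y⟫_ℝ) (hinj : ∀ x, J x = 0 → x = 0)
    {ι : Type*} [Fintype ι] (L : EuclideanSpace ℝ ι →L[ℝ] X) {q₀ : EuclideanSpace ℝ ι} {a z : X}
    (hLq : L q₀ = a + z) (ha : J a = a) (hz : ∀ a, J a = a → ⟪a, z⟫_ℝ = 0)
    (hq : ‖q₀‖ ^ 2 < ‖z‖ ^ 2) :
    ∃ (t : ℝ) (y : X), 0 < t ∧ y - J y ≠ 0 ∧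
      (y - J y) + t • J y = L (L.adjoint (y - J y)) := by
  classical
  -- If M t q = q then y = ((1 - J) + tJ)⁻¹ L q solves the equation, since q = L* (1 - J) y. It
  -- remains to find t with ‖M t‖ = 1.
  set M : ℝ → EuclideanSpace ℝ ι →L[ℝ] EuclideanSpace ℝ ι := fun t =>
    L.adjoint ∘L ((1 - J) ∘L (pencilInv J t ∘L L)) with hM
  have hMa : ∀ t q, M t q = L.adjoint (pencilInv J t (L q) - J (pencilInv J t (L q))) :=
    fun t q => rfl
  have hMi : ∀ t q q', ⟪M t q, q'⟫_ℝ
      = ⟪pencilInv J t (L q) - J (pencilInv J t (L q)), L q'⟫_ℝ := fun t q q' => by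
    rw [hMa, ContinuousLinearMap.adjoint_inner_left]
  have hcont : ContinuousOn (fun t => ‖M t‖) (Set.Ioi 0) := by
    have h1 := continuousOn_pencilInv hJ
    refine ContinuousOn.norm ?_
    exact continuousOn_const.clm_comp (continuousOn_const.clm_comp (h1.clm_comp continuousOn_const))
  have hform : ∀ {t : ℝ}, 0 < t → ∀ q q', ⟪M t q, q'⟫_ℝ =
      ⟪pencilInv J t (L q) - J (pencilInv J t (L q)),
        pencilInv J t (L q') - J (pencilInv J t (L q'))⟫_ℝ
      + t * (⟪pencilInv J t (L q), J (pencilInv J t (L q'))⟫_ℝ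
        - ⟪J (pencilInv J t (L q)), J (pencilInv J t (L q'))⟫_ℝ) := fun {t} ht q q' => by
    rw [hMi]
    conv_lhs => rw [← pencilInv_spec hJ ht (L q')]
    rw [inner_add_right, inner_smul_right, inner_sub_left _ _ (J (pencilInv J t (L q')))]
  have hsymm : ∀ {t : ℝ}, 0 < t → ∀ q q', ⟪M t q, q'⟫_ℝ = ⟪q, M t q'⟫_ℝ := fun {t} ht q q' => by
    rw [real_inner_comm (M t q') q, hform ht, hform ht]
    rw [real_inner_comm (pencilInv J t (L q) - J (pencilInv J t (L q))),
      real_inner_comm (J (pencilInv J t (L q))) (J (pencilInv J t (L q'))),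
      ← hs, real_inner_comm (pencilInv J t (L q')) (J (pencilInv J t (L q)))]
  have hpos : ∀ {t : ℝ}, 0 < t → ∀ q, 0 ≤ ⟪M t q, q⟫_ℝ := fun {t} ht q => by
    rw [hform ht, ← inner_sub_left]
    exact add_nonneg real_inner_self_nonneg (mul_nonneg ht.le (inner_sub_apply_nonneg hJ _))
  -- Strong convergence to zero as t → ∞ becomes norm convergence in finite dimension, by summing
  -- over a basis.
  obtain ⟨t₁, ht₁, h1⟩ : ∃ t, 0 < t ∧ ‖M t‖ < 1 := by
    have h2 : Filter.Tendsto (fun t => ∑ i, ‖M t (EuclideanSpace.single i 1)‖) Filter.atTop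
        (nhds 0) := by
      have h3 : ∀ i, Filter.Tendsto (fun t => ‖M t (EuclideanSpace.single i 1)‖) Filter.atTop
          (nhds 0) := fun i => by
        have h4 := ((L.adjoint.continuous.tendsto 0).comp
          (pencil_tendsto_top hJ hs hinj (L (EuclideanSpace.single i 1)))).norm
        rw [map_zero, norm_zero] at h4
        exact h4
      simpa using tendsto_finsetSum Finset.univ fun i _ => h3 i
    obtain ⟨t, ht, ht'⟩ := ((h2.eventually_lt_const one_pos).and
      (Filter.eventually_gt_atTop 0)).exists
    refine ⟨t, ht', lt_of_le_of_lt ?_ ht⟩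
    refine ContinuousLinearMap.opNorm_le_bound _ (Finset.sum_nonneg fun i _ => norm_nonneg _)
      fun q => ?_
    have h5 : q = ∑ i, q i • EuclideanSpace.single i (1 : ℝ) := by
      ext j
      simp [Finset.sum_apply, Pi.single_apply]
    conv_lhs => rw [h5]
    rw [map_sum, Finset.sum_mul]
    refine (norm_sum_le _ _).trans (Finset.sum_le_sum fun i _ => ?_)
    rw [map_smul, norm_smul, mul_comm]
    gcongr
    exact PiLp.norm_apply_le q i
  -- For suitable t the form ⟨M t q₀, q₀⟩ is as close as wanted to ⟨z, L q₀⟩ = ‖z‖², which exceeds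
  -- ‖q₀‖².
  obtain ⟨t₀, ht₀, h0⟩ : ∃ t, 0 < t ∧ 1 < ‖M t‖ := by
    have hzpos : 0 < ‖z‖ := by
      by_contra! h
      have : ‖z‖ = 0 := le_antisymm h (norm_nonneg z)
      rw [this] at hq
      nlinarith [sq_nonneg ‖q₀‖]
    have haz : ⟪z, a⟫_ℝ = 0 := by rw [real_inner_comm]; exact hz a ha
    obtain ⟨t, ht, h2⟩ := pencil_tendsto_zero hJ hs ha hz
      (ε := (‖z‖ ^ 2 - ‖q₀‖ ^ 2) / (‖a + z‖ + 1)) (div_pos (by linarith) (by positivity))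
    rw [← hLq] at h2
    refine ⟨t, ht, ?_⟩
    by_contra! hle
    have h3 : ⟪M t q₀, q₀⟫_ℝ ≤ ‖q₀‖ ^ 2 := by
      refine (real_inner_le_norm _ _).trans ?_
      have := M t |>.le_opNorm q₀
      nlinarith [norm_nonneg q₀]
    rw [hMi] at h3
    set v := pencilInv J t (L q₀) - J (pencilInv J t (L q₀))
    have h4 : ∀ v, ⟪v, L q₀⟫_ℝ = ‖z‖ ^ 2 + ⟪v - z, L q₀⟫_ℝ := fun v => by
      rw [inner_sub_left, hLq, inner_add_right z, haz, real_inner_self_eq_norm_sq]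
      ring
    have h5 : |⟪v - z, L q₀⟫_ℝ| < ‖z‖ ^ 2 - ‖q₀‖ ^ 2 := by
      refine (abs_real_inner_le_norm _ _).trans_lt ?_
      rw [hLq] at h2 ⊢
      rw [lt_div_iff₀ (by positivity)] at h2
      nlinarith [norm_nonneg (v - z)]
    have := (abs_lt.1 h5).1
    rw [h4] at h3
    linarith
  obtain ⟨t, ht, h2⟩ : ∃ t, 0 < t ∧ ‖M t‖ = 1 := by
    have := isPreconnected_Ioi.intermediate_value (a := t₁) (b := t₀) ht₁ ht₀ hcont
      (show (1 : ℝ) ∈ Set.Icc _ _ from ⟨h1.le, h0.le⟩)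
    obtain ⟨t, ht, h⟩ := this
    exact ⟨t, ht, h⟩
  obtain ⟨q, hq0, hq⟩ := exists_fixed_of_norm_eq_one (hsymm ht) (hpos ht) h2
  refine ⟨t, pencilInv J t (L q), ht, fun h => hq0 ?_, ?_⟩
  · rw [← hq, hMa, h, map_zero]
  · rw [← hMa, hq]
    exact pencilInv_spec hJ ht (L q)

end Hilbert

/-! ### The weighted Sobolev space and the resolvent J of A = -s⁻¹ R · s² R s⁻¹. -/

section WeightedSobolev

open Classical in
/-- The class in `L²(S²)` of a function on `ℝ³` whose restriction to the sphere is square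
integrable. -/
def cl (ψ : E3 → ℝ) : L2S := if h : MemLp (fun m : S2 => ψ m) 2 σ then h.toLp else 0

theorem coeFn_cl {ψ : E3 → ℝ} (hψ : ContDiff ℝ ∞ ψ) : cl ψ =ᵐ[σ] fun m : S2 => ψ m := by
  have h := memLp_of_contDiff hψ
  unfold cl
  rw [dif_pos h]
  exact h.coeFn_toLp

theorem inner_cl (x : L2S) {ψ : E3 → ℝ} (hψ : ContDiff ℝ ∞ ψ) :
    ⟪x, cl ψ⟫_ℝ = ∫ m, x m * ψ m ∂σ := inner_L2S_eq (ae_eq_refl _) (coeFn_cl hψ)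

theorem cl_pev (p : Poly) : cl (pev p) = pl p := by
  apply Lp.ext
  filter_upwards [coeFn_cl (contDiff_pev p), coeFn_pl p] with m h1 h2
  rw [h1, h2]

/-- The first order Sobolev space with weight `s²`: the vectors `(s u, s R_1 u, s R_2 u, s R_3 u)`. -/
def sobolev (s : E3 → ℝ) : Submodule ℝ (PiLp 2 fun _ : Fin 4 => L2S) where
  carrier := {v | ∀ (i : Fin 3) (ψ : E3 → ℝ), ContDiff ℝ ∞ ψ →
    ⟪v i.succ, cl fun x => (s x)⁻¹ * ψ x⟫_ℝ + ⟪v 0, cl fun x => (s x)⁻¹ * rot i ψ x⟫_ℝ = 0}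
  add_mem' {v w} hv hw i ψ hψ := by
    have h1 := hv i ψ hψ
    have h2 := hw i ψ hψ
    simp only [PiLp.add_apply, inner_add_left]
    linarith
  zero_mem' i ψ hψ := by simp
  smul_mem' c v hv i ψ hψ := by
    have h1 := hv i ψ hψ
    simp only [PiLp.smul_apply, inner_smul_left, ← mul_add, h1, mul_zero]

theorem isClosed_sobolev (s : E3 → ℝ) :
    IsClosed (sobolev s : Set (PiLp 2 fun _ : Fin 4 => L2S)) := by
  have : (sobolev s : Set (PiLp 2 fun _ : Fin 4 => L2S)) =
      ⋂ (i : Fin 3) (ψ : E3 → ℝ) (_ : ContDiff ℝ ∞ ψ),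
        {v | ⟪v i.succ, cl fun x => (s x)⁻¹ * ψ x⟫_ℝ
          + ⟪v 0, cl fun x => (s x)⁻¹ * rot i ψ x⟫_ℝ = 0} := by
    ext v
    simp [sobolev]
  rw [this]
  refine isClosed_iInter fun i => isClosed_iInter fun ψ => isClosed_iInter fun _ => ?_
  exact isClosed_eq (by fun_prop) continuous_const

instance (s : E3 → ℝ) : CompleteSpace (sobolev s) := (isClosed_sobolev s).completeSpace_coe

/-- The embedding `(s u, s R u) ↦ s u` of the weighted Sobolev space in `L²(S²)`. -/
def embed (s : E3 → ℝ) : sobolev s →L[ℝ] L2S :=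
  (PiLp.proj 2 (fun _ : Fin 4 => L2S) 0 : (PiLp 2 fun _ : Fin 4 => L2S) →L[ℝ] L2S) ∘L
    (sobolev s).subtypeL

theorem embed_apply (s : E3 → ℝ) (v : sobolev s) :
    embed s v = (v : PiLp 2 fun _ : Fin 4 => L2S) 0 := rfl

/-- The resolvent at `-1` of the operator `- s⁻¹ R · s² R s⁻¹`. -/
def resolv (s : E3 → ℝ) : L2S →L[ℝ] L2S := embed s ∘L (embed s).adjoint

theorem resolv_apply (s : E3 → ℝ) (x : L2S) : resolv s x = embed s ((embed s).adjoint x) := rfl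

theorem norm_sq_sobolev {s : E3 → ℝ} (v : sobolev s) :
    ‖v‖ ^ 2 = ‖embed s v‖ ^ 2 + ∑ i : Fin 3, ‖(v : PiLp 2 fun _ : Fin 4 => L2S) i.succ‖ ^ 2 := by
  rw [embed_apply, Submodule.coe_norm, PiLp.norm_sq_eq_of_L2, Fin.sum_univ_succ]

theorem inner_sobolev {s : E3 → ℝ} (v w : sobolev s) :
    ⟪v, w⟫_ℝ = ⟪embed s v, embed s w⟫_ℝ + ∑ i : Fin 3, ⟪(v : PiLp 2 fun _ : Fin 4 => L2S) i.succ,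
      (w : PiLp 2 fun _ : Fin 4 => L2S) i.succ⟫_ℝ := by
  rw [embed_apply, embed_apply, Submodule.coe_inner, PiLp.inner_apply, Fin.sum_univ_succ]

theorem norm_embed_le {s : E3 → ℝ} (v : sobolev s) : ‖embed s v‖ ≤ ‖v‖ := by
  rw [← sq_le_sq₀ (norm_nonneg _) (norm_nonneg _), norm_sq_sobolev]
  exact le_add_of_nonneg_right (Finset.sum_nonneg fun i _ => sq_nonneg _)

theorem inner_resolv (s : E3 → ℝ) (x y : L2S) :
    ⟪resolv s x, y⟫_ℝ = ⟪(embed s).adjoint x, (embed s).adjoint y⟫_ℝ := by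
  rw [resolv_apply, ContinuousLinearMap.adjoint_inner_right]

theorem resolv_symm (s : E3 → ℝ) (x y : L2S) : ⟪resolv s x, y⟫_ℝ = ⟪x, resolv s y⟫_ℝ := by
  rw [inner_resolv, resolv_apply, ContinuousLinearMap.adjoint_inner_left]

/-- J = E E* for the embedding E, which has norm at most one. -/
theorem norm_resolv_sq_le (s : E3 → ℝ) (x : L2S) : ‖resolv s x‖ ^ 2 ≤ ⟪resolv s x, x⟫_ℝ := by
  rw [inner_resolv, real_inner_self_eq_norm_sq, resolv_apply]
  have := norm_embed_le ((embed s).adjoint x)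
  gcongr

variable {s : E3 → ℝ} (hs : ContDiff ℝ ∞ s) (hpos : ∀ x, 0 < s x)

include hs hpos

theorem contDiff_inv_weight : ContDiff ℝ ∞ fun x => (s x)⁻¹ := hs.inv fun x => (hpos x).ne'

theorem exists_sobolev_of_contDiff {r : E3 → ℝ} (hr : ContDiff ℝ ∞ r) :
    ∃ v : sobolev s, embed s v = cl (fun x => s x * r x) ∧
      ∀ i : Fin 3, (v : PiLp 2 fun _ : Fin 4 => L2S) i.succ = cl fun x => s x * rot i r x := by
  refine ⟨⟨WithLp.toLp 2 (Fin.cons (cl fun x => s x * r x) fun i => cl fun x => s x * rot i r x),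
    fun i ψ hψ => ?_⟩, rfl, fun i => rfl⟩
  have hi := contDiff_inv_weight hs hpos
  have hri := contDiff_rot_infty i hr
  have hψi := contDiff_rot_infty i hψ
  change ⟪cl fun x => s x * rot i r x, _⟫_ℝ + ⟪cl fun x => s x * r x, _⟫_ℝ = 0
  rw [inner_L2S_eq (coeFn_cl (hs.mul hri)) (coeFn_cl (hi.mul hψ)),
    inner_L2S_eq (coeFn_cl (hs.mul hr)) (coeFn_cl (hi.mul hψi))]
  have e : ∀ (f g : E3 → ℝ) (m : S2), s m * f m * ((s m)⁻¹ * g m) = f m * g m := fun f g m => by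
    have := (hpos m).ne'
    field_simp
  simp only [e]
  rw [integral_mul_rot i (contDiff_one hr) (contDiff_one hψ)]
  ring

theorem hasWeakRot_of_sobolev (v : sobolev s) (i : Fin 3) :
    HasWeakRot i (fun m : S2 => (s m)⁻¹ * embed s v m)
      (fun m : S2 => (s m)⁻¹ * (v : PiLp 2 fun _ : Fin 4 => L2S) i.succ m) := by
  intro ψ hψ
  have hi := contDiff_inv_weight hs hpos
  have h := v.2 i ψ hψ
  rw [inner_cl _ (hi.mul hψ), inner_cl _ (hi.mul (contDiff_rot_infty i hψ))] at h
  have e : ∀ (x : L2S) (g : E3 → ℝ) (m : S2), (s m)⁻¹ * x m * g m = x m * ((s m)⁻¹ * g m) :=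
    fun x g m => by ring
  simp only [e, embed_apply]
  linarith

/-- The weak form of y - J y = A (J y): the defining relation of E*, with the L² part of the Sobolev
inner product moved to the left. -/
theorem inner_adjoint_embed (y : L2S) {r : E3 → ℝ} (hr : ContDiff ℝ ∞ r) :
    ⟪y - resolv s y, cl fun x => s x * r x⟫_ℝ = ∑ i : Fin 3,
      ⟪((embed s).adjoint y : PiLp 2 fun _ : Fin 4 => L2S) i.succ, cl fun x => s x * rot i r x⟫_ℝ := by
  obtain ⟨v, hv, hv'⟩ := exists_sobolev_of_contDiff hs hpos hr
  have h := inner_sobolev ((embed s).adjoint y) v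
  rw [ContinuousLinearMap.adjoint_inner_left, hv, ← resolv_apply] at h
  simp only [hv'] at h
  rw [inner_sub_left, h]
  ring

theorem eq_zero_of_resolv_eq_zero {x : L2S} (h : resolv s x = 0) : x = 0 := by
  have h1 : (embed s).adjoint x = 0 := by
    have := inner_resolv s x x
    rw [h, inner_zero_left] at this
    exact inner_self_eq_zero.1 this.symm
  refine eq_of_inner_pl fun p => ?_
  obtain ⟨v, hv, -⟩ := exists_sobolev_of_contDiff hs hpos
    ((contDiff_inv_weight hs hpos).mul (contDiff_pev p))
  have h2 := ContinuousLinearMap.adjoint_inner_left (embed s) v x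
  rw [h1, inner_zero_left, hv] at h2
  have e : (fun x => s x * ((s x)⁻¹ * pev p x)) = pev p := funext fun x => by
    have := (hpos x).ne'
    field_simp
  rw [e, cl_pev] at h2
  rw [← h2, inner_zero_left]

/-- A fixed vector satisfies ‖E* a‖ = ‖E E* a‖, so the gradient components of E* a vanish and a / s
is constant. -/
theorem exists_const_of_resolv_eq {a : L2S} (h : resolv s a = a) :
    ∃ c : ℝ, ∀ᵐ m : S2 ∂σ, a m = c * s m := by
  set v := (embed s).adjoint a with hv
  have hva : embed s v = a := h
  have h1 := inner_resolv s a a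
  rw [h, real_inner_self_eq_norm_sq, real_inner_self_eq_norm_sq, ← hv, norm_sq_sobolev, hva] at h1
  have h2 := (Finset.sum_eq_zero_iff_of_nonneg fun i _ => sq_nonneg _).1
    (by linarith : ∑ i : Fin 3, ‖(v : PiLp 2 fun _ : Fin 4 => L2S) i.succ‖ ^ 2 = 0)
  have h3 : ∀ i : Fin 3, (v : PiLp 2 fun _ : Fin 4 => L2S) i.succ = 0 := fun i => by
    simpa using h2 i (Finset.mem_univ i)
  have hi := contDiff_inv_weight hs hpos
  obtain ⟨c, hc⟩ := ae_const_of_hasWeakRot_zero (memLp_contDiff_mul hi (Lp.memLp a)) fun i => by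
    have h4 := hasWeakRot_of_sobolev hs hpos v i
    rw [hva, h3] at h4
    refine hasWeakRot_congr (ae_eq_refl _) ?_ h4
    filter_upwards [Lp.coeFn_zero ℝ 2 σ] with m hm
    change (s m)⁻¹ * ((0 : L2S) : S2 → ℝ) m = 0
    rw [hm, Pi.zero_apply, mul_zero]
  refine ⟨c, ?_⟩
  filter_upwards [hc] with m hm
  rw [← hm]
  have := (hpos m).ne'
  field_simp

theorem resolv_const_mul (c : ℝ) : resolv s (cl fun x => c * s x) = cl fun x => c * s x := by
  obtain ⟨v, hv, hv'⟩ := exists_sobolev_of_contDiff hs hpos (r := fun _ => c) contDiff_const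
  have e : (fun x => s x * c) = fun x => c * s x := funext fun x => mul_comm _ _
  rw [e] at hv
  have h0 : ∀ i : Fin 3, (v : PiLp 2 fun _ : Fin 4 => L2S) i.succ = 0 := fun i => by
    rw [hv' i]
    have : (fun x => s x * rot i (fun _ => c) x) = fun _ => 0 := funext fun x => by
      rw [rot_eq_rotAx, rotAx_const, mul_zero]
    rw [this]
    apply Lp.ext
    filter_upwards [coeFn_cl (ψ := fun _ => 0) contDiff_const, Lp.coeFn_zero ℝ 2 σ] with m h1 h2
    rw [h1, h2]
    rfl
  have h1 : (embed s).adjoint (cl fun x => c * s x) = v := by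
    refine ext_inner_right ℝ fun w => ?_
    rw [ContinuousLinearMap.adjoint_inner_left, inner_sobolev, hv]
    simp [h0]
  rw [resolv_apply, h1, hv]

/-- Elliptic regularity for the weighted operator. -/
theorem memH_two_resolv (y : L2S) : MemH 2 fun m : S2 => (s m)⁻¹ * resolv s y m := by
  set v := (embed s).adjoint y with hv
  have hi := contDiff_inv_weight hs hpos
  have hu : MemLp (fun m : S2 => (s m)⁻¹ * resolv s y m) 2 σ := memLp_contDiff_mul hi (Lp.memLp _)
  set V : Fin 3 → L2S := fun i => (v : PiLp 2 fun _ : Fin 4 => L2S) i.succ with hV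
  have hii : ContDiff ℝ ∞ fun x => (s x)⁻¹ * (s x)⁻¹ := hi.mul hi
  have ha : ∀ i, ContDiff ℝ ∞ fun x => s x * rot i (fun x => (s x)⁻¹ * (s x)⁻¹) x := fun i =>
    hs.mul (contDiff_rot_infty i hii)
  have hF1 : MemLp (fun m : S2 => (s m)⁻¹ * (y - resolv s y : L2S) m) 2 σ :=
    memLp_contDiff_mul hi (Lp.memLp _)
  have hF2 : ∀ i, MemLp (fun m : S2 => s m * rot i (fun x => (s x)⁻¹ * (s x)⁻¹) m * V i m) 2 σ :=
    fun i => memLp_contDiff_mul (ha i) (Lp.memLp _)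
  -- Testing the weighted equation with s⁻² p removes the weight from the principal part. The
  -- derivative falling on s⁻² gives a first order term in L², so `memH_two_of_weak` applies.
  refine (memH_two_of_weak (u := hu.toLp) (F := hu.toLp + (hF1.toLp - ∑ i, (hF2 i).toLp))
    fun p => ?_).congr hu.coeFn_toLp
  rw [helm_apply, map_sub, map_sum, inner_sub_right, inner_sum, inner_add_left, inner_sub_left,
    sum_inner]
  have h1 : ∀ i, ⟪hu.toLp, pl (rotP i (rotP i p))⟫_ℝ
      = - ∫ m : S2, (s m)⁻¹ * V i m * rot i (pev p) m ∂σ := fun i => by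
    rw [inner_toLp_pl, ← rot_pev, rot_pev i p]
    have := hasWeakRot_of_sobolev hs hpos v i _ (contDiff_pev (rotP i p))
    rw [hv, ← resolv_apply] at this
    linarith
  have h2 := inner_adjoint_embed hs hpos y (hii.mul (contDiff_pev p))
  have h3 : ∀ i, ⟪V i, cl fun x => s x * rot i (fun x => (s x)⁻¹ * (s x)⁻¹ * pev p x) x⟫_ℝ
      = ∫ m : S2, (s m)⁻¹ * V i m * rot i (pev p) m ∂σ
        + ⟪(hF2 i).toLp, pl p⟫_ℝ := fun i => by
    have hr := contDiff_rot_infty i (contDiff_pev p)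
    rw [inner_cl _ (hs.mul (contDiff_rot_infty i (hii.mul (contDiff_pev p)))), inner_toLp_pl,
      ← integral_add]
    · refine integral_congr_ae (.of_forall fun m => ?_)
      have := (hpos m).ne'
      simp only [rot_mul i (contDiff_one hii) (contDiff_one (contDiff_pev p))]
      field_simp
    · exact integrable_mul_of_memLp (memLp_contDiff_mul hi (Lp.memLp _)) (memLp_of_contDiff hr)
    · exact integrable_mul_of_memLp (hF2 i) (memLp_of_contDiff (contDiff_pev p))
  have h4 : ⟪y - resolv s y, cl fun x => s x * ((s x)⁻¹ * (s x)⁻¹ * pev p x)⟫_ℝ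
      = ⟪hF1.toLp, pl p⟫_ℝ := by
    rw [inner_cl _ (hs.mul (hii.mul (contDiff_pev p))), inner_toLp_pl]
    refine integral_congr_ae (.of_forall fun m => ?_)
    have := (hpos m).ne'
    simp only
    field_simp
  rw [h4] at h2
  change _ = ∑ i, ⟪V i, _⟫_ℝ at h2
  simp only [h3, Finset.sum_add_distrib] at h2
  simp only [h1, Finset.sum_neg_distrib]
  linarith

end WeightedSobolev

/-! ### Finite linear combinations as operators on Euclidean space, and their adjoints. -/

section Comb

variable {X : Type*} [NormedAddCommGroup X] [InnerProductSpace ℝ X] [CompleteSpace X]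
  {ι : Type*} [Fintype ι]

/-- The linear combinations of a finite family. -/
def comb (e : ι → X) : EuclideanSpace ℝ ι →L[ℝ] X :=
  ∑ i, (EuclideanSpace.proj i : EuclideanSpace ℝ ι →L[ℝ] ℝ).smulRight (e i)

omit [CompleteSpace X] in
theorem comb_apply (e : ι → X) (q : EuclideanSpace ℝ ι) : comb e q = ∑ i, q i • e i := by
  simp [comb]

theorem comb_adjoint_apply (e : ι → X) (x : X) (i : ι) : (comb e).adjoint x i = ⟪e i, x⟫_ℝ := by
  classical
  have h := ContinuousLinearMap.adjoint_inner_right (comb e) (EuclideanSpace.single i 1) x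
  rw [EuclideanSpace.inner_single_left, comb_apply] at h
  simpa using h

end Comb

theorem HasWeakRot.const_mul {i : Fin 3} {f g : S2 → ℝ} (c : ℝ) (h : HasWeakRot i f g) :
    HasWeakRot i (fun m => c * f m) fun m => c * g m := by
  intro ψ hψ
  simp only [mul_assoc]
  rw [integral_const_mul, integral_const_mul, h ψ hψ, mul_neg]

theorem coeFn_finsetSum {ι : Type*} (t : Finset ι) (f : ι → L2S) :
    ∀ᵐ m ∂σ, (∑ i ∈ t, f i : L2S) m = ∑ i ∈ t, f i m := by
  classical
  induction t using Finset.induction_on with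
  | empty =>
    filter_upwards [Lp.coeFn_zero ℝ 2 σ] with m hm
    simpa using hm
  | insert a t ha ih =>
    filter_upwards [ih, Lp.coeFn_add (f a) (∑ i ∈ t, f i)] with m h1 h2
    rw [Finset.sum_insert ha, Finset.sum_insert ha, h2, Pi.add_apply, h1]

/-! ### A positive eigenvalue on the unstable branch. -/

section Instability

variable (b : OrthonormalBasis (Fin 3) ℝ E3) (η : ℝ)

/-- The square root of the density. -/
def sqrtDensity (x : E3) : ℝ := √(density η (b 2) x)

theorem sqrtDensity_pos (x : E3) : 0 < sqrtDensity b η x := Real.sqrt_pos.2 (density_pos b η x)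

theorem sqrtDensity_mul_self (x : E3) : sqrtDensity b η x * sqrtDensity b η x = density η (b 2) x :=
  Real.mul_self_sqrt (density_pos b η x).le

theorem contDiff_sqrtDensity : ContDiff ℝ ∞ (sqrtDensity b η) :=
  (contDiff_density b η).sqrt fun x => (density_pos b η x).ne'

theorem contDiff_sqrtDensity_mul_co (k l : Fin 3) :
    ContDiff ℝ ∞ fun x => sqrtDensity b η x * (co b k x * co b l x) :=
  (contDiff_sqrtDensity b η).mul ((contDiff_co b k).mul (contDiff_co b l))

/-- The finite rank operator whose square is minus the potential, conjugated by the square root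
of the density. -/
def rootPotential (α : ℝ) : EuclideanSpace ℝ (Fin 3 × Fin 3) →L[ℝ] L2S :=
  comb fun p => √α • cl fun x => sqrtDensity b η x * (co b p.1 x * co b p.2 x)

theorem rootPotential_ae (α : ℝ) (q : EuclideanSpace ℝ (Fin 3 × Fin 3)) :
    ∀ᵐ m : S2 ∂σ, rootPotential b η α q m
      = √α * sqrtDensity b η m * ∑ k, ∑ l, q (k, l) * (co b k m * co b l m) := by
  have h1 : rootPotential b η α q = √α • ∑ p : Fin 3 × Fin 3,
      q p • cl fun x => sqrtDensity b η x * (co b p.1 x * co b p.2 x) := by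
    rw [rootPotential, comb_apply, Finset.smul_sum]
    exact Finset.sum_congr rfl fun p _ => smul_comm _ _ _
  have h2 := fun p : Fin 3 × Fin 3 => Lp.coeFn_smul (q p)
    (cl fun x => sqrtDensity b η x * (co b p.1 x * co b p.2 x))
  have h3 := fun p : Fin 3 × Fin 3 => coeFn_cl (contDiff_sqrtDensity_mul_co b η p.1 p.2)
  rw [h1]
  filter_upwards [Lp.coeFn_smul (√α) (∑ p : Fin 3 × Fin 3,
      q p • cl fun x => sqrtDensity b η x * (co b p.1 x * co b p.2 x)),
    coeFn_finsetSum Finset.univ fun p : Fin 3 × Fin 3 =>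
      q p • cl fun x => sqrtDensity b η x * (co b p.1 x * co b p.2 x),
    ae_all_iff.2 h2, ae_all_iff.2 h3] with m a1 a2 a3 a4
  rw [a1, Pi.smul_apply, a2, smul_eq_mul, mul_assoc, Finset.mul_sum (a := sqrtDensity b η m),
    ← Finset.univ_product_univ, Finset.sum_product]
  congr 1
  refine Finset.sum_congr rfl fun k _ => ?_
  rw [Finset.mul_sum]
  refine Finset.sum_congr rfl fun l _ => ?_
  rw [a3, Pi.smul_apply, a4, smul_eq_mul]
  ring

theorem rootPotential_adjoint {α : ℝ} (ψ : L2S) (k l : Fin 3) :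
    (rootPotential b η α).adjoint ψ (k, l)
      = √α * smom b (fun m : S2 => sqrtDensity b η m * ψ m) k l := by
  rw [rootPotential, comb_adjoint_apply, real_inner_smul_left, real_inner_comm,
    inner_cl _ (contDiff_sqrtDensity_mul_co b η k l)]
  congr 1
  exact integral_congr_ae (.of_forall fun m => by ring)

/-- If the potential is strong enough against some quadratic form, the pencil of the linearized
operator has a solution. -/
theorem exists_pencil_solution_density {α κ : ℝ} (hα : 0 < α)
    (q₀ : EuclideanSpace ℝ (Fin 3 × Fin 3)) (c : Fin 5 → ℝ)
    (hq : ∀ m : S2, ∑ k, ∑ l, q₀ (k, l) * (co b k m * co b l m) = κ + quad b η c m)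
    (hlt : ‖q₀‖ ^ 2 < α * ∫ m : S2, quad b η c m * quad b η c m * density η (b 2) m ∂σ) :
    ∃ (t : ℝ) (y : L2S), 0 < t ∧ y - resolv (sqrtDensity b η) y ≠ 0 ∧
      (y - resolv (sqrtDensity b η) y) + t • resolv (sqrtDensity b η) y
        = rootPotential b η α ((rootPotential b η α).adjoint (y - resolv (sqrtDensity b η) y)) := by
  have hs := contDiff_sqrtDensity b η
  have hpos := sqrtDensity_pos b η
  have hzc : ContDiff ℝ ∞ fun x => √α * sqrtDensity b η x * quad b η c x :=
    (contDiff_const.mul hs).mul (contDiff_quad b η c)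
  have hac : ContDiff ℝ ∞ fun x => √α * κ * sqrtDensity b η x := contDiff_const.mul hs
  -- The fixed vectors of J are the multiples of s. The constant κ thus supplies the fixed part a,
  -- and the form `quad`, which has mean zero for the density, supplies the orthogonal part z.
  refine exists_pencil_solution (norm_resolv_sq_le _) (resolv_symm _)
    (fun x => eq_zero_of_resolv_eq_zero hs hpos) (rootPotential b η α) (q₀ := q₀)
    (a := cl fun x => √α * κ * sqrtDensity b η x)
    (z := cl fun x => √α * sqrtDensity b η x * quad b η c x) ?_ (resolv_const_mul hs hpos _) ?_ ?_
  · apply Lp.ext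
    filter_upwards [rootPotential_ae b η α q₀, Lp.coeFn_add (cl fun x => √α * κ * sqrtDensity b η x)
      (cl fun x => √α * sqrtDensity b η x * quad b η c x), coeFn_cl hac, coeFn_cl hzc]
      with m a1 a2 a3 a4
    rw [a1, a2, Pi.add_apply, a3, a4, hq]
    ring
  · intro a ha
    obtain ⟨d, hd⟩ := exists_const_of_resolv_eq hs hpos ha
    rw [inner_L2S_eq hd (coeFn_cl hzc)]
    have h := integral_quad b η c
    calc _ = ∫ m : S2, (d * √α) * (quad b η c m * density η (b 2) m) ∂σ := by
          refine integral_congr_ae (.of_forall fun m => ?_)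
          simp only [← sqrtDensity_mul_self]
          ring
      _ = 0 := by rw [integral_const_mul, h, mul_zero]
  · rw [← real_inner_self_eq_norm_sq (F := L2S), inner_L2S_eq (coeFn_cl hzc) (coeFn_cl hzc)]
    refine hlt.trans_eq ?_
    rw [← integral_const_mul]
    refine integral_congr_ae (.of_forall fun m => ?_)
    simp only [← sqrtDensity_mul_self]
    have := Real.mul_self_sqrt hα.le
    linear_combination (-(sqrtDensity b η m * sqrtDensity b η m * quad b η c m * quad b η c m)) * this

/-- A solution of the pencil is an eigenfunction of the linearized operator. -/
theorem isEigenvalueG_of_pencil {α : ℝ} (hη : η ∈ branchSet α) (hα : 0 < α) {t : ℝ} {y : L2S}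
    (hy : y - resolv (sqrtDensity b η) y ≠ 0)
    (h : (y - resolv (sqrtDensity b η) y) + t • resolv (sqrtDensity b η) y
      = rootPotential b η α ((rootPotential b η α).adjoint (y - resolv (sqrtDensity b η) y))) :
    IsEigenvalueG α (fun m => density η (b 2) m) t := by
  set s := sqrtDensity b η with hs_def
  have hs : ContDiff ℝ ∞ s := contDiff_sqrtDensity b η
  have hpos : ∀ x, 0 < s x := sqrtDensity_pos b η
  have hss : ∀ x, s x * s x = density η (b 2) x := sqrtDensity_mul_self b η
  -- The eigenfunction is f = sψ. The pencil equation says H f = -t s⁻¹ J y, and ψ = A (J y) then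
  -- gives G f = t f.
  set ψ := y - resolv s y with hψ
  have hf : MemLp (fun m : S2 => s m * ψ m) 2 σ := memLp_contDiff_mul hs (Lp.memLp ψ)
  set M := smom b (fun m : S2 => s m * ψ m) with hM
  have hψae : ∀ᵐ m : S2 ∂σ, ψ m + t * resolv s y m
      = α * s m * ∑ k, ∑ l, M k l * (co b k m * co b l m) := by
    filter_upwards [rootPotential_ae b η α ((rootPotential b η α).adjoint ψ),
      Lp.coeFn_add ψ (t • resolv s y), Lp.coeFn_smul t (resolv s y)] with m a1 a2 a3
    rw [← h, a2, Pi.add_apply, a3, Pi.smul_apply, smul_eq_mul] at a1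
    rw [a1]
    simp only [rootPotential_adjoint, mul_assoc, ← Finset.mul_sum]
    have := Real.mul_self_sqrt hα.le
    linear_combination (s m * ∑ k, ∑ l, M k l * (co b k m * co b l m)) * this
  -- Testing ψ = A (J y) with the constant function gives mean zero, so the potential of f consists
  -- of its second-moment part alone.
  have h0 : ∫ m : S2, s m * ψ m ∂σ = 0 := by
    have h1 := inner_adjoint_embed hs hpos y (r := fun _ => 1) contDiff_const
    rw [← hψ, inner_cl _ (hs.mul contDiff_const)] at h1
    have e : ∀ i, (fun x => s x * rot i (fun _ => 1) x) = fun _ => (0 : ℝ) := fun i =>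
      funext fun x => by rw [rot_eq_rotAx, rotAx_const, mul_zero]
    simp only [e, inner_cl _ (contDiff_const : ContDiff ℝ ∞ fun _ : E3 => (0 : ℝ)), mul_zero,
      integral_zero, Finset.sum_const_zero, mul_one] at h1
    rw [← h1]
    exact integral_congr_ae (.of_forall fun m => mul_comm _ _)
  have hreg := memH_two_resolv hs hpos y
  have hpolyc : ContDiff ℝ ∞ fun x => density η (b 2) x *
      (α * ∑ k, ∑ l, M k l * (co b k x * co b l x)) :=
    (contDiff_density b η).mul (contDiff_const.mul (ContDiff.sum fun k _ => ContDiff.sum fun l _ =>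
      contDiff_const.mul ((contDiff_co b k).mul (contDiff_co b l))))
  -- The equation writes f as h times a polynomial minus t h · (s⁻¹ J y), and the last factor is in
  -- H² by elliptic regularity.
  have hH : MemH 2 fun m : S2 => s m * ψ m := by
    refine MemH.congr ?_ ((memH_of_contDiff 2 hpolyc).add
      (MemH.mul (a := fun x => -t * density η (b 2) x)
        (contDiff_const.mul (contDiff_density b η)) hreg))
    filter_upwards [hψae] with m hm
    rw [eq_sub_of_add_eq hm]
    simp only [← hss]
    have := (hpos m).ne'
    field_simp
    ring
  have hopH : opH α (fun m => density η (b 2) m) (fun m => s m * ψ m)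
      =ᵐ[σ] fun m => -t * ((s m)⁻¹ * resolv s y m) := by
    filter_upwards [hψae] with m hm
    unfold opH
    rw [potential_eq b α hf, h0]
    simp only [← hss, eq_sub_of_add_eq hm, ← hM]
    have := (hpos m).ne'
    field_simp
    ring
  have hae := hf.coeFn_toLp
  replace hH := hH.congr hae.symm
  replace hopH := (opH_congr α (fun m => density η (b 2) m) hae).trans hopH
  obtain ⟨-, g, k, hg, hk, hug, hhk, hG⟩ := opG_divergence_form b η hη hH
  set V : Fin 3 → L2S := fun i => ((embed s).adjoint y : PiLp 2 fun _ : Fin 4 => L2S) i.succ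
  have hgV : ∀ i, g i =ᵐ[σ] fun m => -t * ((s m)⁻¹ * V i m) := fun i =>
    (hug i).unique (hg i)
      ((memLp_contDiff_mul (contDiff_inv_weight hs hpos) (Lp.memLp (V i))).const_mul (-t))
      (hasWeakRot_congr hopH.symm (ae_eq_refl _)
        ((hasWeakRot_of_sobolev hs hpos ((embed s).adjoint y) i).const_mul (-t)))
  have hsum : ∑ i, (hk i).toLp (k i) = t • hf.toLp := by
    refine eq_of_inner_pl fun p => ?_
    have h1 := inner_adjoint_embed hs hpos y (contDiff_pev p)
    rw [← hψ, inner_cl _ (hs.mul (contDiff_pev p))] at h1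
    rw [sum_inner, real_inner_smul_left, inner_toLp_pl]
    have h2 : ∀ i, ⟪(hk i).toLp (k i), pl p⟫_ℝ
        = t * ⟪V i, cl fun x => s x * rot i (pev p) x⟫_ℝ := fun i => by
      rw [inner_toLp_pl, hhk i _ (contDiff_pev p),
        inner_cl _ (hs.mul (contDiff_rot_infty i (contDiff_pev p))), ← integral_const_mul,
        ← integral_neg]
      refine integral_congr_ae ?_
      filter_upwards [hgV i] with m hm
      rw [hm, ← hss]
      have := (hpos m).ne'
      field_simp
    simp only [h2]
    rw [← Finset.mul_sum, ← h1]
    congr 1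
    exact integral_congr_ae (.of_forall fun m => by ring)
  refine ⟨hf.toLp, fun hzero => hy ?_, hH, ?_⟩
  · apply Lp.ext
    rw [hzero] at hae
    filter_upwards [hae, Lp.coeFn_zero ℝ 2 σ] with m a1 a2
    rw [a2] at a1 ⊢
    exact (mul_eq_zero.1 a1.symm).resolve_left (hpos m).ne'
  · have h3 := coeFn_finsetSum Finset.univ fun i => (hk i).toLp (k i)
    rw [hsum] at h3
    filter_upwards [hG, h3, Lp.coeFn_smul t (hf.toLp), ae_all_iff.2 fun i => (hk i).coeFn_toLp]
      with m a1 a2 a3 a4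
    rw [a1, ← smul_eq_mul, ← Pi.smul_apply, ← a3, a2]
    exact Finset.sum_congr rfl fun i _ => (a4 i).symm

theorem exists_pos_isEigenvalueG {α : ℝ} (hη : η ∈ branchSet α) (hα : 0 < α)
    (h : 1 < 3 / 2 * α * var2 η ∨ 1 < 2 * α * mix η) :
    ∃ μ, 0 < μ ∧ IsEigenvalueG α (fun m => density η (b 2) m) μ := by
  suffices ∃ (κ : ℝ) (q₀ : EuclideanSpace ℝ (Fin 3 × Fin 3)) (c : Fin 5 → ℝ),
      (∀ m : S2, ∑ k, ∑ l, q₀ (k, l) * (co b k m * co b l m) = κ + quad b η c m) ∧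
      ‖q₀‖ ^ 2 < α * ∫ m : S2, quad b η c m * quad b η c m * density η (b 2) m ∂σ by
    obtain ⟨κ, q₀, c, hq, hlt⟩ := this
    obtain ⟨t, y, ht, hy, he⟩ := exists_pencil_solution_density b η hα q₀ c hq hlt
    exact ⟨t, ht, isEigenvalueG_of_pencil b η hη hα hy he⟩
  rcases h with h | h
  -- The traceless matrix of (3 z² - 1) / 2 has squared norm 3/2, and its quadratic integral is
  -- (9/4) var2: the required inequality is 1 < (3/2) α var2.
  · refine ⟨3 / 2 * avg 2 η - 1 / 2, WithLp.toLp 2 fun p =>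
      (![![-1 / 2, 0, 0], ![0, -1 / 2, 0], ![0, 0, 1]] : Fin 3 → Fin 3 → ℝ) p.1 p.2,
      ![3 / 2, 0, 0, 0, 0], fun m => ?_, ?_⟩
    · have := sum_co_sq b m
      simp only [Fin.sum_univ_three, quad, Matrix.cons_val]
      linear_combination (-1 / 2) * this
    · rw [integral_quad_mul, EuclideanSpace.norm_sq_eq, ← Finset.univ_product_univ,
        Finset.sum_product]
      simp only [Fin.sum_univ_three, Matrix.cons_val]
      norm_num
      linarith
  -- The matrix of 2xy has squared norm 2, and its quadratic integral is 4 mix: the required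
  -- inequality is 1 < 2 α mix.
  · refine ⟨0, WithLp.toLp 2 fun p =>
      (![![0, 1, 0], ![1, 0, 0], ![0, 0, 0]] : Fin 3 → Fin 3 → ℝ) p.1 p.2,
      ![0, 0, 2, 0, 0], fun m => ?_, ?_⟩
    · simp only [Fin.sum_univ_three, quad, Matrix.cons_val]
      ring
    · rw [integral_quad_mul, EuclideanSpace.norm_sq_eq, ← Finset.univ_product_univ,
        Finset.sum_product]
      simp only [Fin.sum_univ_three, Matrix.cons_val]
      norm_num
      linarith

end Instability

end DoiOnsager

end

/-! ### Assembly of the theorem in an orthonormal basis whose last vector is n. -/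

open DoiOnsager in
theorem theorem4p1 (α : ℝ) (hα : alphaStar < α) (n : E3) (hn : ‖n‖ = 1)
    (h₁ h₂ : E3 → ℝ) (hh₁ : h₁ = density (eta1 α) n) (hh₂ : h₂ = density (eta2 α) n) :
    (branchSet α = {eta1 α, eta2 α} ∧ eta2 α < eta1 α) ∧
    (IsCriticalPoint α (fun m => h₁ m) ∧ SecondVariationNonneg α (fun m => h₁ m)) ∧
    (IsCriticalPoint α (fun m => h₂ m) ∧
      (α ≠ 15 / 2 → ¬ SecondVariationNonneg α (fun m => h₂ m))) ∧
    (∀ μ : ℝ, 0 < μ → ¬ IsEigenvalueG α (fun m => h₁ m) μ) ∧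
    (α ≠ 15 / 2 → ∃ μ : ℝ, 0 < μ ∧ IsEigenvalueG α (fun m => h₂ m) μ) ∧
    (kerG α (fun m => h₁ m) =
      {φ : L2S | ∃ Θ : E3, ∀ᵐ m : S2 ∂σ, φ m = ∑ i, Θ i * rot i h₁ m}) ∧
    (∃ K : Submodule ℝ L2S, (K : Set L2S) = kerG α (fun m => h₁ m) ∧
      Module.finrank ℝ K = 2) ∧
    (∀ φ : L2S, φ ∈ kerG α (fun m => h₁ m) →
      ∀ᵐ m ∂σ, opH α (fun m => h₁ m) φ m = 0) := by
  subst hh₁ hh₂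
  obtain ⟨b, rfl⟩ := exists_orthonormalBasis_axis hn
  obtain ⟨hpair, h1pos, h1disc, h2disc⟩ := branchSet_eq_pair hα
  have hα0 := (alphaStar_lt_iff_exists hα).1
  have hm1 : eta1 α ∈ branchSet α := by rw [hpair.1]; exact Or.inl rfl
  have hm2 : eta2 α ∈ branchSet α := by rw [hpair.1]; exact Or.inr rfl
  obtain ⟨s1, s2⟩ := stable_coefs hm1 hα0 h1pos h1disc
  have hstab := secondVariationNonneg_density b (eta1 α) hm1 hα0 s1.le s2.le
  have hker := kerG_eq b (eta1 α) hm1 hα0 s1 s2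
  have hunst := fun h => unstable_coefs hm2 hα0 (eta2_ne_zero hα h) h2disc
  refine ⟨hpair, ⟨isCriticalPoint_density b _ hm1, hstab⟩, ⟨isCriticalPoint_density b _ hm2,
    fun h => not_secondVariationNonneg_density b _ (hunst h)⟩,
    fun μ hμ => not_isEigenvalueG b _ hm1 hstab hμ,
    fun h => exists_pos_isEigenvalueG b _ hm2 hα0 (hunst h), ?_,
    exists_submodule_kerG b _ hm1 hα0 s1 s2, fun φ hφ => ?_⟩
  · rw [hker]
    ext φ
    constructor
    · rintro ⟨p, q, h⟩
      -- Every pair p, q comes from a rotation only because η₁ ≠ 0; at η = 0 the density is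
      -- isotropic and its rotational gradient vanishes.
      obtain ⟨Θ, hΘ⟩ := exists_sum_mul_rot_density b (eta1 α) h1pos.ne' p q
      refine ⟨Θ, ?_⟩
      filter_upwards [h] with m hm
      rw [hm, hΘ]
    · rintro ⟨Θ, h⟩
      refine ⟨2 * eta1 α * ⟪cross Θ (b 0), b 2⟫_ℝ, 2 * eta1 α * ⟪cross Θ (b 1), b 2⟫_ℝ, ?_⟩
      filter_upwards [h] with m hm
      rw [hm, sum_mul_rot_density]
  · rw [hker] at hφ
    obtain ⟨p, q, h⟩ := hφ
    filter_upwards [opH_congr α (fun m : S2 => density (eta1 α) (b 2) m) h] with m hm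
    rw [hm, opH_density_mul_quad b _ hm1]
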